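/- Let $\langle x\rangle=(1+x^2)^{1/2}$, let $\hat{\ }$ (or $\mathcal F$) denote the Fourier transform, and for $\mu>0$ let $\widehat{L^\infty_\mu}=\{u\in\mathcal S'(\mathbb R):\ \hat u \text{ is a function with } \|u\|_{\widehat{L^\infty_\mu}}:=\|\langle\xi\rangle^\mu\hat u\|_{L^\infty}<\infty\}$. For every $\mu>0$ the modified Korteweg–de Vries equation $$\partial_t u+\partial_x^3u=\sigma\,\partial_x(u^3),\qquad u(t,x)\in\mathbb R,\quad \sigma\in\{1,-1\},$$ is locally well-posed in $\widehat{L^\infty_\mu}$ in the following sense. There is $b>1/2$, depending only on $\mu$, such that, with $$\|u\|_{X^{\mu,b}_\infty}=\big\|\langle\tau\rangle^b\langle\xi\rangle^\mu\mathcal F_{t,x}(e^{t\partial_x^3}u)(\tau,\xi)\big\|_{L^2_\tau L^\infty_\xi}$$ and with $X^{\mu,b}_\infty(T)$ the space of restrictions to $[-T,T]$ (with the infimum norm over extensions), the following holds. A solution on $[-T,T]$ with datum $u_0$ means a real-valued $u\in X^{\mu,b}_\infty(T)$ with $$u(t)=e^{-t\partial_x^3}u_0+\sigma\int_0^te^{-(t-s)\partial_x^3}\partial_x(u^3)(s)\,ds,\qquad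 t\in[-T,T],$$ where $u^3$ is defined, from an extension of $u$ in $X^{\mu,b}_\infty$, by the almost everywhere absolutely convergent triple convolution of its space-time Fourier transform, and the Duhamel integral is defined by the absolutely convergent $\tau$-integral in Fourier variables. 1. (Uniqueness) For every $T>0$, two solutions on $[-T,T]$ with the same datum coincide on $[-T,T]$. 2. For every $R>0$ there are $T>0$ and $C\ge0$ such that: (a) (Existence and persistence) for every real-valued $u_0$ with $\|u_0\|_{\widehat{L^\infty_\mu}}\le R$ there is a solution $u$ on $[-T,T]$ with $u(0)=u_0$; it is continuous with values in $\mathcal S'(\mathbb R)$, it takes values in $\widehat{L^\infty_\mu}$, and $t\mapsto e^{t\partial_x^3}u(t)$ is continuous from $[-T,T]$ to $\widehat{L^\infty_\mu}$ in norm; (b) (Lipschitz dependence) if $u,v$ are solutions on $[-T,T]$ with data $u_0,v_0$ of norm at most $R$, then $$\|u-v\|_{X^{\mu,b}_\infty(T)}\le C\|u_0-v_0\|_{\widehat{L^\infty_\mu}}\quad\text{and}\quad \sup_{|t|\le T}\|u(t)-v(t)\|_{\widehat{L^\infty_\mu}}\le C\|u_0-v_0\|_{\widehat{L^\infty_\mu}}.$$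 -/

import Mathlib

open MeasureTheory Set Filter Topology SchwartzMap FourierTransform
open scoped NNReal ENNReal

noncomputable section

namespace MKdV

/-- The Japanese bracket `⟨x⟩ = (1 + x²)^{1/2}`. -/
def japaneseBracket (x : ℝ) : ℝ := Real.sqrt (1 + x ^ 2)

/-- The Fourier transform of the tempered distribution `u` on `ℝ` is (given by) the function `f`.
The Fourier transform is Mathlib's, `f̂(ξ) = ∫ e^{-2πixξ} f(x) dx`. -/
def HasFourier (u : 𝓢'(ℝ, ℂ)) (f : ℝ → ℂ) : Prop :=
  AEStronglyMeasurable f volume ∧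
    ∀ φ : 𝓢(ℝ, ℂ), Integrable (fun ξ => f ξ * φ ξ) volume ∧ (𝓕 u) φ = ∫ ξ, f ξ * φ ξ

/-- The weighted norm `‖⟨ξ⟩^μ f‖_{L^∞}`. -/
def weightedSup (μ : ℝ) (f : ℝ → ℂ) : ℝ≥0∞ :=
  eLpNorm (fun ξ => ((japaneseBracket ξ ^ μ : ℝ) : ℂ) * f ξ) ⊤ volume

/-- The norm `‖⟨ξ⟩^μ û‖_{L^∞}` of a tempered distribution `u`, with value `∞` if `û` is not a
function. (The function `û` is unique almost everywhere.) -/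
def normFL (μ : ℝ) (u : 𝓢'(ℝ, ℂ)) : ℝ≥0∞ :=
  ⨅ (f : ℝ → ℂ) (_ : HasFourier u f), weightedSup μ f

/-- A tempered distribution is real-valued if it is real on real-valued test functions. -/
def IsReal (u : 𝓢'(ℝ, ℂ)) : Prop :=
  ∀ φ : 𝓢(ℝ, ℂ), (∀ x, (φ x).im = 0) → (u φ).im = 0

/-- The dispersion relation: in the normalisation `f̂(ξ) = ∫ e^{-2πixξ} f(x) dx`, the group
`e^{-t∂ₓ³}` acts as multiplication by `e^{-t(2πiξ)³} = e^{2πi t ω(ξ)}`, `ω(ξ) = 4π²ξ³`. -/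
def omega (ξ : ℝ) : ℝ := 4 * Real.pi ^ 2 * ξ ^ 3

/-- The character `e^{2πi x}`. -/
def cexp2 (x : ℝ) : ℂ := Complex.exp (2 * Real.pi * x * Complex.I)

/-- The Bourgain norm `‖⟨τ⟩^b ⟨ξ⟩^μ 𝓕_{t,x}(e^{t∂ₓ³}u)‖_{L²_τ L^∞_ξ}`, written in terms of the
space-time Fourier transform `F(τ, ξ)` of `u`, so that
`𝓕_{t,x}(e^{t∂ₓ³}u)(τ, ξ) = F(τ + ω(ξ), ξ)`. -/
def bourgainNorm (μ b : ℝ) (F : ℝ × ℝ → ℂ) : ℝ≥0∞ :=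
  eLpNorm (fun τ : ℝ => ENNReal.ofReal (japaneseBracket τ ^ b) *
    weightedSup μ (fun ξ => F (τ + omega ξ, ξ))) 2 volume

/-- The spatial Fourier transform at time `t` of the function with space-time Fourier
transform `F`. -/
def timeSlice (F : ℝ × ℝ → ℂ) (t ξ : ℝ) : ℂ := ∫ τ : ℝ, cexp2 (t * τ) * F (τ, ξ)

/-- `F` is (the space-time Fourier transform of) an extension to all times of the curve `u`
of tempered distributions on the time interval `[-T, T]`. -/
def IsExtension (T : ℝ) (u : ℝ → 𝓢'(ℝ, ℂ)) (F : ℝ × ℝ → ℂ) : Prop :=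
  AEStronglyMeasurable F volume ∧ ∀ t ∈ Icc (-T) T, HasFourier (u t) (timeSlice F t)

/-- The norm of the Bourgain space restricted to the time interval `[-T, T]`: the infimum of the
Bourgain norms of all extensions. -/
def restrictedNorm (μ b T : ℝ) (u : ℝ → 𝓢'(ℝ, ℂ)) : ℝ≥0∞ :=
  ⨅ (F : ℝ × ℝ → ℂ) (_ : IsExtension T u F), bourgainNorm μ b F

/-- The integrand of the triple convolution `(F * F * F)(q)`. -/
def cubeIntegrand (F : ℝ × ℝ → ℂ) (q : ℝ × ℝ) (p : (ℝ × ℝ) × (ℝ × ℝ)) : ℂ :=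
  F p.1 * F p.2 * F (q - p.1 - p.2)

/-- The space-time Fourier transform `F * F * F` of `u³`, where `F` is that of `u`. -/
def cubeFourier (F : ℝ × ℝ → ℂ) (q : ℝ × ℝ) : ℂ := ∫ p, cubeIntegrand F q p

/-- The spatial Fourier transform of `∫₀ᵗ e^{-(t-s)∂ₓ³} g(s) ds` for `𝓕ₓ g(s, ξ) = e^{2πi s τ}`. -/
def duhamelKernel (t τ ξ : ℝ) : ℂ :=
  ∫ s in (0 : ℝ)..t, cexp2 ((t - s) * omega ξ) * cexp2 (s * τ)

/-- The spatial Fourier transform of `∫₀ᵗ e^{-(t-s)∂ₓ³} ∂ₓ(u³)(s) ds`, where `F` is the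
space-time Fourier transform of `u`. -/
def duhamel (F : ℝ × ℝ → ℂ) (t ξ : ℝ) : ℂ :=
  (2 * Real.pi * ξ * Complex.I) * ∫ τ : ℝ, duhamelKernel t τ ξ * cubeFourier F (τ, ξ)

/-- `u` is a real-valued solution on `[-T, T]`, in the restricted Bourgain space, of
`∂ₜu + ∂ₓ³u = σ ∂ₓ(u³)`, `u(0) = u₀`, that is
`u(t) = e^{-t∂ₓ³}u₀ + σ ∫₀ᵗ e^{-(t-s)∂ₓ³} ∂ₓ(u³)(s) ds` for all `t ∈ [-T, T]`.
The integrals that define the nonlinear term converge absolutely. -/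
def IsSolution (σ μ b T : ℝ) (u₀ : 𝓢'(ℝ, ℂ)) (u : ℝ → 𝓢'(ℝ, ℂ)) : Prop :=
  (∀ t ∈ Icc (-T) T, IsReal (u t)) ∧
  ∃ F : ℝ × ℝ → ℂ, IsExtension T u F ∧ bourgainNorm μ b F < ⊤ ∧
    (∀ᵐ q : ℝ × ℝ, Integrable (cubeIntegrand F q) volume) ∧
    (∀ t ∈ Icc (-T) T, ∀ᵐ ξ : ℝ,
      Integrable (fun τ => duhamelKernel t τ ξ * cubeFourier F (τ, ξ)) volume) ∧
    ∃ f₀ : ℝ → ℂ, HasFourier u₀ f₀ ∧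
      ∀ t ∈ Icc (-T) T, HasFourier (u t)
        (fun ξ => cexp2 (t * omega ξ) * f₀ ξ + (σ : ℂ) * duhamel F t ξ)

/-- The curve `t ↦ e^{t∂ₓ³}u(t)` is continuous on `[-T, T]` for the norm `‖⟨ξ⟩^μ ·̂‖_{L^∞}`
(and takes values in the corresponding space). -/
def ProfileContinuousOn (μ T : ℝ) (u : ℝ → 𝓢'(ℝ, ℂ)) : Prop :=
  ∃ f : ℝ → ℝ → ℂ, (∀ t ∈ Icc (-T) T, HasFourier (u t) (f t) ∧ weightedSup μ (f t) < ⊤) ∧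
    ∀ s ∈ Icc (-T) T, Tendsto
      (fun t => weightedSup μ
        (fun ξ => cexp2 (-(t * omega ξ)) * f t ξ - cexp2 (-(s * omega ξ)) * f s ξ))
      (𝓝[Icc (-T) T] s) (𝓝 0)

end MKdV

end

/-!
# Local well-posedness of the modified KdV equation in weighted `L^∞` on the Fourier side

The Duhamel formula is solved by a fixed point argument for extensions of the solution to all
times, written in terms of their space-time Fourier transforms `F(τ, ξ)`. A function `F` is
controlled through a majorant `M` of its profile, `|F(τ, ξ)| ≤ ⟨ξ⟩^{-μ} M(τ - ω(ξ))`; the optimal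
`M` has the weighted `L²` norm `bourgainNorm μ b F`, so that every estimate is an estimate on
functions of the single variable `τ`.

*The trilinear estimate.* For a triple convolution, the modulations `τⱼ - ω(ξⱼ)` of the factors and
the modulation of the product differ by the resonance function
`ω(ξ) - ω(ξ₁) - ω(ξ₂) - ω(ξ₃) = 12π²(ξ - ξ₁)(ξ - ξ₂)(ξ - ξ₃)`. Its distribution under the measure
`|ξ|⟨ξ⟩^μ ∏ⱼ ⟨ξⱼ⟩^{-μ}` has a density bounded by `C|h|^{-δ}`, uniformly in `ξ`, for small `δ > 0`
(`exists_pushforward_le`). So the nonlinear term has the majorant `M₁ * M₂ * M₃ * |·|^{-δ}`. Since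
`b > 1/2`, the `Mⱼ` are integrable, and convolution with `|·|^{-δ}` maps `L¹` to the weighted `L²`
space of order `-β` as soon as `2β + 2δ > 1` (`exists_eLpNorm_fractional_le`). The gain is that `β`
may be smaller than `1/2`, whereas `b` is larger (`exists_trilinear`).

*The Duhamel term.* Cut off at time scale `T`, the Duhamel operator maps order `-β` to order `b` with
norm `O(T^{1-b-β})` (`exists_wnorm_duhamelExt_le`), and `b + β < 1` is possible
(`exists_admissible`). Hence for small `T` the solution map `solMap` is a contraction of a ball
(`exists_contraction`), its fixed points are extensions of solutions, and they depend on the datum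
in a Lipschitz way (`exists_solution_operator`).

*Uniqueness.* A solution has many extensions, and an arbitrary one is not a fixed point of the
solution map. But the Duhamel term at time `t` depends only on the curve between the times `0` and
`t` (`duhamelInt_nonlin_congr`, by Fubini), so applying the solution map to an extension gives
another extension of the same curve. Iterating, two solutions with the same datum acquire
extensions that are arbitrarily close, hence they coincide on a short time interval
(`exists_unique_short`); translations in time extend this to intervals of any length
(`SolvesOn.unique`). Uniqueness also shows that a solution with real datum is real, as the complex
conjugate is a solution too, and that the Lipschitz bounds hold for arbitrary solutions.
-/

noncomputable section

namespace MKdV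

/-! ### The bracket and elementary integrals -/

/-- The Japanese bracket `⟨x⟩` as an extended nonnegative real. -/
def jb (x : ℝ) : ℝ≥0∞ := ENNReal.ofReal (japaneseBracket x)

lemma one_le_japaneseBracket (x : ℝ) : 1 ≤ japaneseBracket x := by
  rw [japaneseBracket, Real.one_le_sqrt]; nlinarith [sq_nonneg x]

lemma japaneseBracket_pos (x : ℝ) : 0 < japaneseBracket x :=
  lt_of_lt_of_le one_pos (one_le_japaneseBracket x)

lemma abs_le_japaneseBracket (x : ℝ) : |x| ≤ japaneseBracket x :=
  Real.le_sqrt_of_sq_le (by rw [sq_abs]; linarith)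

lemma japaneseBracket_le (x : ℝ) : japaneseBracket x ≤ 1 + |x| := by
  rw [japaneseBracket, Real.sqrt_le_left (by positivity)]
  nlinarith [sq_abs x, abs_nonneg x]

lemma continuous_japaneseBracket : Continuous japaneseBracket := by
  unfold japaneseBracket; fun_prop

@[fun_prop]
lemma measurable_jb : Measurable jb :=
  continuous_japaneseBracket.measurable.ennreal_ofReal

lemma one_le_jb (x : ℝ) : 1 ≤ jb x := by
  rw [jb, ENNReal.one_le_ofReal]; exact one_le_japaneseBracket x

lemma jb_ne_zero (x : ℝ) : jb x ≠ 0 := (lt_of_lt_of_le one_pos (one_le_jb x)).ne'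

lemma jb_ne_top (x : ℝ) : jb x ≠ ⊤ := ENNReal.ofReal_ne_top

lemma jb_rpow_ne_zero (x p : ℝ) : jb x ^ p ≠ 0 := by
  simp [ENNReal.rpow_eq_zero_iff, jb_ne_zero, jb_ne_top]

lemma jb_rpow_ne_top (x p : ℝ) : jb x ^ p ≠ ⊤ := by
  simp [ENNReal.rpow_eq_top_iff, jb_ne_zero, jb_ne_top]

lemma jb_rpow_mul_rpow (x p q : ℝ) : jb x ^ p * jb x ^ q = jb x ^ (p + q) :=
  (ENNReal.rpow_add _ _ (jb_ne_zero x) (jb_ne_top x)).symm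

lemma jb_rpow_mul_neg (x p : ℝ) : jb x ^ p * jb x ^ (-p) = 1 := by
  rw [jb_rpow_mul_rpow]; simp

lemma ofReal_japaneseBracket_rpow (x p : ℝ) :
    ENNReal.ofReal (japaneseBracket x ^ p) = jb x ^ p :=
  (ENNReal.ofReal_rpow_of_pos (japaneseBracket_pos x)).symm

lemma enorm_le_jb (x : ℝ) : ‖x‖ₑ ≤ jb x := by
  rw [jb, Real.enorm_eq_ofReal_abs]
  exact ENNReal.ofReal_le_ofReal (abs_le_japaneseBracket x)

/-- For nonpositive exponents, `t ↦ t ^ p` is antitone. -/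
lemma rpow_le_rpow_of_nonpos {x y : ℝ≥0∞} {p : ℝ} (h : x ≤ y) (hp : p ≤ 0) : y ^ p ≤ x ^ p := by
  obtain ⟨q, rfl⟩ : ∃ q, p = -q := ⟨-p, by ring⟩
  rw [ENNReal.rpow_neg, ENNReal.rpow_neg, ENNReal.inv_le_inv]
  exact ENNReal.rpow_le_rpow h (by linarith)

lemma jb_neg (x : ℝ) : jb (-x) = jb x := by simp [jb, japaneseBracket]

/-- Peetre's inequality, with a convenient constant. -/
lemma jb_le_mul (x y : ℝ) : jb x ≤ 2 * (jb y * jb (x - y)) := by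
  have h2 : (2 : ℝ≥0∞) = ENNReal.ofReal 2 := by simp
  rw [jb, jb, jb, ← ENNReal.ofReal_mul (japaneseBracket_pos _).le, h2,
    ← ENNReal.ofReal_mul (by norm_num)]
  apply ENNReal.ofReal_le_ofReal
  rw [japaneseBracket, japaneseBracket, japaneseBracket, ← Real.sqrt_mul (by positivity),
    Real.sqrt_le_left (by positivity), mul_pow, Real.sq_sqrt (by positivity)]
  nlinarith [sq_nonneg y, sq_nonneg (x - y), mul_nonneg (sq_nonneg y) (sq_nonneg (x - y)),
    sq_nonneg (x - 2 * y)]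

lemma jb_rpow_le_mul {p : ℝ} (hp : 0 ≤ p) (x y : ℝ) :
    jb x ^ p ≤ 2 ^ p * (jb y ^ p * jb (x - y) ^ p) := by
  rw [← ENNReal.mul_rpow_of_nonneg _ _ hp, ← ENNReal.mul_rpow_of_nonneg _ _ hp]
  exact ENNReal.rpow_le_rpow (jb_le_mul x y) hp

lemma jb_rpow_mono {p q : ℝ} (h : p ≤ q) (x : ℝ) : jb x ^ p ≤ jb x ^ q :=
  ENNReal.rpow_le_rpow_of_exponent_le (one_le_jb x) h

lemma jb_le_of_abs_le {x c y : ℝ} (hc : 1 ≤ c) (h : |x| ≤ c * |y|) :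
    jb x ≤ ENNReal.ofReal c * jb y := by
  rw [jb, jb, ← ENNReal.ofReal_mul (by linarith)]
  apply ENNReal.ofReal_le_ofReal
  rw [japaneseBracket, japaneseBracket, Real.sqrt_le_left (by positivity), mul_pow,
    Real.sq_sqrt (by positivity)]
  have := mul_self_le_mul_self (abs_nonneg x) h
  have h1 := abs_mul_abs_self x
  have h2 := abs_mul_abs_self y
  nlinarith

lemma lintegral_jb_rpow_lt_top {p : ℝ} (hp : 1 < p) : ∫⁻ x, jb x ^ (-p) < ⊤ := by
  have h := integrable_rpow_neg_one_add_norm_sq (E := ℝ) (μ := volume) (r := p) (by simpa using hp)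
  refine lt_of_eq_of_lt (lintegral_congr fun x => ?_) h.lintegral_lt_top
  rw [← ofReal_japaneseBracket_rpow, japaneseBracket, Real.sqrt_eq_rpow,
    ← Real.rpow_mul (by positivity), Real.norm_eq_abs, sq_abs]
  congr 2; ring

lemma lintegral_Ioo_enorm_rpow_lt_top {q : ℝ} (hq : q < 1) :
    ∫⁻ x in Ioo (-1 : ℝ) 1, ‖x‖ₑ ^ (-q) < ⊤ := by
  set g : ℝ → ℝ≥0∞ := (Ioo (0:ℝ) 1).indicator fun x => ‖x‖ₑ ^ (-q) with hg
  have hgm : Measurable g := by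
    apply Measurable.indicator _ measurableSet_Ioo; fun_prop
  have hgi : ∫⁻ x, g x < ⊤ := by
    rw [hg, lintegral_indicator measurableSet_Ioo]
    have h : IntegrableOn (fun x : ℝ => x ^ (-q)) (Ioo 0 1) :=
      (intervalIntegral.integrableOn_Ioo_rpow_iff one_pos).2 (by linarith)
    refine lt_of_eq_of_lt (setLIntegral_congr_fun measurableSet_Ioo fun x hx => ?_)
      h.lintegral_lt_top
    rw [Real.enorm_eq_ofReal_abs, abs_of_pos hx.1, ENNReal.ofReal_rpow_of_pos hx.1]
  have hgi' : ∫⁻ x, g (-x) < ⊤ := by rwa [lintegral_neg_eq_self]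
  rw [← lintegral_indicator measurableSet_Ioo]
  refine lt_of_le_of_lt (lintegral_mono_ae (g := fun x => g x + g (-x)) ?_)
    (by rw [lintegral_add_left hgm]; exact ENNReal.add_lt_top.2 ⟨hgi, hgi'⟩)
  filter_upwards [Measure.ae_ne volume (0:ℝ)] with x hx0
  by_cases hx : x ∈ Ioo (-1 : ℝ) 1
  · rw [indicator_of_mem hx]
    rcases lt_or_gt_of_ne hx0 with h | h
    · refine le_trans ?_ (le_add_self)
      have hx' : -x ∈ Ioo (0 : ℝ) 1 := ⟨by linarith, by linarith [hx.1]⟩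
      rw [hg, indicator_of_mem hx']; simp
    · refine le_trans ?_ (le_self_add)
      have hx' : x ∈ Ioo (0 : ℝ) 1 := ⟨h, hx.2⟩
      rw [hg, indicator_of_mem hx']
  · rw [indicator_of_notMem hx]; exact zero_le

lemma enorm_rpow_le_of_one_le_abs {q : ℝ} (hq : 0 ≤ q) {x : ℝ} (hx : 1 ≤ |x|) :
    ‖x‖ₑ ^ (-q) ≤ 2 ^ q * jb x ^ (-q) := by
  have h1 : jb x ≤ 2 * ‖x‖ₑ := by
    have h2 : (2 : ℝ≥0∞) = ENNReal.ofReal 2 := by simp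
    rw [jb, Real.enorm_eq_ofReal_abs, h2, ← ENNReal.ofReal_mul (by norm_num)]
    exact ENNReal.ofReal_le_ofReal ((japaneseBracket_le x).trans (by linarith))
  have h3 := rpow_le_rpow_of_nonpos h1 (p := -q) (by linarith)
  rw [ENNReal.mul_rpow_of_ne_top (by simp) (by simp)] at h3
  calc ‖x‖ₑ ^ (-q) = 2 ^ q * (2 ^ (-q) * ‖x‖ₑ ^ (-q)) := by
        rw [← mul_assoc, ← ENNReal.rpow_add _ _ (by simp) (by simp)]; simp
    _ = 2 ^ q * ((2 * ‖x‖ₑ) ^ (-q)) := by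
        rw [ENNReal.mul_rpow_of_ne_top (by simp) (by simp)]
    _ ≤ 2 ^ q * jb x ^ (-q) := by
        gcongr 2 ^ q * ?_
        exact rpow_le_rpow_of_nonpos h1 (by linarith)

lemma two_rpow_ne_top (p : ℝ) : (2 : ℝ≥0∞) ^ p ≠ ⊤ := by simp [ENNReal.rpow_eq_top_iff]

/-- Away from the origin `|x|^{-q}⟨x⟩^{-p}` decays like `⟨x⟩^{-p-q}`, near the origin it is an
integrable power. -/
lemma lintegral_enorm_rpow_mul_jb_rpow_lt_top {p q : ℝ} (hp : 0 ≤ p) (hq0 : 0 ≤ q) (hq : q < 1)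
    (hpq : 1 < p + q) : ∫⁻ x : ℝ, ‖x‖ₑ ^ (-q) * jb x ^ (-p) < ⊤ := by
  refine lt_of_le_of_lt (lintegral_mono (g := fun x : ℝ =>
    (Ioo (-1 : ℝ) 1).indicator (fun x => ‖x‖ₑ ^ (-q)) x + 2 ^ q * jb x ^ (-(p + q))) fun x => ?_) ?_
  · by_cases hx : |x| < 1
    · refine le_trans ?_ le_self_add
      have hx' : x ∈ Ioo (-1 : ℝ) 1 := abs_lt.1 hx
      rw [indicator_of_mem hx']
      refine mul_le_of_le_one_right' ?_
      simpa using jb_rpow_mono (neg_nonpos.2 hp) x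
    · refine le_trans ?_ le_add_self
      refine (mul_le_mul_left (enorm_rpow_le_of_one_le_abs hq0 (not_lt.1 hx)) _).trans ?_
      rw [mul_assoc, jb_rpow_mul_rpow]
      gcongr 2 ^ q * ?_
      exact jb_rpow_mono (by linarith) x
  · rw [lintegral_add_left (by apply Measurable.indicator _ measurableSet_Ioo; fun_prop),
      lintegral_const_mul _ (by fun_prop), lintegral_indicator measurableSet_Ioo]
    exact ENNReal.add_lt_top.2 ⟨lintegral_Ioo_enorm_rpow_lt_top hq,
      ENNReal.mul_lt_top (two_rpow_ne_top q).lt_top (lintegral_jb_rpow_lt_top hpq)⟩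

lemma lintegral_comp_mul_left (f : ℝ → ℝ≥0∞) {T : ℝ} (hT : T ≠ 0) :
    ∫⁻ x, f (T * x) = ‖T‖ₑ⁻¹ * ∫⁻ x, f x := by
  have h := (Homeomorph.mulLeft₀ T hT).toMeasurableEquiv.measurableEmbedding.lintegral_map
    (μ := volume) f
  have h' : ⇑(Homeomorph.mulLeft₀ T hT).toMeasurableEquiv = fun x => T * x := rfl
  rw [h', Real.map_volume_mul_left hT, lintegral_smul_measure, abs_inv,
    ENNReal.ofReal_inv_of_pos (abs_pos.2 hT), ← Real.enorm_eq_ofReal_abs] at h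
  exact h.symm

/-- The square of an `L²` norm of an extended nonnegative function. -/
lemma eLpNorm_two_sq (f : ℝ → ℝ≥0∞) : (eLpNorm f 2 volume) ^ 2 = ∫⁻ x, f x ^ 2 := by
  rw [eLpNorm_eq_lintegral_rpow_enorm_toReal (by simp) (by simp)]
  simp only [ENNReal.toReal_ofNat, enorm_eq_self]
  rw [← ENNReal.rpow_natCast, ← ENNReal.rpow_mul]
  norm_num

lemma eLpNorm_two_le {f : ℝ → ℝ≥0∞} {c : ℝ≥0∞} (h : ∫⁻ x, f x ^ 2 ≤ c ^ 2) :
    eLpNorm f 2 volume ≤ c := by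
  rw [← eLpNorm_two_sq] at h
  exact (ENNReal.pow_le_pow_left_iff (by norm_num)).1 h

/-- The Cauchy-Schwarz inequality. -/
lemma lintegral_mul_le_eLpNorm {f g : ℝ → ℝ≥0∞} (hf : AEMeasurable f) (hg : AEMeasurable g) :
    ∫⁻ x, f x * g x ≤ eLpNorm f 2 volume * eLpNorm g 2 volume := by
  have := ENNReal.lintegral_mul_le_Lp_mul_Lq volume (Real.HolderConjugate.two_two) hf hg
  rw [eLpNorm_eq_lintegral_rpow_enorm_toReal (by simp) (by simp),
    eLpNorm_eq_lintegral_rpow_enorm_toReal (by simp) (by simp)]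
  simpa using this

/-- The Cauchy-Schwarz inequality with respect to the measure `n(x) dx`. -/
lemma lintegral_mul_sq_le {n k : ℝ → ℝ≥0∞} (hn : AEMeasurable n) (hk : AEMeasurable k) :
    (∫⁻ x, n x * k x) ^ 2 ≤ (∫⁻ x, n x) * ∫⁻ x, n x * k x ^ 2 := by
  have h2 : ∀ y : ℝ≥0∞, (y ^ (1/2 : ℝ)) ^ 2 = y := fun y => by
    rw [← ENNReal.rpow_natCast, ← ENNReal.rpow_mul]; norm_num
  have h := lintegral_mul_le_eLpNorm (f := fun x => n x ^ (1/2:ℝ)) (g := fun x => n x ^ (1/2:ℝ) * k x)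
    (hn.pow_const _) ((hn.pow_const _).mul hk)
  calc (∫⁻ x, n x * k x) ^ 2 = (∫⁻ x, n x ^ (1/2:ℝ) * (n x ^ (1/2:ℝ) * k x)) ^ 2 := by
        congr 2; ext x; rw [← mul_assoc, ← sq, h2]
    _ ≤ _ := pow_le_pow_left' h 2
    _ = _ := by
        rw [mul_pow, eLpNorm_two_sq, eLpNorm_two_sq]
        simp only [mul_pow, h2]

/-- Splitting according to which of `⟨τ⟩`, `⟨s - τ⟩` is larger gives a bound that does not depend
on `s`. -/
lemma exists_lintegral_jb_mul_enorm_sub_le {p q : ℝ} (hp : 0 ≤ p) (hq0 : 0 ≤ q) (hq : q < 1)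
    (hpq : 1 < p + q) :
    ∃ C : ℝ≥0, ∀ s : ℝ, ∫⁻ τ : ℝ, jb τ ^ (-p) * ‖s - τ‖ₑ ^ (-q) ≤ C := by
  have hfin : 2 ^ q * (∫⁻ x, jb x ^ (-(p + q))) +
      2 ^ p * (∫⁻ x : ℝ, ‖x‖ₑ ^ (-q) * jb x ^ (-p)) ≠ ⊤ := by
    refine (ENNReal.add_lt_top.2 ⟨ENNReal.mul_lt_top (two_rpow_ne_top q).lt_top
      (lintegral_jb_rpow_lt_top hpq), ENNReal.mul_lt_top (two_rpow_ne_top p).lt_top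
      (lintegral_enorm_rpow_mul_jb_rpow_lt_top hp hq0 hq hpq)⟩).ne
  obtain ⟨C, hC⟩ := ENNReal.canLift.prf _ hfin
  refine ⟨C, fun s => ?_⟩
  rw [hC, ← lintegral_sub_left_eq_self (fun x : ℝ => ‖x‖ₑ ^ (-q) * jb x ^ (-p)) s,
    ← lintegral_const_mul _ (by fun_prop), ← lintegral_const_mul _ (by fun_prop),
    ← lintegral_add_left (by fun_prop)]
  refine lintegral_mono fun τ => ?_
  simp only
  set y := s - τ
  have hτ : (1 : ℝ≥0∞) ≤ jb τ := one_le_jb τ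
  have key : ∀ c : ℝ≥0∞, c ≠ 0 → c ≠ ⊤ → jb y ≤ c * jb τ → jb τ ^ (-p) ≤ c ^ p * jb y ^ (-p) := by
    intro c hc hc' h
    calc jb τ ^ (-p) = c ^ p * (c * jb τ) ^ (-p) := by
          rw [ENNReal.mul_rpow_of_ne_top hc' (jb_ne_top _), ← mul_assoc,
            ← ENNReal.rpow_add _ _ hc hc']; simp
      _ ≤ _ := by gcongr c ^ p * ?_; exact rpow_le_rpow_of_nonpos h (by linarith)
  by_cases h1 : jb y ≤ 2 * jb τ
  · refine le_trans ?_ le_add_self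
    refine (mul_le_mul_left (key 2 (by simp) (by simp) h1) _).trans (le_of_eq ?_)
    ring
  · refine le_trans ?_ le_self_add
    push Not at h1
    have h2 : 1 ≤ |y| := by
      by_contra! h3
      refine absurd (h1.trans_le ?_) (lt_irrefl (2 * jb τ))
      refine le_trans ?_ (mul_le_mul_right hτ 2)
      rw [jb, mul_one, show (2 : ℝ≥0∞) = ENNReal.ofReal 2 by simp]
      exact ENNReal.ofReal_le_ofReal ((japaneseBracket_le y).trans (by linarith))
    have h4 : jb y ^ (-q) ≤ jb τ ^ (-q) := rpow_le_rpow_of_nonpos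
      ((le_mul_of_one_le_left' (by norm_num)).trans h1.le) (by linarith)
    calc jb τ ^ (-p) * ‖y‖ₑ ^ (-q) ≤ jb τ ^ (-p) * (2 ^ q * jb τ ^ (-q)) := by
          gcongr jb τ ^ (-p) * ?_
          exact (enorm_rpow_le_of_one_le_abs hq0 h2).trans (by gcongr 2 ^ q * ?_)
      _ = 2 ^ q * (jb τ ^ (-p) * jb τ ^ (-q)) := by ring
      _ = _ := by rw [jb_rpow_mul_rpow]; congr 2; ring

/-- Fractional integration from `L¹` to a weighted `L²` space. -/
lemma exists_eLpNorm_fractional_le {β δ : ℝ} (hβ : 0 ≤ β) (hδ0 : 0 ≤ δ) (hδ : 2 * δ < 1)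
    (h : 1 < 2 * β + 2 * δ) :
    ∃ C : ℝ≥0, ∀ n : ℝ → ℝ≥0∞, AEMeasurable n →
      eLpNorm (fun τ => jb τ ^ (-β) * ∫⁻ s, n s * ‖s - τ‖ₑ ^ (-δ)) 2 volume ≤ C * ∫⁻ s, n s := by
  obtain ⟨C, hC⟩ := exists_lintegral_jb_mul_enorm_sub_le (p := 2 * β) (q := 2 * δ) (by linarith)
    (by linarith) hδ h
  refine ⟨NNReal.sqrt C, fun n hn => eLpNorm_two_le ?_⟩
  have hsq : ∀ (y : ℝ≥0∞) (p : ℝ), (y ^ (-p)) ^ 2 = y ^ (-(2 * p)) := fun y p => by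
    rw [← ENNReal.rpow_natCast, ← ENNReal.rpow_mul]; congr 1; push_cast; ring
  calc ∫⁻ τ, (jb τ ^ (-β) * ∫⁻ s, n s * ‖s - τ‖ₑ ^ (-δ)) ^ 2
      ≤ ∫⁻ τ, (∫⁻ s, n s) * ∫⁻ s, n s * (jb τ ^ (-(2 * β)) * ‖s - τ‖ₑ ^ (-(2 * δ))) := by
        refine lintegral_mono fun τ => ?_
        rw [mul_pow, hsq]
        refine (mul_le_mul_right (lintegral_mul_sq_le hn (by fun_prop)) _).trans (le_of_eq ?_)
        rw [mul_left_comm, ← lintegral_const_mul' _ _ (jb_rpow_ne_top _ _)]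
        congr 2; ext s; rw [hsq]; ring
    _ = (∫⁻ s, n s) * ∫⁻ s, n s * ∫⁻ τ, jb τ ^ (-(2 * β)) * ‖s - τ‖ₑ ^ (-(2 * δ)) := by
        rw [lintegral_const_mul'' _ (by
          refine AEMeasurable.lintegral_prod_right' (f := fun z : ℝ × ℝ =>
            n z.2 * (jb z.1 ^ (-(2 * β)) * ‖z.2 - z.1‖ₑ ^ (-(2 * δ)))) ?_
          exact (hn.comp_quasiMeasurePreserving Measure.quasiMeasurePreserving_snd).mul
            (by fun_prop)), lintegral_lintegral_swap]
        · congr 2; ext s; rw [lintegral_const_mul _ (by fun_prop)]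
        · exact (hn.comp_quasiMeasurePreserving Measure.quasiMeasurePreserving_snd).mul
            (by fun_prop)
    _ ≤ (∫⁻ s, n s) * ∫⁻ s, n s * C := by gcongr with s; exact hC s
    _ = _ := by
        rw [lintegral_mul_const'' _ hn, mul_pow]
        norm_cast; rw [NNReal.sq_sqrt]; ring

/-- Young's inequality `L¹ * L² ⊆ L²`. -/
lemma eLpNorm_convolution_le {κ f : ℝ → ℝ≥0∞} (hκ : Measurable κ) (hf : AEMeasurable f) :
    eLpNorm (fun x' => ∫⁻ x, κ (x' - x) * f x) 2 volume ≤ (∫⁻ x, κ x) * eLpNorm f 2 volume := by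
  refine eLpNorm_two_le ?_
  have hm : AEMeasurable (fun z : ℝ × ℝ => κ (z.1 - z.2) * f z.2 ^ 2) :=
    (hκ.comp (by fun_prop)).aemeasurable.mul
      ((hf.pow_const 2).comp_quasiMeasurePreserving Measure.quasiMeasurePreserving_snd)
  calc ∫⁻ x', (∫⁻ x, κ (x' - x) * f x) ^ 2
      ≤ ∫⁻ x', (∫⁻ x, κ x) * ∫⁻ x, κ (x' - x) * f x ^ 2 := by
        refine lintegral_mono fun x' => ?_
        have := lintegral_mul_sq_le (n := fun x => κ (x' - x)) (k := f)
          (hκ.comp (by fun_prop)).aemeasurable hf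
        rwa [lintegral_sub_left_eq_self κ x'] at this
    _ = (∫⁻ x, κ x) * ∫⁻ x, (∫⁻ x', κ (x' - x)) * f x ^ 2 := by
        rw [lintegral_const_mul'' _ hm.lintegral_prod_right', lintegral_lintegral_swap hm]
        congr 2; ext x; exact lintegral_mul_const (f x ^ 2) (hκ.comp (measurable_id.sub_const x))
    _ = _ := by
        simp_rw [lintegral_sub_right_eq_self κ]
        rw [lintegral_const_mul'' _ (hf.pow_const 2), mul_pow, eLpNorm_two_sq]; ring

/-! ### The resonance function and the push-forward of the frequency measure -/

/-- The resonance function `ω(ξ) - ω(x) - ω(y) - ω(ξ - x - y)`, in factorised form. -/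
def resonance (ξ x y : ℝ) : ℝ := 12 * Real.pi ^ 2 * ((ξ - x) * (ξ - y) * (x + y))

lemma resonance_eq (ξ x y : ℝ) :
    resonance ξ x y = omega ξ - omega x - omega y - omega (ξ - x - y) := by
  simp only [resonance, omega]; ring

lemma one_le_twelve_pi_sq : (1 : ℝ) ≤ 12 * Real.pi ^ 2 * (2 / 3) := by
  nlinarith [Real.pi_gt_three]

/-- Change of variables `h = f x` on a set where `f` is injective. -/
lemma setLIntegral_abs_deriv_mul_comp_le {s : Set ℝ} (hs : MeasurableSet s) {f f' : ℝ → ℝ}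
    (hf : ∀ x ∈ s, HasDerivAt f (f' x) x) (hinj : InjOn f s) (g : ℝ → ℝ≥0∞) :
    ∫⁻ x in s, ‖f' x‖ₑ * g (f x) ≤ ∫⁻ h, g h := by
  have := lintegral_image_eq_lintegral_abs_deriv_mul hs
    (fun x hx => (hf x hx).hasDerivWithinAt) hinj g
  simp only [Real.enorm_eq_ofReal_abs]
  rw [← this]
  exact setLIntegral_le_lintegral _ _

lemma hasDerivAt_resonance (ξ x y : ℝ) :
    HasDerivAt (resonance ξ x) (12 * Real.pi ^ 2 * ((ξ - x) * (ξ - x - y - y))) y := by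
  have h1 : HasDerivAt (fun y => (ξ - x) * (ξ - y)) ((ξ - x) * (0 - 1)) y :=
    ((hasDerivAt_const y ξ).sub (hasDerivAt_id y)).const_mul _
  have h2 : HasDerivAt (fun y => x + y) (0 + 1) y := (hasDerivAt_const y x).add (hasDerivAt_id y)
  exact ((h1.mul h2).const_mul (12 * Real.pi ^ 2)).congr_deriv (by ring)

/-- As a function of `y` the resonance function is a quadratic polynomial, so it has two monotone
branches. -/
lemma lintegral_comp_resonance_le {ξ x : ℝ} (hx : ξ - x ≠ 0) (g : ℝ → ℝ≥0∞) :
    ∫⁻ y, ‖12 * Real.pi ^ 2 * ((ξ - x) * (ξ - x - y - y))‖ₑ * g (resonance ξ x y) ≤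
      2 * ∫⁻ h, g h := by
  have hinj : ∀ a b, a + b ≠ ξ - x → resonance ξ x a = resonance ξ x b → a = b := by
    intro a b hab h
    have hpi : (12 * Real.pi ^ 2 : ℝ) ≠ 0 := by positivity
    have h1 := mul_left_cancel₀ hpi h
    have h2 : (ξ - x) * ((a - b) * (ξ - x - (a + b))) = 0 := by linear_combination h1
    rcases mul_eq_zero.1 h2 with h3 | h3
    · exact absurd h3 hx
    rcases mul_eq_zero.1 h3 with h3 | h3
    · linarith
    · exact absurd (by linarith) hab
  have h1 := setLIntegral_abs_deriv_mul_comp_le (s := Iio ((ξ - x) / 2)) measurableSet_Iio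
    (fun y _ => hasDerivAt_resonance ξ x y)
    (fun a ha b hb h => hinj a b (by simp only [mem_Iio] at ha hb; linarith) h) g
  have h2 := setLIntegral_abs_deriv_mul_comp_le (s := Ici ((ξ - x) / 2)) measurableSet_Ici
    (fun y _ => hasDerivAt_resonance ξ x y)
    (fun a ha b hb h => by
      by_cases hab : a + b = ξ - x
      · simp only [mem_Ici] at ha hb; linarith
      · exact hinj a b hab h) g
  rw [two_mul, ← lintegral_add_compl _ (measurableSet_Iio (a := (ξ - x) / 2)), compl_Iio]
  exact add_le_add h1 h2

/-- The scaling invariant integral which controls the interactions away from the diagonal. -/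
def offDiagonalWeight (δ ξ x : ℝ) : ℝ≥0∞ :=
  ‖ξ‖ₑ * ‖ξ - x‖ₑ ^ (δ - 1) * (max ‖x‖ₑ (‖ξ‖ₑ / 3)) ^ (2 * δ - 1) * ‖x‖ₑ ^ (-(3 * δ))

lemma lintegral_offDiagonalWeight_one_lt_top {δ : ℝ} (hδ0 : 0 < δ) (hδ : 3 * δ < 1) :
    ∫⁻ x, offDiagonalWeight δ 1 x < ⊤ := by
  obtain ⟨C, hC⟩ := exists_lintegral_jb_mul_enorm_sub_le (p := 1 + δ) (q := 1 - δ) (by linarith)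
    (by linarith) (by linarith) (by linarith)
  have h2 := lintegral_enorm_rpow_mul_jb_rpow_lt_top (p := 2 - 3 * δ) (q := 3 * δ) (by linarith)
    (by linarith) hδ (by linarith)
  have h4 : ∀ (a : ℝ≥0∞) (y p : ℝ), 0 ≤ p → jb y ≤ 4 * a → a ^ (-p) ≤ 4 ^ p * jb y ^ (-p) := by
    intro a y p hp h
    calc a ^ (-p) = 4 ^ p * (4 * a) ^ (-p) := by
          rw [ENNReal.mul_rpow_of_ne_zero (by simp) ?_, ← mul_assoc,
            ← ENNReal.rpow_add _ _ (by simp) (by simp)]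
          · simp
          · rintro rfl; simp [jb_ne_zero] at h
      _ ≤ _ := by gcongr 4 ^ p * ?_; exact rpow_le_rpow_of_nonpos h (by linarith)
  have hjb : ∀ y r : ℝ, 1 + |y| ≤ 4 * |r| → jb y ≤ 4 * ‖r‖ₑ := fun y r h => by
    rw [jb, Real.enorm_eq_ofReal_abs, show (4 : ℝ≥0∞) = ENNReal.ofReal 4 by simp,
      ← ENNReal.ofReal_mul (by norm_num)]
    exact ENNReal.ofReal_le_ofReal ((japaneseBracket_le y).trans h)
  have hmax : ∀ y : ℝ, max ‖y‖ₑ (1 / 3) ^ (2 * δ - 1) ≤ 4 ^ (1 - 2 * δ) * jb y ^ (-(1 - 2 * δ)) := by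
    intro y
    rw [show 2 * δ - 1 = -(1 - 2 * δ) by ring]
    refine h4 _ _ _ (by linarith) ?_
    have h3 : (1 / 3 : ℝ≥0∞) = ‖(1 / 3 : ℝ)‖ₑ := by
      rw [Real.enorm_eq_ofReal_abs, abs_of_pos (by norm_num), ENNReal.ofReal_div_of_pos (by norm_num)]
      simp
    rw [h3]
    rcases le_total (1 / 3) |y| with h | h
    · exact (hjb y y (by linarith)).trans (by gcongr; exact le_max_left _ _)
    · refine (hjb y (1 / 3) ?_).trans (by gcongr; exact le_max_right _ _)
      rw [abs_of_pos (by norm_num : (0:ℝ) < 1 / 3)]; linarith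
  refine lt_of_le_of_lt (lintegral_mono (g := fun y : ℝ =>
    4 ^ (1 - 2 * δ) * 4 ^ (1 - δ) * (‖y‖ₑ ^ (-(3 * δ)) * jb y ^ (-(2 - 3 * δ))) +
    4 ^ (1 - 2 * δ) * 4 ^ (3 * δ) * (jb y ^ (-(1 + δ)) * ‖1 - y‖ₑ ^ (-(1 - δ)))) fun y => ?_) ?_
  · simp only [offDiagonalWeight, enorm_one, one_mul]
    rw [show δ - 1 = -(1 - δ) by ring]
    rcases le_total |y| (1 / 2) with h | h
    · refine le_trans ?_ le_self_add
      have h5 := h4 ‖1 - y‖ₑ y (1 - δ) (by linarith) (hjb _ _ (by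
        have := abs_sub_abs_le_abs_sub 1 y
        rw [abs_one] at this; linarith))
      calc _ ≤ (4 ^ (1 - δ) * jb y ^ (-(1 - δ))) * (4 ^ (1 - 2 * δ) * jb y ^ (-(1 - 2 * δ))) *
            ‖y‖ₑ ^ (-(3 * δ)) := by gcongr; exact hmax y
        _ = 4 ^ (1 - 2 * δ) * 4 ^ (1 - δ) * (‖y‖ₑ ^ (-(3 * δ)) *
            (jb y ^ (-(1 - δ)) * jb y ^ (-(1 - 2 * δ)))) := by ring
        _ = _ := by rw [jb_rpow_mul_rpow]; congr 4; ring
    · refine le_trans ?_ le_add_self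
      have h5 := h4 ‖y‖ₑ y (3 * δ) (by linarith) (hjb _ _ (by linarith))
      calc _ ≤ ‖1 - y‖ₑ ^ (-(1 - δ)) * (4 ^ (1 - 2 * δ) * jb y ^ (-(1 - 2 * δ))) *
            (4 ^ (3 * δ) * jb y ^ (-(3 * δ))) := by gcongr; exact hmax y
        _ = 4 ^ (1 - 2 * δ) * 4 ^ (3 * δ) * ((jb y ^ (-(1 - 2 * δ)) * jb y ^ (-(3 * δ))) *
            ‖1 - y‖ₑ ^ (-(1 - δ))) := by ring
        _ = _ := by rw [jb_rpow_mul_rpow]; congr 4; ring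
  · have h4t : ∀ p : ℝ, (4 : ℝ≥0∞) ^ p < ⊤ := fun p => by
      rw [lt_top_iff_ne_top]; simp [ENNReal.rpow_eq_top_iff]
    rw [lintegral_add_left (by fun_prop), lintegral_const_mul _ (by fun_prop),
      lintegral_const_mul _ (by fun_prop)]
    exact ENNReal.add_lt_top.2 ⟨ENNReal.mul_lt_top (ENNReal.mul_lt_top (h4t _) (h4t _)) h2,
      ENNReal.mul_lt_top (ENNReal.mul_lt_top (h4t _) (h4t _))
        ((hC 1).trans_lt ENNReal.coe_lt_top)⟩

lemma lintegral_offDiagonalWeight_eq {δ ξ : ℝ} (hξ : ξ ≠ 0) :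
    ∫⁻ x, offDiagonalWeight δ ξ x = ∫⁻ x, offDiagonalWeight δ 1 x := by
  have hξ0 : ‖ξ‖ₑ ≠ 0 := by simpa using hξ
  have hξt : ‖ξ‖ₑ ≠ ⊤ := enorm_ne_top
  have h := lintegral_comp_mul_left (offDiagonalWeight δ ξ) hξ
  have h2 : ∫⁻ x, offDiagonalWeight δ ξ x = ‖ξ‖ₑ * ∫⁻ x, offDiagonalWeight δ ξ (ξ * x) := by
    rw [h, ← mul_assoc, ENNReal.mul_inv_cancel hξ0 hξt, one_mul]
  rw [h2, ← lintegral_const_mul' _ _ hξt]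
  refine lintegral_congr fun x => ?_
  simp only [offDiagonalWeight, enorm_one, one_mul]
  rw [show ξ - ξ * x = ξ * (1 - x) by ring, enorm_mul, enorm_mul,
    show ‖ξ‖ₑ / 3 = ‖ξ‖ₑ * (1 / 3) by rw [mul_one_div], ← mul_max,
    ENNReal.mul_rpow_of_ne_top hξt enorm_ne_top, ENNReal.mul_rpow_of_ne_top hξt enorm_ne_top,
    ENNReal.mul_rpow_of_ne_top hξt (max_lt enorm_lt_top
      (by rw [lt_top_iff_ne_top]; simp)).ne]
  have h3 : ‖ξ‖ₑ * ‖ξ‖ₑ * ‖ξ‖ₑ ^ (δ - 1) * ‖ξ‖ₑ ^ (2 * δ - 1) * ‖ξ‖ₑ ^ (-(3 * δ)) = 1 := by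
    nth_rewrite 1 [← ENNReal.rpow_one ‖ξ‖ₑ]
    nth_rewrite 2 [← ENNReal.rpow_one ‖ξ‖ₑ]
    rw [← ENNReal.rpow_add _ _ hξ0 hξt, ← ENNReal.rpow_add _ _ hξ0 hξt,
      ← ENNReal.rpow_add _ _ hξ0 hξt, ← ENNReal.rpow_add _ _ hξ0 hξt]
    ring_nf; simp
  calc _ = (‖ξ‖ₑ * ‖ξ‖ₑ * ‖ξ‖ₑ ^ (δ - 1) * ‖ξ‖ₑ ^ (2 * δ - 1) * ‖ξ‖ₑ ^ (-(3 * δ))) *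
      (‖1 - x‖ₑ ^ (δ - 1) * max ‖x‖ₑ (1 / 3) ^ (2 * δ - 1) * ‖x‖ₑ ^ (-(3 * δ))) := by ring
    _ = _ := by rw [h3, one_mul]

/-- The frequencies `x, y, z` for which `x` is not the largest and `y`, `z` are far apart. -/
def farPair (x y z : ℝ) : Prop :=
  (|x| ≤ |y| ∨ |x| ≤ |z|) ∧ |y| ≤ 10 * |z - y| ∧ |z| ≤ 10 * |z - y|

/-- Up to a cyclic permutation, the last two of three frequencies are far apart, unless all are close
to a third of their sum, the critical point of the resonance function. -/
lemma farPair_or_near (x y z : ℝ) : farPair x y z ∨ farPair y z x ∨ farPair z x y ∨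
    (|x - (x + y + z) / 3| ≤ |x + y + z| / 20 ∧ |y - (x + y + z) / 3| ≤ |x + y + z| / 20) := by
  by_contra! h
  obtain ⟨h1, h2, h3, h4⟩ := h
  have key : ∀ a b c : ℝ, |b| ≤ |a| → |c| ≤ |a| → ¬ farPair b c a → ¬ farPair c a b →
      |a - (a + b + c) / 3| ≤ |a + b + c| / 20 ∧ |b - (a + b + c) / 3| ≤ |a + b + c| / 20 ∧
      |c - (a + b + c) / 3| ≤ |a + b + c| / 20 := by
    intro a b c hb hc hB hC
    have h5 : 10 * |a - c| ≤ |a| := by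
      by_contra! h
      exact hB ⟨Or.inr hb, by linarith, h.le⟩
    have h6 : 10 * |b - a| ≤ |a| := by
      by_contra! h
      exact hC ⟨Or.inl hc, h.le, by linarith⟩
    have h5' := abs_le.1 (show |a - c| ≤ |a| / 10 by linarith)
    have h6' := abs_le.1 (show |b - a| ≤ |a| / 10 by linarith)
    simp only [abs_le]
    rcases le_total 0 a with ha | ha
    · rw [abs_of_nonneg ha] at h5' h6'
      rw [abs_of_nonneg (show 0 ≤ a + b + c by linarith)]
      refine ⟨⟨?_, ?_⟩, ⟨?_, ?_⟩, ⟨?_, ?_⟩⟩ <;> linarith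
    · rw [abs_of_nonpos ha] at h5' h6'
      rw [abs_of_nonpos (show a + b + c ≤ 0 by linarith)]
      refine ⟨⟨?_, ?_⟩, ⟨?_, ?_⟩, ⟨?_, ?_⟩⟩ <;> linarith
  rcases le_total |x| |y| with hxy | hxy <;> rcases le_total |y| |z| with hyz | hyz <;>
    rcases le_total |x| |z| with hxz | hxz
  all_goals first
    | (have := key x y z (by linarith) (by linarith) h2 h3
       exact absurd this.2.1 (not_le.2 (h4 this.1)))
    | (have := key y z x (by linarith) (by linarith) h3 h1
       rw [show y + z + x = x + y + z by ring] at this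
       exact absurd this.1 (not_le.2 (h4 this.2.2)))
    | (have := key z x y (by linarith) (by linarith) h1 h2
       rw [show z + x + y = x + y + z by ring] at this
       exact absurd this.2.2 (not_le.2 (h4 this.2.1)))

/-- On the region where `y` and `z` are far apart, the derivative of the resonance function in `y`
compensates all the weights except for an integrable function of `x`. -/
lemma exists_farPair_bound {μ δ : ℝ} (hδ0 : 0 < δ) (hδμ : 3 * δ ≤ μ) (hδ : 2 * δ ≤ 1) :
    ∃ C : ℝ≥0, ∀ ξ x y : ℝ, x ≠ 0 → ξ - x ≠ 0 → farPair x y (ξ - x - y) →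
      ‖ξ‖ₑ * jb ξ ^ μ * (jb x ^ (-μ) * jb y ^ (-μ) * jb (ξ - x - y) ^ (-μ)) ≤
        C * offDiagonalWeight δ ξ x *
          (‖12 * Real.pi ^ 2 * ((ξ - x) * (ξ - x - y - y))‖ₑ * ‖resonance ξ x y‖ₑ ^ (-δ)) := by
  have hμ : 0 ≤ μ := by linarith
  set K : ℝ≥0∞ := ‖12 * Real.pi ^ 2 * 1600‖ₑ with hK
  have hK0 : K ≠ 0 := by rw [hK]; simp [Real.pi_ne_zero]
  have hKt : K ≠ ⊤ := enorm_ne_top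
  obtain ⟨C, hC⟩ := ENNReal.canLift.prf (3 ^ μ * (K ^ δ * 10 ^ (1 - 2 * δ)) : ℝ≥0∞) (by
    refine ENNReal.mul_ne_top ?_ (ENNReal.mul_ne_top ?_ ?_) <;>
    simp [ENNReal.rpow_eq_top_iff, hK0, hKt])
  refine ⟨C, fun ξ x y hx hξx hfar => ?_⟩
  rw [hC]
  set z := ξ - x - y with hz
  have hξ : ξ = x + y + z := by rw [hz]; ring
  obtain ⟨hmax, hy, hzz⟩ := hfar
  set a : ℝ≥0∞ := ‖ξ - x‖ₑ with ha
  set D : ℝ≥0∞ := ‖z - y‖ₑ with hD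
  have ha0 : a ≠ 0 := by simpa [ha] using hξx
  have hat : a ≠ ⊤ := enorm_ne_top
  have hzy : z - y ≠ 0 := by
    intro h
    rw [h, abs_zero, mul_zero] at hy hzz
    have : |x| ≤ 0 := hmax.elim (fun h => h.trans hy) (fun h => h.trans hzz)
    exact hx (abs_nonpos_iff.1 this)
  have hD0 : D ≠ 0 := by simpa [hD] using hzy
  have hDt : D ≠ ⊤ := enorm_ne_top
  have hxD : |x| ≤ 10 * |z - y| := hmax.elim (fun h => h.trans hy) (fun h => h.trans hzz)
  -- The larger of `y`, `z` dominates `ξ`, so its weight absorbs `⟨ξ⟩^μ`; the weight of `x` is left.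
  have hw : jb ξ ^ μ * (jb x ^ (-μ) * jb y ^ (-μ) * jb z ^ (-μ)) ≤ 3 ^ μ * ‖x‖ₑ ^ (-(3 * δ)) := by
    have hx1 : jb x ^ (-μ) ≤ ‖x‖ₑ ^ (-(3 * δ)) :=
      (jb_rpow_mono (by linarith) x).trans (rpow_le_rpow_of_nonpos (enorm_le_jb x) (by linarith))
    have key : ∀ r s : ℝ, |s| ≤ |r| → |x| ≤ |r| → ξ = x + r + s →
        jb ξ ^ μ * jb r ^ (-μ) * jb s ^ (-μ) ≤ 3 ^ μ := by
      intro r s hs hxr hrs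
      have h1 : jb ξ ≤ 3 * jb r := by
        have := jb_le_of_abs_le (x := ξ) (y := r) (c := 3) (by norm_num) (by
          rw [hrs]; linarith [abs_add_le (x + r) s, abs_add_le x r])
        simpa using this
      calc jb ξ ^ μ * jb r ^ (-μ) * jb s ^ (-μ) ≤ (3 * jb r) ^ μ * jb r ^ (-μ) * 1 := by
            gcongr
            simpa using jb_rpow_mono (neg_nonpos.2 hμ) s
        _ = _ := by
            rw [ENNReal.mul_rpow_of_nonneg _ _ hμ, mul_one, mul_assoc, jb_rpow_mul_neg, mul_one]
    rcases le_total |z| |y| with h | h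
    · have hxy : |x| ≤ |y| := hmax.elim id (fun h' => h'.trans h)
      calc _ = (jb ξ ^ μ * jb y ^ (-μ) * jb z ^ (-μ)) * jb x ^ (-μ) := by ring
        _ ≤ _ := by gcongr; exact key y z h hxy hξ
    · have hxy : |x| ≤ |z| := hmax.elim (fun h' => h'.trans h) id
      calc _ = (jb ξ ^ μ * jb z ^ (-μ) * jb y ^ (-μ)) * jb x ^ (-μ) := by ring
        _ ≤ _ := by gcongr; exact key z y h hxy (by rw [hξ]; ring)
  -- As `x`, `y`, `z` are all `O(|z - y|)`, the resonance function is `O(|ξ - x| |z - y|²)`, while its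
  -- derivative in `y` is `12π²(ξ - x)(z - y)`.
  have hres : ‖resonance ξ x y‖ₑ ≤ K * (a * D ^ 2) := by
    rw [hK, ha, hD, ← enorm_pow, ← enorm_mul, ← enorm_mul]
    rw [enorm_le_iff_norm_le, resonance, Real.norm_eq_abs, Real.norm_eq_abs]
    have h1 : |ξ - y| ≤ 40 * |z - y| := by
      rw [hξ, show x + y + z - y = x + z by ring]
      linarith [abs_add_le x z, abs_nonneg (z - y)]
    have h2 : |x + y| ≤ 40 * |z - y| := by
      linarith [abs_add_le x y, abs_nonneg (z - y)]
    have h3 : |ξ - y| * |x + y| ≤ 1600 * |z - y| ^ 2 := by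
      calc _ ≤ (40 * |z - y|) * (40 * |z - y|) := by gcongr
        _ = _ := by ring
    have h4 : |resonance ξ x y| = 12 * Real.pi ^ 2 * (|ξ - x| * (|ξ - y| * |x + y|)) := by
      rw [resonance, abs_mul, abs_of_pos (by positivity : 0 < 12 * Real.pi ^ 2), abs_mul, abs_mul,
        mul_assoc |ξ - x|]
    rw [← resonance, h4, abs_mul, abs_of_pos (by positivity : 0 < 12 * Real.pi ^ 2 * 1600), abs_mul,
      abs_pow]
    calc 12 * Real.pi ^ 2 * (|ξ - x| * (|ξ - y| * |x + y|))
        ≤ 12 * Real.pi ^ 2 * (|ξ - x| * (1600 * |z - y| ^ 2)) := by gcongr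
      _ = _ := by ring
  have hder : a * D ≤ ‖12 * Real.pi ^ 2 * ((ξ - x) * (z - y))‖ₑ := by
    rw [enorm_mul, enorm_mul (ξ - x)]
    refine le_mul_of_one_le_left' ?_
    rw [← enorm_one (G := ℝ), enorm_le_iff_norm_le, Real.norm_eq_abs, Real.norm_eq_abs]
    rw [abs_one, abs_of_pos (by positivity)]
    linarith [one_le_twelve_pi_sq]
  have hm : max ‖x‖ₑ (‖ξ‖ₑ / 3) ≤ 10 * D := by
    have h10 : (10 : ℝ≥0∞) = ‖(10 : ℝ)‖ₑ := by simp [Real.enorm_eq_ofReal_abs]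
    have h3 : ‖ξ‖ₑ / 3 = ‖ξ / 3‖ₑ := by
      rw [div_eq_mul_inv, div_eq_mul_inv, enorm_mul]; congr 1
      rw [enorm_inv (by norm_num)]; congr 1; simp [Real.enorm_eq_ofReal_abs]
    rw [h3, h10, hD, ← enorm_mul]
    refine max_le ?_ ?_ <;>
      rw [enorm_le_iff_norm_le, Real.norm_eq_abs, Real.norm_eq_abs, abs_mul,
        abs_of_pos (by norm_num : (0:ℝ) < 10)]
    · exact hxD
    · rw [abs_div, abs_of_pos (by norm_num : (0:ℝ) < 3), hξ]
      linarith [abs_add_le (x + y) z, abs_add_le x y]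
  have hmain : 1 ≤ K ^ δ * 10 ^ (1 - 2 * δ) * (a ^ (δ - 1) * max ‖x‖ₑ (‖ξ‖ₑ / 3) ^ (2 * δ - 1)) *
      (‖12 * Real.pi ^ 2 * ((ξ - x) * (z - y))‖ₑ * ‖resonance ξ x y‖ₑ ^ (-δ)) := by
    calc (1 : ℝ≥0∞) = (K ^ δ * K ^ (-δ)) * (10 ^ (1 - 2 * δ) * 10 ^ (2 * δ - 1)) *
          (a ^ (δ - 1) * a ^ (1 : ℝ) * a ^ (-δ)) * (D ^ (2 * δ - 1) * D ^ (1 : ℝ) * D ^ (-(2 * δ))) := by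
          rw [← ENNReal.rpow_add _ _ hK0 hKt, ← ENNReal.rpow_add _ _ (by simp) (by simp),
            ← ENNReal.rpow_add _ _ ha0 hat, ← ENNReal.rpow_add _ _ ha0 hat,
            ← ENNReal.rpow_add _ _ hD0 hDt, ← ENNReal.rpow_add _ _ hD0 hDt]
          ring_nf; simp
      _ = K ^ δ * 10 ^ (1 - 2 * δ) * (a ^ (δ - 1) * (10 * D) ^ (2 * δ - 1)) *
          ((a * D) * (K * (a * D ^ 2)) ^ (-δ)) := by
          rw [ENNReal.mul_rpow_of_ne_top (by simp) hDt, ENNReal.mul_rpow_of_ne_top hKt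
            (ENNReal.mul_ne_top hat (by simp [hDt])), ENNReal.mul_rpow_of_ne_top hat (by simp [hDt]),
            ← ENNReal.rpow_natCast, ← ENNReal.rpow_mul, ENNReal.rpow_one, ENNReal.rpow_one]
          rw [show ((2 : ℕ) : ℝ) * -δ = -(2 * δ) by push_cast; ring]
          ring
      _ ≤ _ := by
          refine mul_le_mul' (mul_le_mul' le_rfl (mul_le_mul' le_rfl ?_)) (mul_le_mul' hder ?_)
          · exact rpow_le_rpow_of_nonpos hm (by linarith)
          · exact rpow_le_rpow_of_nonpos hres (by linarith)
  calc ‖ξ‖ₑ * jb ξ ^ μ * (jb x ^ (-μ) * jb y ^ (-μ) * jb z ^ (-μ))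
      ≤ ‖ξ‖ₑ * (3 ^ μ * ‖x‖ₑ ^ (-(3 * δ))) * 1 := by
        rw [mul_assoc, mul_one]; gcongr
    _ ≤ _ := mul_le_mul_right hmain _
    _ = _ := by rw [offDiagonalWeight]; ring

/-- Near the critical point all frequencies are comparable to `ξ`, so that the weights leave
`⟨ξ⟩^{-2μ}`, which is bounded by `|ξ|^{-3δ}`, while the resonance function is `O(|ξ|³)`. -/
lemma exists_near_bound {μ δ : ℝ} (hδ0 : 0 < δ) (hδμ : 3 * δ ≤ μ) :
    ∃ C : ℝ≥0, ∀ ξ x y : ℝ, ξ ≠ 0 → |x - ξ / 3| ≤ |ξ| / 20 → |y - ξ / 3| ≤ |ξ| / 20 →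
      jb ξ ^ μ * (jb x ^ (-μ) * jb y ^ (-μ) * jb (ξ - x - y) ^ (-μ)) ≤
        C * ‖resonance ξ x y‖ₑ ^ (-δ) := by
  have hμ : 0 ≤ μ := by linarith
  set K : ℝ≥0∞ := ‖12 * Real.pi ^ 2‖ₑ with hK
  have hK0 : K ≠ 0 := by rw [hK]; simp [Real.pi_ne_zero]
  have hKt : K ≠ ⊤ := enorm_ne_top
  obtain ⟨C, hC⟩ := ENNReal.canLift.prf ((5 ^ μ) ^ 3 * K ^ δ : ℝ≥0∞) (by
    refine ENNReal.mul_ne_top (ENNReal.pow_ne_top ?_) ?_ <;>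
    simp [ENNReal.rpow_eq_top_iff, hK0, hKt])
  refine ⟨C, fun ξ x y hξ hx hy => ?_⟩
  rw [hC]
  have hξ0 : ‖ξ‖ₑ ≠ 0 := by simpa using hξ
  have hξt : ‖ξ‖ₑ ≠ ⊤ := enorm_ne_top
  have hz : |(ξ - x - y) - ξ / 3| ≤ |ξ| / 10 := by
    rw [show (ξ - x - y) - ξ / 3 = -((x - ξ / 3) + (y - ξ / 3)) by ring, abs_neg]
    exact (abs_add_le _ _).trans (by linarith)
  have hcomp : ∀ r : ℝ, |r - ξ / 3| ≤ |ξ| / 10 → jb r ^ (-μ) ≤ 5 ^ μ * jb ξ ^ (-μ) := by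
    intro r hr
    have h1 : jb ξ ≤ 5 * jb r := by
      have := jb_le_of_abs_le (x := ξ) (y := r) (c := 5) (by norm_num) (by
        have := abs_add_le r (-(r - ξ / 3))
        rw [abs_neg, show r + -(r - ξ / 3) = ξ / 3 by ring, abs_div,
          abs_of_pos (by norm_num : (0:ℝ) < 3)] at this
        linarith [abs_nonneg ξ])
      simpa using this
    calc jb r ^ (-μ) = 5 ^ μ * (5 * jb r) ^ (-μ) := by
          rw [ENNReal.mul_rpow_of_ne_top (by simp) (jb_ne_top _), ← mul_assoc,
            ← ENNReal.rpow_add _ _ (by simp) (by simp)]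
          simp
      _ ≤ _ := mul_le_mul' le_rfl (rpow_le_rpow_of_nonpos h1 (by linarith))
  have hfac : ∀ r : ℝ, |r - ξ / 3| ≤ |ξ| / 10 → |ξ - r| ≤ |ξ| := by
    intro r hr
    have := abs_add_le (2 / 3 * ξ) (-(r - ξ / 3))
    rw [abs_neg, abs_mul, abs_of_pos (by norm_num : (0:ℝ) < 2 / 3),
      show 2 / 3 * ξ + -(r - ξ / 3) = ξ - r by ring] at this
    linarith [abs_nonneg ξ]
  have hres : ‖resonance ξ x y‖ₑ ≤ K * ‖ξ‖ₑ ^ 3 := by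
    rw [hK, ← enorm_pow, ← enorm_mul, enorm_le_iff_norm_le, Real.norm_eq_abs, Real.norm_eq_abs,
      resonance, abs_mul (12 * Real.pi ^ 2), abs_mul (12 * Real.pi ^ 2), abs_mul ((ξ - x) * (ξ - y)),
      abs_mul (ξ - x), abs_pow ξ]
    refine mul_le_mul_of_nonneg_left ?_ (abs_nonneg _)
    have h1 := hfac x (by linarith [abs_nonneg ξ])
    have h2 := hfac y (by linarith [abs_nonneg ξ])
    have h3 := hfac _ hz
    rw [show ξ - (ξ - x - y) = x + y by ring] at h3
    calc _ ≤ |ξ| * |ξ| * |ξ| := by gcongr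
      _ = _ := by ring
  calc jb ξ ^ μ * (jb x ^ (-μ) * jb y ^ (-μ) * jb (ξ - x - y) ^ (-μ))
      ≤ jb ξ ^ μ * ((5 ^ μ * jb ξ ^ (-μ)) * (5 ^ μ * jb ξ ^ (-μ)) * (5 ^ μ * jb ξ ^ (-μ))) := by
        gcongr
        · exact hcomp x (by linarith [abs_nonneg ξ])
        · exact hcomp y (by linarith [abs_nonneg ξ])
        · exact hcomp _ hz
    _ = (5 ^ μ) ^ 3 * ((jb ξ ^ μ * jb ξ ^ (-μ)) * (jb ξ ^ (-μ) * jb ξ ^ (-μ))) := by ring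
    _ ≤ (5 ^ μ) ^ 3 * ‖ξ‖ₑ ^ (-(3 * δ)) := by
        rw [jb_rpow_mul_neg, one_mul, jb_rpow_mul_rpow]
        gcongr
        exact (jb_rpow_mono (by linarith) ξ).trans
          (rpow_le_rpow_of_nonpos (enorm_le_jb ξ) (by linarith))
    _ = (5 ^ μ) ^ 3 * K ^ δ * (K * ‖ξ‖ₑ ^ 3) ^ (-δ) := by
        rw [ENNReal.mul_rpow_of_ne_top hKt (by simp [hξt]), ← ENNReal.rpow_natCast (‖ξ‖ₑ) 3,
          ← ENNReal.rpow_mul, mul_assoc, ← mul_assoc (K ^ δ), ← ENNReal.rpow_add _ _ hK0 hKt]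
        simp
    _ ≤ _ := by
        exact mul_le_mul' le_rfl (rpow_le_rpow_of_nonpos hres (by linarith))

/-- The restriction of the resonance function to a ray through its critical point `(ξ/3, ξ/3)`. -/
def rayCubic (ξ c d A : ℝ) : ℝ :=
  12 * Real.pi ^ 2 * ((2 * ξ / 3) ^ 3 - (2 * ξ / 3) * c * A ^ 2 + d * A ^ 3)

/-- The derivative of `rayCubic ξ c d`. -/
def rayCubicDeriv (ξ c d A : ℝ) : ℝ :=
  12 * Real.pi ^ 2 * (0 - (2 * ξ / 3) * c * (2 * A) + d * (3 * A ^ 2))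

lemma hasDerivAt_rayCubic (ξ c d A : ℝ) :
    HasDerivAt (rayCubic ξ c d) (rayCubicDeriv ξ c d A) A := by
  have h2 : HasDerivAt (fun A : ℝ => A ^ 2) (2 * A) A := by simpa using hasDerivAt_pow 2 A
  have h3 : HasDerivAt (fun A : ℝ => A ^ 3) (3 * A ^ 2) A := by simpa using hasDerivAt_pow 3 A
  exact ((((hasDerivAt_const A _).sub (h2.const_mul _)).add (h3.const_mul _)).const_mul _)

lemma le_enorm_rayCubicDeriv {ξ c d A : ℝ} (hc : 3 / 4 ≤ c) (hd : |d| ≤ 2)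
    (hA : |A| ≤ |ξ| / 20) : ‖ξ‖ₑ * ‖A‖ₑ ≤ ‖rayCubicDeriv ξ c d A‖ₑ := by
  rw [← enorm_mul, enorm_le_iff_norm_le, Real.norm_eq_abs, Real.norm_eq_abs, rayCubicDeriv,
    abs_mul, abs_mul, abs_of_pos (by positivity : 0 < 12 * Real.pi ^ 2)]
  have h1 : |0 - (2 * ξ / 3) * c * (2 * A) + d * (3 * A ^ 2)| =
      |A| * |d * (3 * A) - 4 / 3 * c * ξ| := by rw [← abs_mul]; congr 1; ring
  have h2 : |d * (3 * A)| ≤ 6 * (|ξ| / 20) := by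
    calc |d * (3 * A)| = |d| * (3 * |A|) := by
          rw [abs_mul, abs_mul 3 A, abs_of_pos (by norm_num : (0:ℝ) < 3)]
      _ ≤ 2 * (3 * (|ξ| / 20)) := by gcongr
      _ = _ := by ring
  have h3 : |4 / 3 * c * ξ| = 4 / 3 * c * |ξ| := by rw [abs_mul, abs_of_pos (by linarith)]
  have h4 := abs_sub_abs_le_abs_sub (4 / 3 * c * ξ) (d * (3 * A))
  rw [abs_sub_comm] at h4
  have h6 : 3 / 4 * |ξ| ≤ c * |ξ| := by gcongr
  have h5 : 2 / 3 * |ξ| ≤ |d * (3 * A) - 4 / 3 * c * ξ| := by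
    linarith [abs_nonneg ξ]
  rw [h1]
  calc |ξ| * |A| = 1 * (|ξ| * |A|) := by ring
    _ ≤ (12 * Real.pi ^ 2 * (2 / 3)) * (|ξ| * |A|) := by
        gcongr; exact one_le_twelve_pi_sq
    _ = 12 * Real.pi ^ 2 * (|A| * (2 / 3 * |ξ|)) := by ring
    _ ≤ _ := by gcongr

lemma rayCubic_injective {ξ c d a b : ℝ} (hξ : ξ ≠ 0) (hc : 3 / 4 ≤ c) (hd : |d| ≤ 2)
    (ha : |a| ≤ |ξ| / 20) (hb : |b| ≤ |ξ| / 20) (hsum : |a + b| = |a| + |b|)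
    (h : rayCubic ξ c d a = rayCubic ξ c d b) : a = b := by
  have h1 := mul_left_cancel₀ (by positivity : (12 * Real.pi ^ 2 : ℝ) ≠ 0) h
  by_contra hne
  have h2 : (a - b) * (d * (a ^ 2 + a * b + b ^ 2) - (2 * ξ / 3) * c * (a + b)) = 0 := by
    linear_combination h1
  have h3 : d * (a ^ 2 + a * b + b ^ 2) = (2 * ξ / 3) * c * (a + b) := by
    rcases mul_eq_zero.1 h2 with h3 | h3
    · exact absurd (sub_eq_zero.1 h3) hne
    · linarith
  have hpos : 0 < |a| + |b| := by
    by_contra! h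
    have h1 : |a| = 0 := by linarith [abs_nonneg a, abs_nonneg b]
    have h2 : |b| = 0 := by linarith [abs_nonneg a, abs_nonneg b]
    exact hne ((abs_eq_zero.1 h1).trans (abs_eq_zero.1 h2).symm)
  have h6 : |a ^ 2 + a * b + b ^ 2| ≤ (|a| + |b|) * (|ξ| / 10) := by
    calc |a ^ 2 + a * b + b ^ 2| ≤ |a ^ 2| + |a * b| + |b ^ 2| := abs_add_three _ _ _
      _ = |a| * |a| + |a| * |b| + |b| * |b| := by rw [abs_mul, abs_pow, abs_pow]; ring
      _ ≤ |a| * |a| + |a| * |b| + |b| * |b| + |a| * |b| :=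
          le_add_of_nonneg_right (by positivity)
      _ = (|a| + |b|) * (|a| + |b|) := by ring
      _ ≤ (|a| + |b|) * (|ξ| / 10) := by gcongr; linarith
  have h4 : |d * (a ^ 2 + a * b + b ^ 2)| ≤ 2 * ((|a| + |b|) * (|ξ| / 10)) := by
    rw [abs_mul]; gcongr
  have h5 : |2 * ξ / 3 * c * (a + b)| = 2 / 3 * c * |ξ| * (|a| + |b|) := by
    rw [abs_mul, hsum, abs_mul, abs_of_pos (by linarith : 0 < c),
      show 2 * ξ / 3 = 2 / 3 * ξ by ring, abs_mul, abs_of_pos (by norm_num : (0:ℝ) < 2 / 3)]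
    ring
  rw [h3, h5] at h4
  have h7 : 0 < |ξ| * (|a| + |b|) := mul_pos (abs_pos.2 hξ) hpos
  have h8 : 3 / 4 * (|ξ| * (|a| + |b|)) ≤ c * (|ξ| * (|a| + |b|)) := by gcongr
  linarith

/-- Along a ray through the critical point `(ξ/3, ξ/3)` of the resonance function, the radial
Jacobian `|A|` compensates the vanishing of the derivative. -/
lemma lintegral_ray_le {ξ s : ℝ} (hξ : ξ ≠ 0) (hs : |s| ≤ 1) (g : ℝ → ℝ≥0∞) :
    ‖ξ‖ₑ * ∫⁻ A in Icc (-(|ξ| / 20)) (|ξ| / 20),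
      ‖A‖ₑ * g (resonance ξ (ξ / 3 + A) (ξ / 3 + A * s)) ≤ 2 * ∫⁻ h, g h := by
  obtain ⟨c, hc⟩ : ∃ c, c = 1 + s + s ^ 2 := ⟨_, rfl⟩
  obtain ⟨d, hd⟩ : ∃ d, d = s * (1 + s) := ⟨_, rfl⟩
  have hs' := abs_le.1 hs
  have hc1 : 3 / 4 ≤ c := by nlinarith [sq_nonneg (s + 1 / 2)]
  have hd1 : |d| ≤ 2 := abs_le.2 ⟨by nlinarith [sq_nonneg (s + 1 / 2)], by nlinarith⟩
  have hform : ∀ A, resonance ξ (ξ / 3 + A) (ξ / 3 + A * s) = rayCubic ξ c d A := by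
    intro A; rw [resonance, rayCubic, hc, hd]; ring
  simp only [hform]
  have hsub : ∀ S : Set ℝ, MeasurableSet S → S ⊆ Icc (-(|ξ| / 20)) (|ξ| / 20) →
      (∀ a ∈ S, ∀ b ∈ S, |a + b| = |a| + |b|) →
      ∫⁻ A in S, ‖ξ‖ₑ * (‖A‖ₑ * g (rayCubic ξ c d A)) ≤ ∫⁻ h, g h := by
    intro S hS hSr hab
    refine le_trans (setLIntegral_mono' hS fun A hA => ?_)
      (setLIntegral_abs_deriv_mul_comp_le hS (fun A _ => hasDerivAt_rayCubic ξ c d A)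
        (fun a ha b hb h => rayCubic_injective hξ hc1 hd1 (abs_le.2 (hSr ha)) (abs_le.2 (hSr hb))
          (hab a ha b hb) h) g)
    rw [← mul_assoc]
    exact mul_le_mul' (le_enorm_rayCubicDeriv hc1 hd1 (abs_le.2 (hSr hA))) le_rfl
  rw [← lintegral_const_mul' _ _ enorm_ne_top, two_mul]
  have hr0 : 0 ≤ |ξ| / 20 := by positivity
  rw [← Icc_union_Icc_eq_Icc (neg_nonpos.2 hr0) hr0]
  refine (lintegral_union_le _ _ _).trans (add_le_add (hsub _ measurableSet_Icc ?_ ?_)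
    (hsub _ measurableSet_Icc ?_ ?_))
  · exact Icc_subset_Icc_right hr0
  · intro a ha b hb; exact abs_add_eq_add_abs_iff a b |>.2 (Or.inr ⟨ha.2, hb.2⟩)
  · exact Icc_subset_Icc_left (by linarith)
  · intro a ha b hb; exact abs_add_eq_add_abs_iff a b |>.2 (Or.inl ⟨ha.1, hb.1⟩)

/-- The part of the plane near the critical point, in coordinates centred there. -/
lemma lintegral_near_le {ξ : ℝ} (hξ : ξ ≠ 0) {g : ℝ → ℝ≥0∞} (hg : Measurable g) :
    ‖ξ‖ₑ * ∫⁻ x in Icc (ξ / 3 - |ξ| / 20) (ξ / 3 + |ξ| / 20),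
      ∫⁻ y in Icc (ξ / 3 - |ξ| / 20) (ξ / 3 + |ξ| / 20), g (resonance ξ x y) ≤
      8 * ∫⁻ h, g h := by
  set r := |ξ| / 20 with hr
  set k : ℝ × ℝ → ℝ≥0∞ := {p : ℝ × ℝ | |p.1| ≤ r ∧ |p.2| ≤ |p.1|}.indicator
    (fun p => g (resonance ξ (ξ / 3 + p.1) (ξ / 3 + p.2))) with hk
  have hres : Measurable fun p : ℝ × ℝ => resonance ξ (ξ / 3 + p.1) (ξ / 3 + p.2) := by
    unfold resonance; fun_prop
  have hkm : Measurable k := by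
    refine (hg.comp hres).indicator ?_
    rw [ofPred_and]
    exact (measurableSet_le (by fun_prop) (by fun_prop)).inter
      (measurableSet_le (by fun_prop) (by fun_prop))
  have hsymm : ∀ A B, resonance ξ (ξ / 3 + A) (ξ / 3 + B) = resonance ξ (ξ / 3 + B) (ξ / 3 + A) := by
    intro A B; simp only [resonance]; ring
  -- the cone `|B| ≤ |A|`, with `B = A s`
  have hcone : ‖ξ‖ₑ * ∫⁻ A, ∫⁻ B, k (A, B) ≤ 4 * ∫⁻ h, g h := by
    have h1 : ∫⁻ A, ∫⁻ B, k (A, B) = ∫⁻ A, ∫⁻ s, ‖A‖ₑ * k (A, A * s) := by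
      refine lintegral_congr_ae ?_
      filter_upwards [Measure.ae_ne volume (0:ℝ)] with A hA
      rw [lintegral_const_mul' _ _ enorm_ne_top,
        lintegral_comp_mul_left (fun B => k (A, B)) hA, ← mul_assoc,
        ENNReal.mul_inv_cancel (by simpa using hA) enorm_ne_top, one_mul]
    rw [h1, lintegral_lintegral_swap (by
      refine Measurable.aemeasurable ?_
      exact (by fun_prop : Measurable fun p : ℝ × ℝ => ‖p.1‖ₑ).mul (hkm.comp (by fun_prop))),
      ← lintegral_const_mul' _ _ enorm_ne_top]
    calc ∫⁻ s, ‖ξ‖ₑ * ∫⁻ A, ‖A‖ₑ * k (A, A * s)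
        ≤ ∫⁻ s, (Icc (-1 : ℝ) 1).indicator (fun _ => 2 * ∫⁻ h, g h) s := by
          refine lintegral_mono fun s => ?_
          by_cases hs : s ∈ Icc (-1 : ℝ) 1
          · rw [indicator_of_mem hs]
            refine le_trans ?_ (lintegral_ray_le hξ (abs_le.2 hs) g)
            rw [← lintegral_indicator measurableSet_Icc]
            gcongr with A
            simp only [hk, indicator]
            split_ifs with h2 h3 h3
            · exact le_rfl
            · exact absurd (abs_le.1 h2.1) h3
            · simp
            · simp
          · rw [indicator_of_notMem hs]
            simp only [nonpos_iff_eq_zero, mul_eq_zero]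
            right
            rw [lintegral_eq_zero_iff' (by
              refine Measurable.aemeasurable ?_
              exact measurable_id.enorm.mul (hkm.comp (by fun_prop)))]
            filter_upwards [Measure.ae_ne volume (0:ℝ)] with A hA
            simp only [hk, indicator, mem_ofPred_eq, Pi.zero_apply, mul_eq_zero]
            right
            rw [if_neg]
            rintro ⟨-, h3⟩
            rw [abs_mul] at h3
            exact hs (abs_le.1 ((mul_le_iff_le_one_right (abs_pos.2 hA)).1 h3))
      _ = 4 * ∫⁻ h, g h := by
          rw [lintegral_indicator_const measurableSet_Icc, Real.volume_Icc]
          rw [mul_right_comm, show (1 : ℝ) - -1 = 2 by norm_num]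
          congr 1; norm_num
  have hshift : ∫⁻ x in Icc (ξ / 3 - r) (ξ / 3 + r),
      ∫⁻ y in Icc (ξ / 3 - r) (ξ / 3 + r), g (resonance ξ x y) ≤
      (∫⁻ A, ∫⁻ B, k (A, B)) + ∫⁻ A, ∫⁻ B, k (B, A) := by
    rw [← lintegral_indicator measurableSet_Icc, ← lintegral_add_left_eq_self _ (ξ / 3),
      ← lintegral_add_left (by
        exact Measurable.lintegral_prod_right' (f := k) hkm)]
    refine lintegral_mono fun A => ?_
    rw [← lintegral_add_left (f := fun B => k (A, B)) (hkm.comp (by fun_prop))]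
    by_cases hA : ξ / 3 + A ∈ Icc (ξ / 3 - r) (ξ / 3 + r)
    · rw [indicator_of_mem hA, ← lintegral_indicator measurableSet_Icc,
        ← lintegral_add_left_eq_self _ (ξ / 3)]
      refine lintegral_mono fun B => ?_
      by_cases hB : ξ / 3 + B ∈ Icc (ξ / 3 - r) (ξ / 3 + r)
      · rw [indicator_of_mem hB]
        have hA' : |A| ≤ r := abs_le.2 ⟨by linarith [hA.1], by linarith [hA.2]⟩
        have hB' : |B| ≤ r := abs_le.2 ⟨by linarith [hB.1], by linarith [hB.2]⟩
        rcases le_total |B| |A| with h | h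
        · refine le_trans ?_ le_self_add
          simp only [hk, indicator, mem_ofPred_eq]
          rw [if_pos ⟨hA', h⟩]
        · refine le_trans ?_ le_add_self
          simp only [hk, indicator, mem_ofPred_eq]
          rw [if_pos ⟨hB', h⟩, hsymm]
      · rw [indicator_of_notMem hB]; exact zero_le
    · rw [indicator_of_notMem hA]; exact zero_le
  have hswap : ∫⁻ A, ∫⁻ B, k (B, A) = ∫⁻ A, ∫⁻ B, k (A, B) :=
    lintegral_lintegral_swap (f := fun A B => k (B, A))
      (hkm.comp measurable_swap).aemeasurable
  calc _ ≤ ‖ξ‖ₑ * ((∫⁻ A, ∫⁻ B, k (A, B)) + ∫⁻ A, ∫⁻ B, k (B, A)) := by gcongr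
    _ ≤ 4 * (∫⁻ h, g h) + 4 * ∫⁻ h, g h := by
        rw [hswap, mul_add]; exact add_le_add hcone hcone
    _ = _ := by rw [← add_mul]; norm_num

/-- The cyclic permutations of three frequencies with prescribed sum preserve the measure. -/
lemma lintegral_lintegral_cyclic {g : ℝ × ℝ × ℝ → ℝ≥0∞} (hg : Measurable g) (ξ : ℝ) :
    ∫⁻ x, ∫⁻ y, g (y, ξ - x - y, x) = ∫⁻ x, ∫⁻ y, g (x, y, ξ - x - y) := by
  rw [lintegral_lintegral_swap (f := fun x y => g (y, ξ - x - y, x))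
    (hg.comp (by fun_prop : Measurable fun p : ℝ × ℝ =>
      (p.2, ξ - p.1 - p.2, p.1))).aemeasurable]
  refine lintegral_congr fun y => ?_
  rw [← lintegral_sub_left_eq_self _ (ξ - y)]
  refine lintegral_congr fun x => ?_
  congr 3; ring

lemma lintegral_lintegral_add {u : ℝ × ℝ → ℝ≥0∞} (hu : Measurable u) (v : ℝ → ℝ → ℝ≥0∞) :
    ∫⁻ x, ∫⁻ y, (u (x, y) + v x y) = (∫⁻ x, ∫⁻ y, u (x, y)) + ∫⁻ x, ∫⁻ y, v x y := by
  rw [← lintegral_add_left hu.lintegral_prod_right']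
  exact lintegral_congr fun x => lintegral_add_left (hu.comp measurable_prodMk_left) _

lemma measurableSet_farPair : MeasurableSet {p : ℝ × ℝ × ℝ | farPair p.1 p.2.1 p.2.2} := by
  simp only [farPair, ofPred_and, ofPred_or]
  refine ((measurableSet_le ?_ ?_).union (measurableSet_le ?_ ?_)).inter
    ((measurableSet_le ?_ ?_).inter (measurableSet_le ?_ ?_)) <;> fun_prop

/-- The push-forward of the weighted frequency measure by the resonance function has, uniformly in
the output frequency, the density `|h|^{-δ}`. -/
theorem exists_pushforward_le {μ δ : ℝ} (hδ0 : 0 < δ) (hδμ : 3 * δ ≤ μ) (hδ : 3 * δ < 1) :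
    ∃ C : ℝ≥0, ∀ (ξ : ℝ) (φ : ℝ → ℝ≥0∞), Measurable φ →
      ‖ξ‖ₑ * jb ξ ^ μ * ∫⁻ x, ∫⁻ y, (jb x ^ (-μ) * jb y ^ (-μ) * jb (ξ - x - y) ^ (-μ)) *
        φ (resonance ξ x y) ≤ C * ∫⁻ h, φ h * ‖h‖ₑ ^ (-δ) := by
  obtain ⟨C₁, hC₁⟩ := exists_farPair_bound hδ0 hδμ (by linarith)
  obtain ⟨C₂, hC₂⟩ := exists_near_bound hδ0 hδμ
  obtain ⟨J, hJ⟩ := ENNReal.canLift.prf _ (lintegral_offDiagonalWeight_one_lt_top hδ0 hδ).ne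
  refine ⟨3 * (C₁ * J * 2) + C₂ * 8, fun ξ φ hφ => ?_⟩
  rcases eq_or_ne ξ 0 with rfl | hξ
  · simp
  set I := ∫⁻ h, φ h * ‖h‖ₑ ^ (-δ) with hI
  set f : ℝ × ℝ × ℝ → ℝ≥0∞ := fun p => ‖ξ‖ₑ * jb ξ ^ μ *
    (jb p.1 ^ (-μ) * jb p.2.1 ^ (-μ) * jb p.2.2 ^ (-μ)) *
    φ (12 * Real.pi ^ 2 * ((ξ - p.1) * (ξ - p.2.1) * (ξ - p.2.2))) with hf
  have hfm : Measurable f := by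
    have : Measurable fun p : ℝ × ℝ × ℝ =>
      12 * Real.pi ^ 2 * ((ξ - p.1) * (ξ - p.2.1) * (ξ - p.2.2)) := by fun_prop
    exact (by fun_prop : Measurable fun p : ℝ × ℝ × ℝ => ‖ξ‖ₑ * jb ξ ^ μ *
      (jb p.1 ^ (-μ) * jb p.2.1 ^ (-μ) * jb p.2.2 ^ (-μ))).mul (hφ.comp this)
  have hfres : ∀ x y, f (x, y, ξ - x - y) = ‖ξ‖ₑ * jb ξ ^ μ *
      (jb x ^ (-μ) * jb y ^ (-μ) * jb (ξ - x - y) ^ (-μ)) * φ (resonance ξ x y) := by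
    intro x y
    simp only [hf, resonance, show ξ - (ξ - x - y) = x + y by ring]
  have hfcyc : ∀ x y z, f (x, y, z) = f (y, z, x) := by
    intro x y z
    simp only [hf]
    rw [show (ξ - x) * (ξ - y) * (ξ - z) = (ξ - y) * (ξ - z) * (ξ - x) by ring]
    ring
  set F := {p : ℝ × ℝ × ℝ | farPair p.1 p.2.1 p.2.2}.indicator f with hF
  have hFm : Measurable F := hfm.indicator measurableSet_farPair
  have hFin : ∀ x y z, farPair x y z → F (x, y, z) = f (x, y, z) := fun x y z h =>
    indicator_of_mem (s := {p : ℝ × ℝ × ℝ | farPair p.1 p.2.1 p.2.2}) (by exact h) f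
  -- On far pairs the resonance function serves as the variable in place of `y`.
  have hfar : ∫⁻ x, ∫⁻ y, F (x, y, ξ - x - y) ≤ C₁ * J * 2 * I := by
    calc ∫⁻ x, ∫⁻ y, F (x, y, ξ - x - y)
        ≤ ∫⁻ x, C₁ * offDiagonalWeight δ ξ x * (2 * I) := by
          refine lintegral_mono_ae ?_
          filter_upwards [Measure.ae_ne volume (0:ℝ), Measure.ae_ne volume ξ] with x hx hxξ
          have hxξ' : ξ - x ≠ 0 := sub_ne_zero.2 hxξ.symm
          refine le_trans ?_ (mul_le_mul_right (lintegral_comp_resonance_le hxξ'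
            (fun h => φ h * ‖h‖ₑ ^ (-δ))) _)
          rw [← lintegral_const_mul _ (by
            refine Measurable.mul (by fun_prop) ?_
            have : Measurable (resonance ξ x) := by unfold resonance; fun_prop
            exact (hφ.comp this).mul (by fun_prop))]
          refine lintegral_mono fun y => ?_
          by_cases h : farPair x y (ξ - x - y)
          · rw [hFin _ _ _ h, hfres]
            refine (mul_le_mul_left (hC₁ ξ x y hx hxξ' h) _).trans (le_of_eq ?_)
            ring
          · rw [hF, indicator_of_notMem (by exact h)]; exact zero_le
      _ = C₁ * J * 2 * I := by
          have hm : Measurable (offDiagonalWeight δ ξ) := by unfold offDiagonalWeight; fun_prop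
          rw [lintegral_mul_const _ (hm.const_mul _), lintegral_const_mul _ hm,
            lintegral_offDiagonalWeight_eq hξ, ← hJ]
          ring
  -- Near the critical point `(ξ/3, ξ/3)` the resonance function is used along rays instead.
  set S := Icc (ξ / 3 - |ξ| / 20) (ξ / 3 + |ξ| / 20) with hS
  set E : ℝ → ℝ → ℝ≥0∞ := fun x y => S.indicator (fun x => S.indicator (fun y =>
    f (x, y, ξ - x - y)) y) x with hE
  have hnear : ∫⁻ x, ∫⁻ y, E x y ≤ C₂ * 8 * I := by
    have hgm : Measurable fun h : ℝ => φ h * ‖h‖ₑ ^ (-δ) := by fun_prop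
    calc ∫⁻ x, ∫⁻ y, E x y
        ≤ ∫⁻ x in S, ∫⁻ y in S, C₂ * ‖ξ‖ₑ *
            (φ (resonance ξ x y) * ‖resonance ξ x y‖ₑ ^ (-δ)) := by
          rw [← lintegral_indicator measurableSet_Icc]
          refine lintegral_mono fun x => ?_
          by_cases hx : x ∈ S
          · rw [indicator_of_mem hx, ← lintegral_indicator measurableSet_Icc]
            refine lintegral_mono fun y => ?_
            simp only [hE, indicator_of_mem hx]
            by_cases hy : y ∈ S
            · rw [indicator_of_mem hy, indicator_of_mem hy, hfres]
              have := hC₂ ξ x y hξ (abs_le.2 ⟨by linarith [hx.1], by linarith [hx.2]⟩)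
                (abs_le.2 ⟨by linarith [hy.1], by linarith [hy.2]⟩)
              calc _ = ‖ξ‖ₑ * (jb ξ ^ μ * (jb x ^ (-μ) * jb y ^ (-μ) * jb (ξ - x - y) ^ (-μ))) *
                    φ (resonance ξ x y) := by ring
                _ ≤ ‖ξ‖ₑ * (C₂ * ‖resonance ξ x y‖ₑ ^ (-δ)) * φ (resonance ξ x y) := by gcongr
                _ = _ := by ring
            · rw [indicator_of_notMem hy]; exact zero_le
          · simp [hE, indicator_of_notMem hx]
      _ = C₂ * (‖ξ‖ₑ * ∫⁻ x in S, ∫⁻ y in S,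
            (φ (resonance ξ x y) * ‖resonance ξ x y‖ₑ ^ (-δ))) := by
          simp_rw [lintegral_const_mul' _ _ (ENNReal.mul_ne_top (ENNReal.coe_ne_top (r := C₂))
            (enorm_ne_top (x := ξ)))]
          rw [mul_assoc]
      _ ≤ C₂ * (8 * I) := mul_le_mul' le_rfl (lintegral_near_le hξ hgm)
      _ = _ := by ring
  have hcov : ∀ x y, f (x, y, ξ - x - y) ≤ F (x, y, ξ - x - y) + F (y, ξ - x - y, x) +
      F (ξ - x - y, x, y) + E x y := by
    intro x y
    have hsum : x + y + (ξ - x - y) = ξ := by ring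
    rcases farPair_or_near x y (ξ - x - y) with h | h | h | ⟨h, h'⟩
    · rw [hFin _ _ _ h, add_assoc, add_assoc]; exact le_self_add
    · refine le_trans (b := F (y, ξ - x - y, x)) ?_ (le_add_of_le_of_nonneg
        (le_add_of_le_of_nonneg (le_add_of_nonneg_of_le zero_le le_rfl) zero_le) zero_le)
      rw [hFin _ _ _ h, hfcyc x]
    · refine le_trans (b := F (ξ - x - y, x, y)) ?_
        (le_add_of_le_of_nonneg (le_add_of_nonneg_of_le zero_le le_rfl) zero_le)
      rw [hFin _ _ _ h, hfcyc (ξ - x - y)]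
    · rw [hsum, abs_le] at h h'
      have hx : x ∈ S := ⟨by linarith [h.1], by linarith [h.2]⟩
      have hy : y ∈ S := ⟨by linarith [h'.1], by linarith [h'.2]⟩
      simp only [hE, indicator_of_mem hx, indicator_of_mem hy]
      exact le_add_self
  have hm1 : Measurable fun p : ℝ × ℝ => F (p.1, p.2, ξ - p.1 - p.2) := hFm.comp (by fun_prop)
  have hm2 : Measurable fun p : ℝ × ℝ => F (p.2, ξ - p.1 - p.2, p.1) := hFm.comp (by fun_prop)
  have hm3 : Measurable fun p : ℝ × ℝ => F (ξ - p.1 - p.2, p.1, p.2) := hFm.comp (by fun_prop)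
  have hcyc2 : ∫⁻ x, ∫⁻ y, F (ξ - x - y, x, y) = ∫⁻ x, ∫⁻ y, F (x, y, ξ - x - y) := by
    rw [← lintegral_lintegral_cyclic hFm ξ, ← lintegral_lintegral_cyclic
      (g := fun p : ℝ × ℝ × ℝ => F (p.2.1, p.2.2, p.1)) (hFm.comp (by fun_prop)) ξ]
  calc ‖ξ‖ₑ * jb ξ ^ μ * ∫⁻ x, ∫⁻ y, (jb x ^ (-μ) * jb y ^ (-μ) * jb (ξ - x - y) ^ (-μ)) *
        φ (resonance ξ x y)
      = ∫⁻ x, ∫⁻ y, f (x, y, ξ - x - y) := by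
        have hne : ‖ξ‖ₑ * jb ξ ^ μ ≠ ⊤ := ENNReal.mul_ne_top enorm_ne_top (jb_rpow_ne_top _ _)
        simp_rw [← lintegral_const_mul' _ _ hne, hfres, mul_assoc]
    _ ≤ ∫⁻ x, ∫⁻ y, (F (x, y, ξ - x - y) + F (y, ξ - x - y, x) +
          F (ξ - x - y, x, y) + E x y) := by
        gcongr with x y; exact hcov x y
    _ = (∫⁻ x, ∫⁻ y, F (x, y, ξ - x - y)) + (∫⁻ x, ∫⁻ y, F (y, ξ - x - y, x)) +
          (∫⁻ x, ∫⁻ y, F (ξ - x - y, x, y)) + ∫⁻ x, ∫⁻ y, E x y := by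
        have e1 := lintegral_lintegral_add hm1 (fun x y => F (y, ξ - x - y, x))
        have e2 := lintegral_lintegral_add (hm1.add hm2) (fun x y => F (ξ - x - y, x, y))
        have e3 := lintegral_lintegral_add ((hm1.add hm2).add hm3) E
        simp only [Pi.add_apply] at e1 e2 e3
        rw [e3, e2, e1]
    _ ≤ C₁ * J * 2 * I + C₁ * J * 2 * I + C₁ * J * 2 * I + C₂ * 8 * I := by
        rw [lintegral_lintegral_cyclic hFm, hcyc2]
        gcongr
    _ = _ := by push_cast; ring

/-! ### Majorants of space-time Fourier transforms -/

lemma continuous_omega : Continuous omega := by unfold omega; fun_prop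

@[fun_prop]
lemma measurable_omega : Measurable omega := continuous_omega.measurable

/-- The shear `(τ, ξ) ↦ (τ + a(ξ), ξ)` preserves Lebesgue measure. -/
lemma measurePreserving_shear {a : ℝ → ℝ} (ha : Measurable a) :
    MeasurePreserving (fun q : ℝ × ℝ => (q.1 + a q.2, q.2)) volume volume := by
  have h := (MeasurePreserving.id (volume : Measure ℝ)).skew_product (μb := volume)
    (μd := (volume : Measure ℝ)) (g := fun x t => t + a x) (by fun_prop)
    (ae_of_all _ fun x => (measurePreserving_add_right volume (a x)).map_eq)
  have h2 := (Measure.measurePreserving_swap (μ := (volume : Measure ℝ))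
    (ν := (volume : Measure ℝ)))
  exact h2.comp (h.comp h2)

/-- `M` controls the profile `F(τ + ω(ξ), ξ)` of `F`, uniformly in the frequency `ξ`. -/
structure IsMajorant (μ : ℝ) (F : ℝ × ℝ → ℂ) (M : ℝ → ℝ≥0∞) : Prop where
  aesm : AEStronglyMeasurable F volume
  meas : Measurable M
  le : ∀ᵐ q : ℝ × ℝ, ‖F q‖ₑ ≤ jb q.2 ^ (-μ) * M (q.1 - omega q.2)

/-- The weighted norm `‖⟨τ⟩^b M‖_{L²}` of a majorant. -/
def wnorm (b : ℝ) (M : ℝ → ℝ≥0∞) : ℝ≥0∞ := eLpNorm (fun τ => jb τ ^ b * M τ) 2 volume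

lemma weightedSup_le_of_ae {μ : ℝ} {f : ℝ → ℂ} {c : ℝ≥0∞} (h : ∀ᵐ ξ, ‖f ξ‖ₑ ≤ jb ξ ^ (-μ) * c) :
    weightedSup μ f ≤ c := by
  rw [weightedSup, eLpNorm_exponent_top]
  refine eLpNormEssSup_le_of_ae_enorm_bound ?_
  filter_upwards [h] with ξ hξ
  rw [enorm_mul, ← ofReal_norm, Complex.norm_real, Real.norm_of_nonneg
    (Real.rpow_nonneg (japaneseBracket_pos ξ).le _), ofReal_japaneseBracket_rpow]
  refine (mul_le_mul_right hξ _).trans (le_of_eq ?_)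
  rw [← mul_assoc, jb_rpow_mul_neg, one_mul]

lemma ae_le_weightedSup (μ : ℝ) (f : ℝ → ℂ) :
    ∀ᵐ ξ, ‖f ξ‖ₑ ≤ jb ξ ^ (-μ) * weightedSup μ f := by
  rw [weightedSup, eLpNorm_exponent_top]
  filter_upwards [enorm_ae_le_eLpNormEssSup (fun ξ => ((japaneseBracket ξ ^ μ : ℝ) : ℂ) * f ξ)
    volume] with ξ hξ
  refine le_trans (le_of_eq ?_) (mul_le_mul_right hξ _)
  rw [enorm_mul, ← ofReal_norm (E := ℂ) (((japaneseBracket ξ ^ μ : ℝ) : ℂ)),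
    Complex.norm_real, Real.norm_of_nonneg
    (Real.rpow_nonneg (japaneseBracket_pos ξ).le _), ofReal_japaneseBracket_rpow,
    ← mul_assoc, mul_comm (jb ξ ^ (-μ)), jb_rpow_mul_neg, one_mul]

lemma weightedSup_congr {μ : ℝ} {f g : ℝ → ℂ} (h : f =ᵐ[volume] g) :
    weightedSup μ f = weightedSup μ g := by
  refine eLpNorm_congr_ae ?_
  filter_upwards [h] with ξ hξ
  rw [hξ]

lemma measurable_essSup_prod {g : ℝ × ℝ → ℝ≥0∞} (hg : Measurable g) :
    Measurable fun τ => essSup (fun ξ => g (τ, ξ)) volume := by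
  refine measurable_of_Iic fun c => ?_
  have : (fun τ => essSup (fun ξ => g (τ, ξ)) volume) ⁻¹' Iic c =
      (fun τ => volume (Prod.mk τ ⁻¹' {q | c < g q})) ⁻¹' {0} := by
    ext τ
    simp only [mem_preimage, mem_Iic, mem_singleton_iff]
    have h0 : volume (Prod.mk τ ⁻¹' {q | c < g q}) = 0 ↔ ∀ᵐ ξ, g (τ, ξ) ≤ c := by
      rw [ae_iff]; simp only [not_le]; rfl
    rw [h0]
    refine ⟨fun h => ?_, fun h => essSup_le_of_ae_le _ h⟩
    filter_upwards [ae_le_essSup (f := fun ξ => g (τ, ξ)) (μ := volume)] with ξ hξ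
    exact hξ.trans h
  rw [this]
  exact measurable_measure_prodMk_left (measurableSet_lt measurable_const hg)
    (measurableSet_singleton 0)

lemma bourgainNorm_le_wnorm {μ b : ℝ} {F : ℝ × ℝ → ℂ} {M : ℝ → ℝ≥0∞} (h : IsMajorant μ F M) :
    bourgainNorm μ b F ≤ wnorm b M := by
  refine eLpNorm_mono_enorm_ae ?_
  have h1 := (measurePreserving_shear measurable_omega).quasiMeasurePreserving.ae h.le
  filter_upwards [Measure.ae_ae_of_ae_prod h1] with τ hτ
  simp only [enorm_eq_self]
  rw [ofReal_japaneseBracket_rpow]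
  gcongr
  exact weightedSup_le_of_ae (by simpa using hτ)

lemma exists_isMajorant {F : ℝ × ℝ → ℂ} (hF : AEStronglyMeasurable F volume) (μ : ℝ) :
    ∃ M, IsMajorant μ F M ∧ ∀ b, wnorm b M = bourgainNorm μ b F := by
  set F' := hF.mk F with hF'
  have hm : Measurable F' := hF.stronglyMeasurable_mk.measurable
  have hae : F =ᵐ[volume] F' := hF.ae_eq_mk
  have hjm : Measurable japaneseBracket := continuous_japaneseBracket.measurable
  have hM : Measurable fun τ => weightedSup μ (fun ξ => F' (τ + omega ξ, ξ)) := by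
    simp only [weightedSup, eLpNorm_exponent_top, eLpNormEssSup]
    refine measurable_essSup_prod (g := fun q : ℝ × ℝ =>
      ‖((japaneseBracket q.2 ^ μ : ℝ) : ℂ) * F' (q.1 + omega q.2, q.2)‖ₑ) ?_
    refine Measurable.enorm (Measurable.mul ?_ (hm.comp (by fun_prop)))
    exact Complex.measurable_ofReal.comp ((hjm.comp measurable_snd).pow_const μ)
  have hsh := (measurePreserving_shear measurable_omega).quasiMeasurePreserving
  refine ⟨fun τ => weightedSup μ (fun ξ => F' (τ + omega ξ, ξ)), ⟨hF, hM, ?_⟩, fun b => ?_⟩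
  · have h1 : ∀ᵐ q : ℝ × ℝ, ‖F' (q.1 + omega q.2, q.2)‖ₑ ≤ jb q.2 ^ (-μ) *
        weightedSup μ (fun ξ => F' (q.1 + omega ξ, ξ)) := by
      refine (Measure.ae_prod_iff_ae_ae (p := fun q : ℝ × ℝ => ‖F' (q.1 + omega q.2, q.2)‖ₑ ≤
        jb q.2 ^ (-μ) * weightedSup μ (fun ξ => F' (q.1 + omega ξ, ξ))) ?_).2 ?_
      · refine measurableSet_le ?_ ?_
        · exact (hm.comp (by fun_prop)).enorm
        · exact (by fun_prop : Measurable fun q : ℝ × ℝ => jb q.2 ^ (-μ)).mul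
            (hM.comp measurable_fst)
      · exact ae_of_all _ fun τ => ae_le_weightedSup μ (fun ξ => F' (τ + omega ξ, ξ))
    have h2 := (measurePreserving_shear (a := fun ξ => - omega ξ)
      (by fun_prop)).quasiMeasurePreserving.ae h1
    filter_upwards [h2, hae] with q hq hq'
    rw [hq']
    simpa [sub_eq_add_neg] using hq
  · refine eLpNorm_congr_ae ?_
    have h3 := hsh.ae hae
    filter_upwards [Measure.ae_ae_of_ae_prod h3] with τ hτ
    rw [ofReal_japaneseBracket_rpow]
    congr 1
    refine weightedSup_congr ?_
    filter_upwards [hτ] with ξ hξ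
    exact hξ.symm

lemma wnorm_mono {b : ℝ} {M N : ℝ → ℝ≥0∞} (h : ∀ τ, M τ ≤ N τ) : wnorm b M ≤ wnorm b N := by
  refine eLpNorm_mono_enorm fun τ => ?_
  simp only [enorm_eq_self]
  gcongr; exact h τ

lemma wnorm_const_mul {b : ℝ} {c : ℝ≥0∞} (hc : c ≠ ⊤) (M : ℝ → ℝ≥0∞) :
    wnorm b (fun τ => c * M τ) = c * wnorm b M := by
  refine (ENNReal.pow_right_strictMono (n := 2) (by norm_num)).injective ?_
  simp only [wnorm]
  rw [mul_pow, eLpNorm_two_sq, eLpNorm_two_sq, ← lintegral_const_mul' _ _ (by simp [hc])]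
  refine lintegral_congr fun τ => ?_
  ring

lemma exists_lintegral_le_wnorm {b : ℝ} (hb : 1 / 2 < b) :
    ∃ C : ℝ≥0, ∀ M : ℝ → ℝ≥0∞, Measurable M → ∫⁻ τ, M τ ≤ C * wnorm b M := by
  have h : eLpNorm (fun τ => jb τ ^ (-b)) 2 volume ≠ ⊤ := by
    have h1 : (eLpNorm (fun τ => jb τ ^ (-b)) 2 volume) ^ 2 ≠ ⊤ := by
      rw [eLpNorm_two_sq]
      have : ∀ τ, (jb τ ^ (-b)) ^ 2 = jb τ ^ (-(2 * b)) := fun τ => by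
        rw [sq, jb_rpow_mul_rpow]; congr 1; ring
      simp_rw [this]
      exact (lintegral_jb_rpow_lt_top (by linarith)).ne
    simpa using h1
  obtain ⟨C, hC⟩ := ENNReal.canLift.prf _ h
  refine ⟨C, fun M hM => ?_⟩
  calc ∫⁻ τ, M τ = ∫⁻ τ, jb τ ^ (-b) * (jb τ ^ b * M τ) := by
        refine lintegral_congr fun τ => ?_
        rw [← mul_assoc, mul_comm (jb τ ^ (-b)), jb_rpow_mul_neg, one_mul]
    _ ≤ _ := by
        rw [hC]
        exact lintegral_mul_le_eLpNorm (by fun_prop) (by fun_prop)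

/-! ### The trilinear estimate -/

/-- The polarised form of `cubeIntegrand`. -/
def triIntegrand (F₁ F₂ F₃ : ℝ × ℝ → ℂ) (q : ℝ × ℝ) (p : (ℝ × ℝ) × (ℝ × ℝ)) : ℂ :=
  F₁ p.1 * F₂ p.2 * F₃ (q - p.1 - p.2)

/-- The convolution `F₁ * F₂ * F₃`, the polarised form of `cubeFourier`. -/
def triFourier (F₁ F₂ F₃ : ℝ × ℝ → ℂ) (q : ℝ × ℝ) : ℂ := ∫ p, triIntegrand F₁ F₂ F₃ q p

/-- The convolution `|F₁| * |F₂| * |F₃|`. -/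
def triAbs (F₁ F₂ F₃ : ℝ × ℝ → ℂ) (q : ℝ × ℝ) : ℝ≥0∞ := ∫⁻ p, ‖triIntegrand F₁ F₂ F₃ q p‖ₑ

lemma cubeFourier_eq (F : ℝ × ℝ → ℂ) : cubeFourier F = triFourier F F F := rfl

lemma enorm_triFourier_le (F₁ F₂ F₃ : ℝ × ℝ → ℂ) (q : ℝ × ℝ) :
    ‖triFourier F₁ F₂ F₃ q‖ₑ ≤ triAbs F₁ F₂ F₃ q := enorm_integral_le_lintegral_enorm _

/-- For fixed `q`, the map `p ↦ q - p₁ - p₂` respects null sets. -/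
lemma quasiMeasurePreserving_sub_sub (q : ℝ × ℝ) :
    Measure.QuasiMeasurePreserving (fun p : (ℝ × ℝ) × (ℝ × ℝ) => q - p.1 - p.2) volume volume := by
  have h1 : MeasurePreserving (fun p : (ℝ × ℝ) × (ℝ × ℝ) => (p.1, q - p.1 - p.2)) volume volume :=
    (MeasurePreserving.id (volume : Measure (ℝ × ℝ))).skew_product (μb := volume)
      (μd := (volume : Measure (ℝ × ℝ))) (g := fun x y => q - x - y) (by fun_prop)
      (ae_of_all _ fun x => (Measure.measurePreserving_sub_left volume (q - x)).map_eq)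
  exact Measure.quasiMeasurePreserving_snd.comp h1.quasiMeasurePreserving

lemma quasiMeasurePreserving_sub_sub' :
    Measure.QuasiMeasurePreserving
      (fun z : (ℝ × ℝ) × ((ℝ × ℝ) × (ℝ × ℝ)) => z.1 - z.2.1 - z.2.2) volume volume := by
  have h1 : MeasurePreserving (fun z : ((ℝ × ℝ) × (ℝ × ℝ)) × (ℝ × ℝ) =>
      (z.1, z.2 - z.1.1 - z.1.2)) volume volume :=
    (MeasurePreserving.id (volume : Measure ((ℝ × ℝ) × (ℝ × ℝ)))).skew_product (μb := volume)
      (μd := (volume : Measure (ℝ × ℝ))) (g := fun x y => y - x.1 - x.2) (by fun_prop)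
      (ae_of_all _ fun x => by
        have := (measurePreserving_sub_right (volume : Measure (ℝ × ℝ)) (x.1 + x.2)).map_eq
        simpa only [sub_add_eq_sub_sub] using this)
  have h2 := Measure.quasiMeasurePreserving_snd.comp h1.quasiMeasurePreserving
  exact h2.comp (Measure.measurePreserving_swap (μ := (volume : Measure (ℝ × ℝ)))
    (ν := (volume : Measure ((ℝ × ℝ) × (ℝ × ℝ))))).quasiMeasurePreserving

lemma aestronglyMeasurable_triIntegrand {F₁ F₂ F₃ : ℝ × ℝ → ℂ}
    (h₁ : AEStronglyMeasurable F₁ volume) (h₂ : AEStronglyMeasurable F₂ volume)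
    (h₃ : AEStronglyMeasurable F₃ volume) (q : ℝ × ℝ) :
    AEStronglyMeasurable (triIntegrand F₁ F₂ F₃ q) volume :=
  ((h₁.comp_quasiMeasurePreserving Measure.quasiMeasurePreserving_fst).mul
    (h₂.comp_quasiMeasurePreserving Measure.quasiMeasurePreserving_snd)).mul
    (h₃.comp_quasiMeasurePreserving (quasiMeasurePreserving_sub_sub q))

lemma aestronglyMeasurable_triIntegrand' {F₁ F₂ F₃ : ℝ × ℝ → ℂ}
    (h₁ : AEStronglyMeasurable F₁ volume) (h₂ : AEStronglyMeasurable F₂ volume)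
    (h₃ : AEStronglyMeasurable F₃ volume) :
    AEStronglyMeasurable (fun z : (ℝ × ℝ) × ((ℝ × ℝ) × (ℝ × ℝ)) => triIntegrand F₁ F₂ F₃ z.1 z.2)
      (volume.prod volume) := by
  have hs : Measure.QuasiMeasurePreserving
    (fun z : (ℝ × ℝ) × ((ℝ × ℝ) × (ℝ × ℝ)) => z.2) volume volume := Measure.quasiMeasurePreserving_snd
  exact ((h₁.comp_quasiMeasurePreserving (Measure.quasiMeasurePreserving_fst.comp hs)).mul
    (h₂.comp_quasiMeasurePreserving (Measure.quasiMeasurePreserving_snd.comp hs))).mul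
    (h₃.comp_quasiMeasurePreserving quasiMeasurePreserving_sub_sub')

lemma aestronglyMeasurable_triFourier {F₁ F₂ F₃ : ℝ × ℝ → ℂ}
    (h₁ : AEStronglyMeasurable F₁ volume) (h₂ : AEStronglyMeasurable F₂ volume)
    (h₃ : AEStronglyMeasurable F₃ volume) :
    AEStronglyMeasurable (triFourier F₁ F₂ F₃) volume :=
  (aestronglyMeasurable_triIntegrand' h₁ h₂ h₃).integral_prod_right'

/-- The convolution of three functions on the modulation axis. -/
def conv3 (M₁ M₂ M₃ : ℝ → ℝ≥0∞) (s : ℝ) : ℝ≥0∞ := ∫⁻ b, ∫⁻ a, M₁ a * M₂ b * M₃ (s - a - b)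

lemma measurable_conv3 {M₁ M₂ M₃ : ℝ → ℝ≥0∞} (h₁ : Measurable M₁) (h₂ : Measurable M₂)
    (h₃ : Measurable M₃) : Measurable (conv3 M₁ M₂ M₃) := by
  have h : Measurable fun z : (ℝ × ℝ) × ℝ => M₁ z.2 * M₂ z.1.2 * M₃ (z.1.1 - z.2 - z.1.2) :=
    ((h₁.comp (by fun_prop)).mul (h₂.comp (by fun_prop))).mul (h₃.comp (by fun_prop))
  exact (h.lintegral_prod_right').lintegral_prod_right'

lemma lintegral_conv3 {M₁ M₂ M₃ : ℝ → ℝ≥0∞} (h₁ : Measurable M₁) (h₂ : Measurable M₂)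
    (h₃ : Measurable M₃) :
    ∫⁻ s, conv3 M₁ M₂ M₃ s = (∫⁻ s, M₁ s) * (∫⁻ s, M₂ s) * ∫⁻ s, M₃ s := by
  have h : Measurable fun z : (ℝ × ℝ) × ℝ => M₁ z.2 * M₂ z.1.2 * M₃ (z.1.1 - z.2 - z.1.2) :=
    ((h₁.comp (by fun_prop)).mul (h₂.comp (by fun_prop))).mul (h₃.comp (by fun_prop))
  simp only [conv3]
  rw [lintegral_lintegral_swap (f := fun s b => ∫⁻ a, M₁ a * M₂ b * M₃ (s - a - b))
    h.lintegral_prod_right'.aemeasurable]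
  have h4 : ∀ b, ∫⁻ s, ∫⁻ a, M₁ a * M₂ b * M₃ (s - a - b) =
      M₂ b * ((∫⁻ s, M₁ s) * ∫⁻ s, M₃ s) := by
    intro b
    rw [lintegral_lintegral_swap (f := fun s a => M₁ a * M₂ b * M₃ (s - a - b))
      (((h₁.comp (by fun_prop)).mul_const _).mul (h₃.comp (by fun_prop))).aemeasurable]
    have h5 : ∀ a, ∫⁻ s, M₁ a * M₂ b * M₃ (s - a - b) = M₁ a * (M₂ b * ∫⁻ s, M₃ s) := by
      intro a
      rw [lintegral_const_mul (f := fun s => M₃ (s - a - b)) (M₁ a * M₂ b)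
        (h₃.comp (by fun_prop : Measurable fun s => s - a - b)),
        ← lintegral_sub_right_eq_self M₃ (a + b), mul_assoc]
      simp only [sub_add_eq_sub_sub]
    simp_rw [h5]
    rw [lintegral_mul_const _ h₁]; ring
  simp_rw [h4]
  rw [lintegral_mul_const _ h₂]; ring

lemma lintegral_prod_prod_reorder {f : (ℝ × ℝ) × (ℝ × ℝ) → ℝ≥0∞} (hf : Measurable f) :
    ∫⁻ p, f p = ∫⁻ x, ∫⁻ y, ∫⁻ b, ∫⁻ a, f ((a, x), (b, y)) := by
  rw [Measure.volume_eq_prod, lintegral_prod _ hf.aemeasurable, Measure.volume_eq_prod,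
    lintegral_prod_symm' _ hf.lintegral_prod_right']
  refine lintegral_congr fun x => ?_
  rw [lintegral_lintegral_swap (f := fun a p₂ => f ((a, x), p₂))
    (hf.comp (by fun_prop)).aemeasurable]
  rw [lintegral_prod_symm' (fun p₂ => ∫⁻ a, f ((a, x), p₂))]
  exact Measurable.lintegral_prod_left' (f := fun z : ℝ × (ℝ × ℝ) => f ((z.1, x), z.2))
    (hf.comp (by fun_prop))

lemma triAbs_le {μ : ℝ} {F₁ F₂ F₃ : ℝ × ℝ → ℂ} {M₁ M₂ M₃ : ℝ → ℝ≥0∞}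
    (h₁ : IsMajorant μ F₁ M₁) (h₂ : IsMajorant μ F₂ M₂) (h₃ : IsMajorant μ F₃ M₃) (τ ξ : ℝ) :
    triAbs F₁ F₂ F₃ (τ, ξ) ≤ ∫⁻ x, ∫⁻ y, (jb x ^ (-μ) * jb y ^ (-μ) * jb (ξ - x - y) ^ (-μ)) *
      conv3 M₁ M₂ M₃ (τ - omega ξ + resonance ξ x y) := by
  have hm₁ := h₁.meas
  have hm₂ := h₂.meas
  have hm₃ := h₃.meas
  have e₁ := (Measure.quasiMeasurePreserving_fst (μ := (volume : Measure (ℝ × ℝ)))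
    (ν := (volume : Measure (ℝ × ℝ)))).ae h₁.le
  have e₂ := (Measure.quasiMeasurePreserving_snd (μ := (volume : Measure (ℝ × ℝ)))
    (ν := (volume : Measure (ℝ × ℝ)))).ae h₂.le
  have e₃ := (quasiMeasurePreserving_sub_sub (τ, ξ)).ae h₃.le
  set f : (ℝ × ℝ) × (ℝ × ℝ) → ℝ≥0∞ := fun p =>
    (jb p.1.2 ^ (-μ) * M₁ (p.1.1 - omega p.1.2)) * (jb p.2.2 ^ (-μ) * M₂ (p.2.1 - omega p.2.2)) *
      (jb (ξ - p.1.2 - p.2.2) ^ (-μ) * M₃ (τ - p.1.1 - p.2.1 - omega (ξ - p.1.2 - p.2.2))) with hf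
  have hfm : Measurable f := by
    refine Measurable.mul (Measurable.mul (Measurable.mul ?_ (hm₁.comp ?_))
      (Measurable.mul ?_ (hm₂.comp ?_))) (Measurable.mul ?_ (hm₃.comp ?_)) <;> fun_prop
  calc triAbs F₁ F₂ F₃ (τ, ξ) ≤ ∫⁻ p, f p := by
        refine lintegral_mono_ae ?_
        filter_upwards [e₁, e₂, e₃] with p hp₁ hp₂ hp₃
        rw [triIntegrand, enorm_mul, enorm_mul]
        exact mul_le_mul' (mul_le_mul' hp₁ hp₂) hp₃
    _ = _ := by
        rw [lintegral_prod_prod_reorder hfm]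
        refine lintegral_congr fun x => lintegral_congr fun y => ?_
        rw [resonance_eq, conv3]
        have hne : jb x ^ (-μ) * jb y ^ (-μ) * jb (ξ - x - y) ^ (-μ) ≠ ⊤ :=
          ENNReal.mul_ne_top (ENNReal.mul_ne_top (jb_rpow_ne_top _ _) (jb_rpow_ne_top _ _))
            (jb_rpow_ne_top _ _)
        rw [← lintegral_const_mul' _ _ hne, ← lintegral_add_right_eq_self _ (omega y)]
        refine lintegral_congr fun b => ?_
        rw [← lintegral_const_mul' _ _ hne, ← lintegral_add_right_eq_self _ (omega x)]
        refine lintegral_congr fun a => ?_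
        simp only [hf]
        rw [show τ - omega ξ + (omega ξ - omega x - omega y - omega (ξ - x - y)) - a - b =
          τ - (a + omega x) - (b + omega y) - omega (ξ - x - y) by ring, add_sub_cancel_right,
          add_sub_cancel_right]
        ring

/-- The trilinear estimate: the triple convolution of functions with majorants of finite norm has,
after multiplication by `|ξ|⟨ξ⟩^μ`, a majorant `N` in a weighted `L²` space of negative order. -/
theorem exists_trilinear {μ δ b β : ℝ} (hδ0 : 0 < δ) (hδμ : 3 * δ ≤ μ) (hδ : 2 * (3 * δ) ≤ 1)
    (hb : 1 / 2 < b) (hβ : 0 ≤ β) (hβδ : 1 < 2 * β + 2 * δ) :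
    ∃ C : ℝ≥0, ∀ (F₁ F₂ F₃ : ℝ × ℝ → ℂ) (M₁ M₂ M₃ : ℝ → ℝ≥0∞),
      IsMajorant μ F₁ M₁ → IsMajorant μ F₂ M₂ → IsMajorant μ F₃ M₃ →
      ∃ N : ℝ → ℝ≥0∞, Measurable N ∧
        (∀ τ ξ, ‖ξ‖ₑ * jb ξ ^ μ * triAbs F₁ F₂ F₃ (τ, ξ) ≤ N (τ - omega ξ)) ∧
        wnorm (-β) N ≤ C * (wnorm b M₁ * wnorm b M₂ * wnorm b M₃) := by
  obtain ⟨C₁, hC₁⟩ := exists_pushforward_le hδ0 hδμ (by linarith)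
  obtain ⟨C₂, hC₂⟩ := exists_eLpNorm_fractional_le hβ hδ0.le (by linarith) hβδ
  obtain ⟨C₃, hC₃⟩ := exists_lintegral_le_wnorm hb
  refine ⟨C₁ * C₂ * C₃ ^ 3, fun F₁ F₂ F₃ M₁ M₂ M₃ h₁ h₂ h₃ => ?_⟩
  have hn := measurable_conv3 h₁.meas h₂.meas h₃.meas
  set n := conv3 M₁ M₂ M₃ with hndef
  refine ⟨fun τ => C₁ * ∫⁻ s, n s * ‖s - τ‖ₑ ^ (-δ), ?_, fun τ ξ => ?_, ?_⟩
  · refine Measurable.const_mul (Measurable.lintegral_prod_right'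
      (f := fun z : ℝ × ℝ => n z.2 * ‖z.2 - z.1‖ₑ ^ (-δ)) ?_) _
    exact (hn.comp measurable_snd).mul (by fun_prop)
  · calc _ ≤ _ := mul_le_mul_right (triAbs_le h₁ h₂ h₃ τ ξ) _
      _ ≤ _ := hC₁ ξ (fun h => n (τ - omega ξ + h)) (hn.comp (by fun_prop))
      _ = _ := by
        rw [← lintegral_sub_right_eq_self _ (τ - omega ξ)]
        congr 2; ext s
        congr 2; ring
  · have h4 : wnorm (-β) (fun τ => C₁ * ∫⁻ s, n s * ‖s - τ‖ₑ ^ (-δ)) =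
        C₁ * eLpNorm (fun τ => jb τ ^ (-β) * ∫⁻ s, n s * ‖s - τ‖ₑ ^ (-δ)) 2 volume := by
      exact wnorm_const_mul ENNReal.coe_ne_top _
    rw [h4]
    calc _ ≤ C₁ * (C₂ * ∫⁻ s, n s) := mul_le_mul_right (hC₂ n hn.aemeasurable) _
      _ = C₁ * (C₂ * ((∫⁻ s, M₁ s) * (∫⁻ s, M₂ s) * ∫⁻ s, M₃ s)) := by
          rw [hndef, lintegral_conv3 h₁.meas h₂.meas h₃.meas]
      _ ≤ C₁ * (C₂ * ((C₃ * wnorm b M₁) * (C₃ * wnorm b M₂) * (C₃ * wnorm b M₃))) := by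
          gcongr
          exacts [hC₃ _ h₁.meas, hC₃ _ h₂.meas, hC₃ _ h₃.meas]
      _ = _ := by push_cast; ring

/-! ### The Duhamel operator with a time cutoff -/

lemma exists_enorm_schwartz_le (g : 𝓢(ℝ, ℂ)) : ∃ C : ℝ≥0, ∀ x, ‖g x‖ₑ ≤ C * jb x ^ (-2 : ℝ) := by
  obtain ⟨C₀, hC₀, h₀⟩ := g.decay 0 0
  obtain ⟨C₂, hC₂, h₂⟩ := g.decay 2 0
  refine ⟨(C₀ + C₂).toNNReal, fun x => ?_⟩
  have h1 : (1 + x ^ 2) * ‖g x‖ ≤ C₀ + C₂ := by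
    have h3 := h₀ x
    have h4 := h₂ x
    simp only [pow_zero, one_mul, norm_iteratedFDeriv_zero, Real.norm_eq_abs, sq_abs] at h3 h4
    linarith
  have h2 : jb x ^ (2 : ℝ) = ENNReal.ofReal (1 + x ^ 2) := by
    rw [← ofReal_japaneseBracket_rpow, japaneseBracket, Real.rpow_two,
      Real.sq_sqrt (by positivity)]
  calc ‖g x‖ₑ = jb x ^ (2 : ℝ) * ‖g x‖ₑ * jb x ^ (-2 : ℝ) := by
        rw [mul_right_comm, jb_rpow_mul_neg, one_mul]
    _ ≤ _ := by
        gcongr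
        rw [h2, ← ofReal_norm, ← ENNReal.ofReal_mul (by positivity)]
        exact ENNReal.ofReal_le_ofReal h1

/-- A smooth cutoff function in time, equal to `1` on `[-1, 1]`. -/
def cutoff : 𝓢(ℝ, ℂ) :=
  HasCompactSupport.toSchwartzMap
    (f := Complex.ofRealCLM ∘ (⟨1, 2, one_pos, one_lt_two⟩ : ContDiffBump (0 : ℝ)))
    ((ContDiffBump.hasCompactSupport _).comp_left rfl)
    (Complex.ofRealCLM.contDiff.comp (ContDiffBump.contDiff _))

lemma cutoff_eq_one {t : ℝ} (ht : |t| ≤ 1) : cutoff t = 1 := by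
  have : (⟨1, 2, one_pos, one_lt_two⟩ : ContDiffBump (0 : ℝ)) t = 1 :=
    ContDiffBump.one_of_mem_closedBall _ (by simpa using ht)
  simp [cutoff, this]

/-- The Fourier transform of the time cutoff. -/
def cutoffFT : 𝓢(ℝ, ℂ) := 𝓕 cutoff

lemma continuous_cexp2 : Continuous cexp2 := by unfold cexp2; fun_prop

lemma norm_cexp2 (x : ℝ) : ‖cexp2 x‖ = 1 := by
  rw [cexp2, show (2 * Real.pi * x * Complex.I : ℂ) = ((2 * Real.pi * x : ℝ) : ℂ) * Complex.I by
    push_cast; ring]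
  exact Complex.norm_exp_ofReal_mul_I _

lemma enorm_cexp2 (x : ℝ) : ‖cexp2 x‖ₑ = 1 := by rw [← ofReal_norm, norm_cexp2]; simp

lemma cexp2_add (x y : ℝ) : cexp2 (x + y) = cexp2 x * cexp2 y := by
  rw [cexp2, cexp2, cexp2, ← Complex.exp_add]; congr 1; push_cast; ring

lemma cexp2_zero : cexp2 0 = 1 := by simp [cexp2]

lemma conj_cexp2 (x : ℝ) : (starRingEnd ℂ) (cexp2 x) = cexp2 (-x) := by
  rw [cexp2, cexp2, ← Complex.exp_conj]; congr 1
  simp only [map_mul, Complex.conj_ofReal, Complex.conj_I, map_ofNat]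
  push_cast; ring

/-- Fourier inversion for the time cutoff, on the interval where it equals `1`. -/
lemma integral_cexp2_mul_cutoffFT {t : ℝ} (ht : |t| ≤ 1) :
    ∫ x, cexp2 (t * x) * cutoffFT x = 1 := by
  have h : (𝓕⁻ cutoffFT) t = cutoff t := by rw [cutoffFT]; simp
  rw [SchwartzMap.fourierInv_coe, Real.fourierInv_eq', cutoff_eq_one ht] at h
  rw [← h]
  refine integral_congr_ae (ae_of_all _ fun x => ?_)
  simp only [cexp2, smul_eq_mul, RCLike.inner_apply, conj_trivial]
  congr 2; push_cast; ring

lemma integrable_cutoffFT : Integrable cutoffFT := cutoffFT.integrable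

/-- A difference quotient of the Fourier transform of the cutoff. -/
lemma exists_enorm_cutoffFT_sub_le : ∃ C : ℝ≥0, ∀ a s : ℝ,
    ‖cutoffFT (a - s) - cutoffFT a‖ₑ ≤
      C * (‖s‖ₑ * jb s ^ (-1 : ℝ) * (jb (a - s) ^ (-2 : ℝ) + jb a ^ (-2 : ℝ))) := by
  obtain ⟨C₀, h₀⟩ := exists_enorm_schwartz_le cutoffFT
  obtain ⟨C₁, h₁⟩ := exists_enorm_schwartz_le (SchwartzMap.derivCLM ℂ ℂ cutoffFT)
  refine ⟨2 * C₀ + C₁ * 16 * 2, fun a s => ?_⟩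
  have hjb : ∀ r c : ℝ, 1 + |r| ≤ 2 * |c| → 1 ≤ 2 * (‖c‖ₑ * jb r ^ (-1 : ℝ)) := by
    intro r c h
    have : jb r ≤ 2 * ‖c‖ₑ := by
      rw [jb, Real.enorm_eq_ofReal_abs, show (2 : ℝ≥0∞) = ENNReal.ofReal 2 by simp,
        ← ENNReal.ofReal_mul (by norm_num)]
      exact ENNReal.ofReal_le_ofReal ((japaneseBracket_le r).trans h)
    calc (1 : ℝ≥0∞) = jb r ^ (1 : ℝ) * jb r ^ (-1 : ℝ) := (jb_rpow_mul_neg r 1).symm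
      _ ≤ (2 * ‖c‖ₑ) * jb r ^ (-1 : ℝ) := by rw [ENNReal.rpow_one]; gcongr
      _ = _ := by ring
  have h2 : ∀ y, |y| ≤ 1 → jb y ≤ 2 := fun y hy => by
    rw [jb, show (2 : ℝ≥0∞) = ENNReal.ofReal 2 by simp]
    exact ENNReal.ofReal_le_ofReal ((japaneseBracket_le y).trans (by linarith))
  rcases le_total 1 |s| with hs | hs
  · calc ‖cutoffFT (a - s) - cutoffFT a‖ₑ ≤ ‖cutoffFT (a - s)‖ₑ + ‖cutoffFT a‖ₑ := enorm_sub_le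
      _ ≤ 1 * (C₀ * jb (a - s) ^ (-2 : ℝ) + C₀ * jb a ^ (-2 : ℝ)) := by
          rw [one_mul]; exact add_le_add (h₀ _) (h₀ _)
      _ ≤ (2 * (‖s‖ₑ * jb s ^ (-1 : ℝ))) * (C₀ * jb (a - s) ^ (-2 : ℝ) + C₀ * jb a ^ (-2 : ℝ)) := by
          gcongr; exact hjb s s (by linarith)
      _ = (2 * C₀ : ℝ≥0) * (‖s‖ₑ * jb s ^ (-1 : ℝ) * (jb (a - s) ^ (-2 : ℝ) + jb a ^ (-2 : ℝ))) := by
          push_cast; ring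
      _ ≤ _ := by
          gcongr; exact le_self_add
  · have hder : ∀ y ∈ uIcc a (a - s), ‖deriv cutoffFT y‖ ≤ (C₁ * 16 * jb a ^ (-2 : ℝ)).toReal := by
      intro y hy
      have hy' : |a - y| ≤ 1 := by
        have := abs_sub_left_of_mem_uIcc hy
        rw [abs_sub_comm]
        refine this.trans ?_
        simpa using hs
      have e1 : ‖deriv cutoffFT y‖ₑ ≤ C₁ * 16 * jb a ^ (-2 : ℝ) := by
        have e2 := h₁ y
        rw [SchwartzMap.derivCLM_apply] at e2
        refine e2.trans ?_
        rw [mul_assoc]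
        gcongr
        have e3 : jb a ≤ 4 * jb y := by
          calc jb a ≤ 2 * (jb y * jb (a - y)) := jb_le_mul a y
            _ ≤ 2 * (jb y * 2) := by gcongr; exact h2 _ hy'
            _ = _ := by ring
        calc jb y ^ (-2 : ℝ) = 16 * (4 * jb y) ^ (-2 : ℝ) := by
              rw [ENNReal.mul_rpow_of_ne_top (by simp) (jb_ne_top _), ← mul_assoc]
              rw [show (16 : ℝ≥0∞) = 4 ^ (2 : ℝ) by norm_num, ← ENNReal.rpow_add _ _ (by simp)
                (by simp)]
              simp
          _ ≤ _ := by gcongr 16 * ?_; exact rpow_le_rpow_of_nonpos e3 (by norm_num)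
      rw [← ofReal_norm] at e1
      exact (ENNReal.ofReal_le_iff_le_toReal (ENNReal.mul_ne_top
        (ENNReal.mul_ne_top ENNReal.coe_ne_top (by simp)) (jb_rpow_ne_top _ _))).1 e1
    have hmv := (convex_uIcc a (a - s)).norm_image_sub_le_of_norm_deriv_le
      (fun y _ => cutoffFT.differentiableAt) hder left_mem_uIcc right_mem_uIcc
    have e4 : ‖cutoffFT (a - s) - cutoffFT a‖ₑ ≤ C₁ * 16 * jb a ^ (-2 : ℝ) * ‖s‖ₑ := by
      rw [← ofReal_norm, ← ofReal_norm]
      refine (ENNReal.ofReal_le_ofReal hmv).trans (le_of_eq ?_)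
      rw [ENNReal.ofReal_mul ENNReal.toReal_nonneg, ENNReal.ofReal_toReal (ENNReal.mul_ne_top
        (ENNReal.mul_ne_top ENNReal.coe_ne_top (by simp)) (jb_rpow_ne_top _ _))]
      congr 1
      rw [sub_sub_cancel_left, norm_neg]
    have e5 : 1 ≤ 2 * jb s ^ (-1 : ℝ) := by
      have := hjb s 1 (by rw [abs_one]; linarith)
      simpa using this
    calc _ ≤ _ := e4
      _ ≤ C₁ * 16 * jb a ^ (-2 : ℝ) * ‖s‖ₑ * (2 * jb s ^ (-1 : ℝ)) := le_mul_of_one_le_right' e5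
      _ = (C₁ * 16 * 2 : ℝ≥0) * (‖s‖ₑ * jb s ^ (-1 : ℝ) * jb a ^ (-2 : ℝ)) := by push_cast; ring
      _ ≤ _ := by
          gcongr
          · exact le_add_self
          · exact le_add_self

/-- The kernel, in the modulation variables, of the operator `n ↦ χ(t/T) ∫₀ᵗ n(s) ds`, where `χ` is
the time cutoff. -/
def duhamelExtKernel (T x' x : ℝ) : ℂ :=
  (T * cutoffFT (T * (x' - x)) - T * cutoffFT (T * x')) / (2 * Real.pi * x * Complex.I)

lemma measurable_duhamelExtKernel (T : ℝ) :
    Measurable fun z : ℝ × ℝ => duhamelExtKernel T z.1 z.2 := by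
  have h : Measurable cutoffFT := cutoffFT.continuous.measurable
  unfold duhamelExtKernel
  refine Measurable.div (Measurable.sub ((h.comp (by fun_prop)).const_mul _)
    ((h.comp (by fun_prop)).const_mul _)) ?_
  have : Measurable fun z : ℝ × ℝ => ((z.2 : ℝ) : ℂ) := Complex.measurable_ofReal.comp measurable_snd
  exact (this.const_mul _).mul_const _

lemma exists_enorm_duhamelExtKernel_le : ∃ C : ℝ≥0, ∀ T : ℝ, 0 < T → ∀ x' x : ℝ,
    ‖duhamelExtKernel T x' x‖ₑ ≤ C * (ENNReal.ofReal T ^ (2 : ℝ) * (jb (T * x) ^ (-1 : ℝ) *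
      (jb (T * (x' - x)) ^ (-2 : ℝ) + jb (T * x') ^ (-2 : ℝ)))) := by
  obtain ⟨C, hC⟩ := exists_enorm_cutoffFT_sub_le
  refine ⟨C, fun T hT x' x => ?_⟩
  rcases eq_or_ne x 0 with rfl | hx
  · simp [duhamelExtKernel]
  have h := hC (T * x') (T * x)
  rw [← mul_sub] at h
  have hx0 : ‖x‖ₑ ≠ 0 := by simpa using hx
  have hT' : ‖T‖ₑ = ENNReal.ofReal T := Real.enorm_of_nonneg hT.le
  have hxC : (2 * Real.pi * x * Complex.I : ℂ) ≠ 0 := by simp [hx, Real.pi_ne_zero]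
  have h2 : ‖duhamelExtKernel T x' x‖ₑ * ‖x‖ₑ ≤
      ENNReal.ofReal T * ‖cutoffFT (T * (x' - x)) - cutoffFT (T * x')‖ₑ := by
    have h3 : duhamelExtKernel T x' x * (2 * Real.pi * x * Complex.I) =
        T * (cutoffFT (T * (x' - x)) - cutoffFT (T * x')) := by
      rw [duhamelExtKernel, div_mul_cancel₀ _ hxC]; ring
    have h4 : ‖(T : ℂ)‖ₑ = ENNReal.ofReal T := by
      rw [← ofReal_norm, Complex.norm_real, Real.norm_of_nonneg hT.le]
    rw [← h4, ← enorm_mul, ← h3, enorm_mul]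
    gcongr
    rw [enorm_le_iff_norm_le]
    simp only [norm_mul, Complex.norm_real, Complex.norm_I, mul_one, Complex.norm_ofNat]
    rw [Real.norm_of_nonneg Real.pi_pos.le]
    refine le_mul_of_one_le_left (norm_nonneg _) ?_
    nlinarith [Real.pi_gt_three]
  rw [← ENNReal.mul_le_mul_iff_left hx0 enorm_ne_top]
  refine h2.trans ((mul_le_mul_right h _).trans (le_of_eq ?_))
  rw [enorm_mul, hT', ENNReal.rpow_two]
  ring

lemma lintegral_sq_jb_lt_top {p : ℝ} (hp : p < -1 / 2) :
    eLpNorm (fun x => jb x ^ p) 2 volume ≠ ⊤ := by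
  have h1 : (eLpNorm (fun x => jb x ^ p) 2 volume) ^ 2 ≠ ⊤ := by
    rw [eLpNorm_two_sq]
    have : ∀ x, (jb x ^ p) ^ 2 = jb x ^ (-(-(2 * p))) := fun x => by
      rw [sq, jb_rpow_mul_rpow]; congr 1; ring
    simp_rw [this]
    exact (lintegral_jb_rpow_lt_top (by linarith)).ne
  simpa using h1

lemma eLpNorm_comp_mul_left_sq (g : ℝ → ℝ≥0∞) {T : ℝ} (hT : 0 < T) :
    eLpNorm (fun x => g (T * x)) 2 volume ^ 2 =
      (ENNReal.ofReal T)⁻¹ * eLpNorm g 2 volume ^ 2 := by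
  rw [eLpNorm_two_sq, eLpNorm_two_sq, lintegral_comp_mul_left (fun x => g x ^ 2) hT.ne',
    Real.enorm_of_nonneg hT.le]

/-- The Duhamel operator with a cutoff at time scale `T` gains the power `T^{1-b-β}` and almost one
derivative in the modulation. -/
theorem exists_wnorm_duhamelExt_le {b β : ℝ} (hb0 : 0 ≤ b) (hb : b < 1) (hβ : β < 1 / 2)
    (hβ0 : 0 ≤ β) (hbβ : b + β ≤ 1) :
    ∃ C : ℝ≥0, ∀ T : ℝ, 0 < T → T ≤ 1 → ∀ N : ℝ → ℝ≥0∞, Measurable N →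
      wnorm b (fun x' => ∫⁻ x, ‖duhamelExtKernel T x' x‖ₑ * N x) ≤
        C * (ENNReal.ofReal T ^ (1 - b - β) * wnorm (-β) N) := by
  obtain ⟨C₀, hC₀⟩ := exists_enorm_duhamelExtKernel_le
  obtain ⟨A₁, hA₁⟩ := ENNReal.canLift.prf _
    (lintegral_jb_rpow_lt_top (p := 2 - b) (by linarith)).ne
  obtain ⟨A₂, hA₂⟩ := ENNReal.canLift.prf _ (lintegral_sq_jb_lt_top (p := b - 2) (by linarith))
  obtain ⟨A₃, hA₃⟩ := ENNReal.canLift.prf _ (lintegral_sq_jb_lt_top (p := β - 1) (by linarith))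
  obtain ⟨B, hB⟩ := ENNReal.canLift.prf _ (two_rpow_ne_top b)
  refine ⟨C₀ * (B * A₁ + A₂ * A₃), fun T hT hT1 N hN => ?_⟩
  set θ := ENNReal.ofReal T with hθ
  have hθ0 : θ ≠ 0 := by simpa [hθ] using hT
  have hθt : θ ≠ ⊤ := ENNReal.ofReal_ne_top
  set f : ℝ → ℝ≥0∞ := fun x => jb x ^ (-β) * N x with hf
  have hfm : Measurable f := by rw [hf]; fun_prop
  have hfn : eLpNorm f 2 volume = wnorm (-β) N := rfl
  have hscale : ∀ x p : ℝ, 0 ≤ p → jb x ^ p ≤ θ ^ (-p) * jb (T * x) ^ p := by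
    intro x p hp
    have h1 : θ * jb x ≤ jb (T * x) := by
      rw [hθ, jb, jb, ← ENNReal.ofReal_mul hT.le]
      refine ENNReal.ofReal_le_ofReal ?_
      rw [japaneseBracket, japaneseBracket]
      refine Real.le_sqrt_of_sq_le ?_
      rw [mul_pow, Real.sq_sqrt (by positivity)]
      nlinarith
    calc jb x ^ p = θ ^ (-p) * (θ * jb x) ^ p := by
          rw [ENNReal.mul_rpow_of_nonneg _ _ hp, ← mul_assoc, ← ENNReal.rpow_add _ _ hθ0 hθt]
          simp
      _ ≤ _ := by gcongr
  set G₁ : ℝ → ℝ≥0∞ := fun x' => ∫⁻ x, jb (T * (x' - x)) ^ (-(2 - b)) * f x with hG₁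
  set G₂ : ℝ → ℝ≥0∞ := fun x' => jb (T * x') ^ (b - 2) * ∫⁻ x, jb (T * x) ^ (β - 1) * f x with hG₂
  have hG₁m : Measurable G₁ := by
    refine Measurable.lintegral_prod_right'
      (f := fun z : ℝ × ℝ => jb (T * (z.1 - z.2)) ^ (-(2 - b)) * f z.2) ?_
    exact (by fun_prop : Measurable fun z : ℝ × ℝ => jb (T * (z.1 - z.2)) ^ (-(2 - b))).mul
      (hfm.comp measurable_snd)
  have hG₂m : Measurable G₂ := by rw [hG₂]; fun_prop
  have hpt : ∀ x', jb x' ^ b * (∫⁻ x, ‖duhamelExtKernel T x' x‖ₑ * N x) ≤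
      C₀ * θ ^ (2 - b - β) * (B * G₁ x' + G₂ x') := by
    intro x'
    have h1 : ∀ x, jb x' ^ b * (‖duhamelExtKernel T x' x‖ₑ * N x) ≤
        C₀ * θ ^ (2 - b - β) * (B * (jb (T * (x' - x)) ^ (-(2 - b)) * f x) +
          jb (T * x') ^ (b - 2) * (jb (T * x) ^ (β - 1) * f x)) := by
      intro x
      have hNf : N x = jb x ^ β * f x := by
        rw [hf]; simp only; rw [← mul_assoc, jb_rpow_mul_neg, one_mul]
      have e1 : jb (T * x') ^ b * jb (T * x) ^ (β - 1) * jb (T * (x' - x)) ^ (-2 : ℝ) ≤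
          B * jb (T * (x' - x)) ^ (-(2 - b)) := by
        have e2 := jb_rpow_le_mul hb0 (T * x') (T * x)
        rw [← mul_sub, ← hB] at e2
        calc _ ≤ (B * (jb (T * x) ^ b * jb (T * (x' - x)) ^ b)) * jb (T * x) ^ (β - 1) *
              jb (T * (x' - x)) ^ (-2 : ℝ) := by gcongr
          _ = B * (jb (T * x) ^ b * jb (T * x) ^ (β - 1)) *
              (jb (T * (x' - x)) ^ b * jb (T * (x' - x)) ^ (-2 : ℝ)) := by ring
          _ ≤ B * 1 * jb (T * (x' - x)) ^ (-(2 - b)) := by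
              rw [jb_rpow_mul_rpow, jb_rpow_mul_rpow, show b + -2 = -(2 - b) by ring]
              gcongr
              simpa using jb_rpow_mono (show b + (β - 1) ≤ 0 by linarith) (T * x)
          _ = _ := by rw [mul_one]
      calc jb x' ^ b * (‖duhamelExtKernel T x' x‖ₑ * N x)
          ≤ (θ ^ (-b) * jb (T * x') ^ b) * ((C₀ * (θ ^ (2 : ℝ) * (jb (T * x) ^ (-1 : ℝ) *
              (jb (T * (x' - x)) ^ (-2 : ℝ) + jb (T * x') ^ (-2 : ℝ))))) *
              ((θ ^ (-β) * jb (T * x) ^ β) * f x)) := by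
            rw [hNf]
            gcongr
            · exact hscale x' b hb0
            · exact hC₀ T hT x' x
            · exact hscale x β hβ0
        _ = C₀ * (θ ^ (-b) * θ ^ (2 : ℝ) * θ ^ (-β)) *
            ((jb (T * x') ^ b * (jb (T * x) ^ β * jb (T * x) ^ (-1 : ℝ)) *
              jb (T * (x' - x)) ^ (-2 : ℝ)) * f x +
            (jb (T * x') ^ b * jb (T * x') ^ (-2 : ℝ)) *
              ((jb (T * x) ^ β * jb (T * x) ^ (-1 : ℝ)) * f x)) := by ring
        _ ≤ _ := by
            rw [← ENNReal.rpow_add _ _ hθ0 hθt, ← ENNReal.rpow_add _ _ hθ0 hθt,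
              jb_rpow_mul_rpow, jb_rpow_mul_rpow, show -b + 2 + -β = 2 - b - β by ring,
              show β + -1 = β - 1 by ring, show b + -2 = b - 2 by ring]
            refine mul_le_mul_right (add_le_add ?_ le_rfl) _
            exact (mul_le_mul_left e1 (f x)).trans (le_of_eq (mul_assoc _ _ _))
    rw [← lintegral_const_mul' _ _ (jb_rpow_ne_top _ _)]
    refine (lintegral_mono h1).trans (le_of_eq ?_)
    have hm : Measurable fun x => jb (T * (x' - x)) ^ (-(2 - b)) * f x := by fun_prop
    rw [lintegral_const_mul _ (by fun_prop), lintegral_add_left (by fun_prop),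
      lintegral_const_mul _ (by fun_prop), lintegral_const_mul _ (by fun_prop)]
  have hn₁ : eLpNorm G₁ 2 volume ≤ θ⁻¹ * A₁ * wnorm (-β) N := by
    refine (eLpNorm_convolution_le (κ := fun x => jb (T * x) ^ (-(2 - b))) (by fun_prop)
      hfm.aemeasurable).trans (le_of_eq ?_)
    rw [lintegral_comp_mul_left (fun x => jb x ^ (-(2 - b))) hT.ne', Real.enorm_of_nonneg hT.le,
      hA₁, hfn]
  have hn₂ : eLpNorm G₂ 2 volume ≤ θ⁻¹ * (A₂ * A₃) * wnorm (-β) N := by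
    set I := ∫⁻ x, jb (T * x) ^ (β - 1) * f x with hI
    have hI' : I ≤ eLpNorm (fun x => jb (T * x) ^ (β - 1)) 2 volume * wnorm (-β) N :=
      lintegral_mul_le_eLpNorm (by fun_prop) hfm.aemeasurable
    refine eLpNorm_two_le ?_
    calc ∫⁻ x', G₂ x' ^ 2 = eLpNorm (fun x => jb (T * x) ^ (b - 2)) 2 volume ^ 2 * I ^ 2 := by
          rw [eLpNorm_two_sq, ← lintegral_mul_const _ (by fun_prop)]
          refine lintegral_congr fun x' => ?_
          simp only [hG₂]; rw [mul_pow]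
      _ ≤ eLpNorm (fun x => jb (T * x) ^ (b - 2)) 2 volume ^ 2 *
          (eLpNorm (fun x => jb (T * x) ^ (β - 1)) 2 volume * wnorm (-β) N) ^ 2 := by gcongr
      _ = _ := by
          rw [mul_pow, eLpNorm_comp_mul_left_sq (fun x => jb x ^ (b - 2)) hT,
            eLpNorm_comp_mul_left_sq (fun x => jb x ^ (β - 1)) hT, hA₂, hA₃]
          ring
  calc wnorm b (fun x' => ∫⁻ x, ‖duhamelExtKernel T x' x‖ₑ * N x)
      ≤ eLpNorm (fun x' => C₀ * θ ^ (2 - b - β) * (B * G₁ x' + G₂ x')) 2 volume :=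
        eLpNorm_mono_enorm fun x' => by simpa only [enorm_eq_self] using hpt x'
    _ = C₀ * θ ^ (2 - b - β) * eLpNorm ((fun x' => B * G₁ x') + G₂) 2 volume := by
        have := wnorm_const_mul (b := 0) (c := C₀ * θ ^ (2 - b - β))
          (ENNReal.mul_ne_top ENNReal.coe_ne_top (by simp [ENNReal.rpow_eq_top_iff, hθ0, hθt]))
          (fun x' => B * G₁ x' + G₂ x')
        simp only [wnorm, ENNReal.rpow_zero, one_mul] at this
        exact this
    _ ≤ C₀ * θ ^ (2 - b - β) * (eLpNorm (fun x' => B * G₁ x') 2 volume + eLpNorm G₂ 2 volume) := by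
        gcongr
        exact eLpNorm_add_le (hG₁m.const_mul _).aestronglyMeasurable hG₂m.aestronglyMeasurable
          (by norm_num)
    _ ≤ C₀ * θ ^ (2 - b - β) * (B * (θ⁻¹ * A₁ * wnorm (-β) N) +
          θ⁻¹ * (A₂ * A₃) * wnorm (-β) N) := by
        gcongr
        have := wnorm_const_mul (b := 0) (c := B) ENNReal.coe_ne_top G₁
        simp only [wnorm, ENNReal.rpow_zero, one_mul] at this
        rw [this]
        gcongr
    _ = C₀ * (B * A₁ + A₂ * A₃) * ((θ ^ (2 - b - β) * θ⁻¹) * wnorm (-β) N) := by ring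
    _ = _ := by
        rw [← ENNReal.rpow_neg_one, ← ENNReal.rpow_add _ _ hθ0 hθt,
          show 2 - b - β + -1 = 1 - b - β by ring]
        push_cast
        rfl

/-! ### The Duhamel term and its extension to all times -/

lemma IsMajorant.slice {μ : ℝ} {F : ℝ × ℝ → ℂ} {M : ℝ → ℝ≥0∞} (h : IsMajorant μ F M) :
    ∀ᵐ ξ : ℝ, AEStronglyMeasurable (fun τ => F (τ, ξ)) volume ∧
      ∀ᵐ τ : ℝ, ‖F (τ, ξ)‖ₑ ≤ jb ξ ^ (-μ) * M (τ - omega ξ) := by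
  have hsw : MeasurePreserving (Prod.swap : ℝ × ℝ → ℝ × ℝ) (volume.prod volume)
    (volume.prod volume) := Measure.measurePreserving_swap
  have h1 : AEStronglyMeasurable (fun q : ℝ × ℝ => F q.swap) (volume.prod volume) :=
    h.aesm.comp_measurePreserving hsw
  have h2 := Measure.ae_ae_of_ae_prod (hsw.quasiMeasurePreserving.ae h.le)
  filter_upwards [h1.prodMk_left, h2] with ξ h3 h4
  exact ⟨h3, h4⟩

lemma IsMajorant.congr {μ : ℝ} {F G : ℝ × ℝ → ℂ} {M : ℝ → ℝ≥0∞} (h : IsMajorant μ F M)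
    (hFG : G =ᵐ[volume] F) : IsMajorant μ G M :=
  ⟨h.aesm.congr hFG.symm, h.meas, by filter_upwards [h.le, hFG] with q h1 h2; rwa [h2]⟩

lemma IsMajorant.add {μ : ℝ} {F G : ℝ × ℝ → ℂ} {M N : ℝ → ℝ≥0∞} (hF : IsMajorant μ F M)
    (hG : IsMajorant μ G N) : IsMajorant μ (fun q => F q + G q) (fun τ => M τ + N τ) :=
  ⟨hF.aesm.add hG.aesm, hF.meas.add hG.meas, by
    filter_upwards [hF.le, hG.le] with q h1 h2
    rw [mul_add]
    exact (enorm_add_le _ _).trans (add_le_add h1 h2)⟩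

lemma IsMajorant.const_mul {μ : ℝ} {F : ℝ × ℝ → ℂ} {M : ℝ → ℝ≥0∞} (hF : IsMajorant μ F M)
    {c : ℂ} (hc : ‖c‖ₑ ≤ 1) : IsMajorant μ (fun q => c * F q) M :=
  ⟨hF.aesm.const_mul _, hF.meas, by
    filter_upwards [hF.le] with q h1
    rw [enorm_mul]
    exact (mul_le_of_le_one_left (zero_le) hc).trans h1⟩

lemma IsMajorant.sub {μ : ℝ} {F G : ℝ × ℝ → ℂ} {M N : ℝ → ℝ≥0∞} (hF : IsMajorant μ F M)
    (hG : IsMajorant μ G N) : IsMajorant μ (fun q => F q - G q) (fun τ => M τ + N τ) :=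
  ⟨hF.aesm.sub hG.aesm, hF.meas.add hG.meas, by
    filter_upwards [hF.le, hG.le] with q h1 h2
    rw [mul_add]
    exact enorm_sub_le.trans (add_le_add h1 h2)⟩

lemma wnorm_add_le {b : ℝ} {M N : ℝ → ℝ≥0∞} (hM : Measurable M) (hN : Measurable N) :
    wnorm b (fun τ => M τ + N τ) ≤ wnorm b M + wnorm b N := by
  simp only [wnorm, mul_add]
  exact eLpNorm_add_le (f := fun τ => jb τ ^ b * M τ) (g := fun τ => jb τ ^ b * N τ)
    (by fun_prop : Measurable fun τ => jb τ ^ b * M τ).aestronglyMeasurable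
    (by fun_prop : Measurable fun τ => jb τ ^ b * N τ).aestronglyMeasurable (by norm_num)

/-- The profile of the Duhamel kernel. -/
lemma duhamelKernel_eq (t τ ξ : ℝ) :
    duhamelKernel t τ ξ = cexp2 (t * omega ξ) * ∫ s in (0 : ℝ)..t, cexp2 (s * (τ - omega ξ)) := by
  rw [duhamelKernel, ← intervalIntegral.integral_const_mul]
  refine intervalIntegral.integral_congr fun s _ => ?_
  simp only [← cexp2_add]
  congr 1; ring

lemma integral_cexp2_mul {x : ℝ} (hx : x ≠ 0) (t : ℝ) :
    ∫ s in (0 : ℝ)..t, cexp2 (s * x) = (cexp2 (t * x) - 1) / (2 * Real.pi * x * Complex.I) := by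
  have hc : (2 * Real.pi * x * Complex.I : ℂ) ≠ 0 := by simp [hx, Real.pi_ne_zero]
  have h := integral_exp_mul_complex (a := 0) (b := t) hc
  rw [← sub_eq_zero] at h ⊢
  rw [← h]
  congr 1
  · refine intervalIntegral.integral_congr fun s _ => ?_
    simp only [cexp2]; congr 1; push_cast; ring
  · simp only [cexp2, Complex.ofReal_zero, mul_zero, Complex.exp_zero]
    congr 3; push_cast; ring

lemma exists_enorm_duhamelKernel_le (t : ℝ) : ∃ C : ℝ≥0, ∀ τ ξ : ℝ,
    ‖duhamelKernel t τ ξ‖ₑ ≤ C * jb (τ - omega ξ) ^ (-1 : ℝ) := by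
  refine ⟨(2 * (|t| + 1)).toNNReal, fun τ ξ => ?_⟩
  set x := τ - omega ξ with hx
  have h1 : ‖duhamelKernel t τ ξ‖ * (1 + |x|) ≤ 2 * (|t| + 1) := by
    rw [duhamelKernel_eq, norm_mul, norm_cexp2, one_mul, ← hx]
    have h2 : ‖∫ s in (0 : ℝ)..t, cexp2 (s * x)‖ ≤ |t| := by
      have := intervalIntegral.norm_integral_le_of_norm_le_const (a := 0) (b := t)
        (f := fun s => cexp2 (s * x)) (C := 1) (fun s _ => (norm_cexp2 _).le)
      simpa using this
    have h3 : ‖∫ s in (0 : ℝ)..t, cexp2 (s * x)‖ * |x| ≤ 1 := by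
      rcases eq_or_ne x 0 with h0 | h0
      · simp [h0]
      · rw [integral_cexp2_mul h0, norm_div]
        have h4 : ‖(2 * Real.pi * x * Complex.I : ℂ)‖ = 2 * Real.pi * |x| := by
          simp [abs_of_pos Real.pi_pos]
        have h5 : ‖cexp2 (t * x) - 1‖ ≤ 2 := by
          refine (norm_sub_le _ _).trans ?_
          rw [norm_cexp2]; norm_num
        have h6 : 0 < |x| := abs_pos.2 h0
        rw [h4, div_mul_eq_mul_div, div_le_one (by positivity)]
        nlinarith [Real.pi_gt_three]
    nlinarith [norm_nonneg (∫ s in (0 : ℝ)..t, cexp2 (s * x)), abs_nonneg t]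
  have h2 : jb x ^ (1 : ℝ) ≤ ENNReal.ofReal (1 + |x|) := by
    rw [ENNReal.rpow_one]; exact ENNReal.ofReal_le_ofReal (japaneseBracket_le x)
  calc ‖duhamelKernel t τ ξ‖ₑ = ‖duhamelKernel t τ ξ‖ₑ * (jb x ^ (1 : ℝ)) * jb x ^ (-1 : ℝ) := by
        rw [mul_assoc, jb_rpow_mul_neg, mul_one]
    _ ≤ (‖duhamelKernel t τ ξ‖ₑ * ENNReal.ofReal (1 + |x|)) * jb x ^ (-1 : ℝ) := by gcongr
    _ ≤ _ := by
        gcongr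
        rw [← ofReal_norm, ← ENNReal.ofReal_mul (norm_nonneg _)]
        exact ENNReal.ofReal_le_ofReal h1

lemma continuous_duhamelKernel (t : ℝ) : Continuous fun q : ℝ × ℝ => duhamelKernel t q.1 q.2 := by
  unfold duhamelKernel
  have := continuous_cexp2
  have := continuous_omega
  exact intervalIntegral.continuous_parametric_intervalIntegral_of_continuous'
    (by fun_prop) _ _

/-- The Duhamel kernel is square integrable against functions of negative order above `-1/2`. -/
lemma lintegral_duhamelKernel_mul_lt_top {β : ℝ} (hβ : β < 1 / 2) {N : ℝ → ℝ≥0∞}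
    (hN : Measurable N) (hfin : wnorm (-β) N < ⊤) (t ξ : ℝ) :
    ∫⁻ τ, ‖duhamelKernel t τ ξ‖ₑ * N (τ - omega ξ) < ⊤ := by
  obtain ⟨C, hC⟩ := exists_enorm_duhamelKernel_le t
  calc ∫⁻ τ, ‖duhamelKernel t τ ξ‖ₑ * N (τ - omega ξ)
      ≤ ∫⁻ τ, C * jb (τ - omega ξ) ^ (-1 : ℝ) * N (τ - omega ξ) := by
        gcongr with τ; exact hC τ ξ
    _ = ∫⁻ x, C * jb x ^ (-1 : ℝ) * N x :=
        lintegral_sub_right_eq_self (fun x => C * jb x ^ (-1 : ℝ) * N x) _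
    _ = C * ∫⁻ x, jb x ^ (β - 1) * (jb x ^ (-β) * N x) := by
        rw [← lintegral_const_mul _ (by fun_prop)]
        refine lintegral_congr fun x => ?_
        rw [← mul_assoc (jb x ^ (β - 1)), jb_rpow_mul_rpow, mul_assoc]
        congr 3; ring
    _ ≤ C * (eLpNorm (fun x => jb x ^ (β - 1)) 2 volume * wnorm (-β) N) := by
        gcongr
        exact lintegral_mul_le_eLpNorm (by fun_prop) (by fun_prop)
    _ < ⊤ := ENNReal.mul_lt_top ENNReal.coe_lt_top
        (ENNReal.mul_lt_top (lintegral_sq_jb_lt_top (by linarith)).lt_top hfin)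

/-- The Duhamel integral of the forcing term with space-time Fourier transform `G`. -/
def duhamelInt (G : ℝ × ℝ → ℂ) (t ξ : ℝ) : ℂ := ∫ τ : ℝ, duhamelKernel t τ ξ * G (τ, ξ)

lemma ae_integrable_duhamelKernel_mul {μ β : ℝ} (hβ : β < 1 / 2) {G : ℝ × ℝ → ℂ}
    {N : ℝ → ℝ≥0∞} (hG : IsMajorant μ G N) (hN : wnorm (-β) N < ⊤) :
    ∀ᵐ ξ : ℝ, ∀ t, Integrable (fun τ => duhamelKernel t τ ξ * G (τ, ξ)) volume := by
  filter_upwards [hG.slice] with ξ ⟨h1, h2⟩ t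
  refine ⟨(((continuous_duhamelKernel t).comp (Continuous.prodMk_left
    ξ)).aestronglyMeasurable).mul h1, ?_⟩
  rw [hasFiniteIntegral_iff_enorm]
  calc ∫⁻ τ, ‖duhamelKernel t τ ξ * G (τ, ξ)‖ₑ
      ≤ ∫⁻ τ, jb ξ ^ (-μ) * (‖duhamelKernel t τ ξ‖ₑ * N (τ - omega ξ)) := by
        refine lintegral_mono_ae ?_
        filter_upwards [h2] with τ h3
        rw [enorm_mul, mul_left_comm]
        gcongr
    _ = jb ξ ^ (-μ) * ∫⁻ τ, ‖duhamelKernel t τ ξ‖ₑ * N (τ - omega ξ) :=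
        lintegral_const_mul' _ _ (jb_rpow_ne_top _ _)
    _ < ⊤ := ENNReal.mul_lt_top (jb_rpow_ne_top _ _).lt_top
        (lintegral_duhamelKernel_mul_lt_top hβ hG.meas hN t ξ)

/-- An extension to all times of the Duhamel integral of `G` on `[-T, T]`. -/
def duhamelExt (T : ℝ) (G : ℝ × ℝ → ℂ) (q : ℝ × ℝ) : ℂ :=
  ∫ x, duhamelExtKernel T (q.1 - omega q.2) (x - omega q.2) * G (x, q.2)

lemma IsMajorant.duhamelExt {μ : ℝ} {G : ℝ × ℝ → ℂ} {N : ℝ → ℝ≥0∞} (hG : IsMajorant μ G N)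
    (T : ℝ) : IsMajorant μ (duhamelExt T G)
      (fun x' => ∫⁻ x, ‖duhamelExtKernel T x' x‖ₑ * N x) := by
  have hK : Measurable fun z : ℝ × ℝ => duhamelExtKernel T z.1 z.2 := measurable_duhamelExtKernel T
  have ho := measurable_omega
  refine ⟨?_, ?_, ?_⟩
  · refine AEStronglyMeasurable.integral_prod_right' (f := fun z : (ℝ × ℝ) × ℝ =>
      duhamelExtKernel T (z.1.1 - omega z.1.2) (z.2 - omega z.1.2) * G (z.2, z.1.2)) ?_
    refine AEStronglyMeasurable.mul ?_ ?_
    · exact (hK.comp (by fun_prop : Measurable fun z : (ℝ × ℝ) × ℝ =>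
        (z.1.1 - omega z.1.2, z.2 - omega z.1.2))).aestronglyMeasurable
    · have hq : Measure.QuasiMeasurePreserving (fun z : (ℝ × ℝ) × ℝ => (z.2, z.1.2))
          ((volume.prod volume).prod volume) (volume.prod volume) := by
        have h1 : Measure.QuasiMeasurePreserving (Prod.map Prod.snd id : (ℝ × ℝ) × ℝ → ℝ × ℝ)
            ((volume.prod volume).prod volume) (volume.prod volume) :=
          QuasiMeasurePreserving.prodMap Measure.quasiMeasurePreserving_snd (Measure.QuasiMeasurePreserving.id _)
        exact (Measure.measurePreserving_swap.quasiMeasurePreserving).comp h1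
      exact hG.aesm.comp_quasiMeasurePreserving hq
  · have hN := hG.meas
    exact Measurable.lintegral_prod_right' (f := fun z : ℝ × ℝ =>
      ‖duhamelExtKernel T z.1 z.2‖ₑ * N z.2) (by fun_prop)
  · have h2 : ∀ᵐ q : ℝ × ℝ, ∀ᵐ τ : ℝ, ‖G (τ, q.2)‖ₑ ≤ jb q.2 ^ (-μ) * N (τ - omega q.2) :=
      Measure.quasiMeasurePreserving_snd.ae (hG.slice.mono fun ξ h => h.2)
    filter_upwards [h2] with q hq
    calc ‖MKdV.duhamelExt T G q‖ₑ
        ≤ ∫⁻ x, ‖duhamelExtKernel T (q.1 - omega q.2) (x - omega q.2) * G (x, q.2)‖ₑ :=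
          enorm_integral_le_lintegral_enorm _
      _ ≤ ∫⁻ x, jb q.2 ^ (-μ) * (‖duhamelExtKernel T (q.1 - omega q.2) (x - omega q.2)‖ₑ *
            N (x - omega q.2)) := by
          refine lintegral_mono_ae ?_
          filter_upwards [hq] with x hx
          rw [enorm_mul, mul_left_comm]
          gcongr
      _ = _ := by
          rw [lintegral_const_mul' _ _ (jb_rpow_ne_top _ _), lintegral_sub_right_eq_self
            (fun x => ‖duhamelExtKernel T (q.1 - omega q.2) x‖ₑ * N x)]

lemma integral_cexp2_mul_scaled_cutoffFT {T t : ℝ} (hT : 0 < T) (ht : |t| ≤ T) (a : ℝ) :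
    ∫ x, cexp2 (t * x) * (T * cutoffFT (T * (x - a))) = cexp2 (t * a) := by
  have h1 : ∀ x, cexp2 (t * x) * (T * cutoffFT (T * (x - a))) =
      (fun y => cexp2 (t * a) * (T * (fun z => cexp2 (t / T * z) * cutoffFT z) (T * y))) (x - a) := by
    intro x
    have : cexp2 (t * x) = cexp2 (t * a) * cexp2 (t / T * (T * (x - a))) := by
      rw [← cexp2_add]; congr 1; field_simp; ring
    simp only [this]; ring
  simp_rw [h1]
  rw [integral_sub_right_eq_self (fun y => cexp2 (t * a) *
    (T * (fun z => cexp2 (t / T * z) * cutoffFT z) (T * y))) a, integral_const_mul,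
    integral_const_mul,
    Measure.integral_comp_mul_left (fun z => cexp2 (t / T * z) * cutoffFT z), integral_cexp2_mul_cutoffFT,
    abs_of_pos (inv_pos.2 hT)]
  · simp [hT.ne']
  · rw [abs_div, abs_of_pos hT, div_le_one hT]; exact ht

lemma integrable_cexp2_mul_scaled_cutoffFT {T : ℝ} (hT : 0 < T) (t a : ℝ) :
    Integrable (fun x => cexp2 (t * x) * (T * cutoffFT (T * (x - a)))) volume := by
  have h := continuous_cexp2
  refine Integrable.bdd_mul (c := 1) ?_ (by fun_prop) (ae_of_all _ fun x => (norm_cexp2 _).le)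
  exact (((integrable_cutoffFT.comp_mul_left' hT.ne').comp_sub_right a).const_mul (T : ℂ))

/-- For `|t| ≤ T` the cutoff is invisible. -/
lemma integral_cexp2_mul_duhamelExtKernel {T t : ℝ} (hT : 0 < T) (ht : |t| ≤ T) {τ ξ : ℝ}
    (h0 : τ - omega ξ ≠ 0) :
    ∫ x, cexp2 (t * x) * duhamelExtKernel T (x - omega ξ) (τ - omega ξ) =
      duhamelKernel t τ ξ := by
  have h1 : ∀ x, cexp2 (t * x) * duhamelExtKernel T (x - omega ξ) (τ - omega ξ) =
      (cexp2 (t * x) * (T * cutoffFT (T * (x - τ))) -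
        cexp2 (t * x) * (T * cutoffFT (T * (x - omega ξ)))) *
        (2 * Real.pi * ((τ - omega ξ : ℝ) : ℂ) * Complex.I)⁻¹ := by
    intro x
    rw [duhamelExtKernel, sub_sub_sub_cancel_right]
    ring
  simp_rw [h1]
  rw [integral_mul_const, integral_sub (integrable_cexp2_mul_scaled_cutoffFT hT _ _)
    (integrable_cexp2_mul_scaled_cutoffFT hT _ _), integral_cexp2_mul_scaled_cutoffFT hT ht,
    integral_cexp2_mul_scaled_cutoffFT hT ht, duhamelKernel_eq, integral_cexp2_mul h0,
    mul_div_assoc', mul_sub, ← cexp2_add, mul_one, div_eq_mul_inv]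
  congr 3
  ring_nf

/-- On `[-T, T]` the extension agrees with the Duhamel integral. -/
theorem timeSlice_duhamelExt {μ b β : ℝ} (hb : 1 / 2 < b) (hb1 : b < 1) (hβ0 : 0 ≤ β)
    (hβ : β < 1 / 2) (hbβ : b + β ≤ 1) {G : ℝ × ℝ → ℂ} {N : ℝ → ℝ≥0∞} (hG : IsMajorant μ G N)
    (hN : wnorm (-β) N < ⊤) {T : ℝ} (hT : 0 < T) (hT1 : T ≤ 1) :
    ∀ᵐ ξ : ℝ, ∀ t, |t| ≤ T → timeSlice (duhamelExt T G) t ξ = duhamelInt G t ξ := by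
  have hK : Measurable fun z : ℝ × ℝ => duhamelExtKernel T z.1 z.2 := measurable_duhamelExtKernel T
  have hNm := hG.meas
  obtain ⟨C, hC⟩ := exists_wnorm_duhamelExt_le (by linarith) hb1 hβ hβ0 hbβ
  obtain ⟨C', hC'⟩ := exists_lintegral_le_wnorm hb
  have hfin : ∫⁻ x', ∫⁻ x, ‖duhamelExtKernel T x' x‖ₑ * N x < ⊤ := by
    refine (hC' _ (hG.duhamelExt T).meas).trans_lt
      (ENNReal.mul_lt_top ENNReal.coe_lt_top ((hC T hT hT1 N hNm).trans_lt ?_))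
    exact ENNReal.mul_lt_top ENNReal.coe_lt_top (ENNReal.mul_lt_top
      (ENNReal.rpow_lt_top_of_nonneg (by linarith) ENNReal.ofReal_ne_top) hN)
  filter_upwards [hG.slice] with ξ ⟨h1, h2⟩ t ht
  have hint : Integrable (Function.uncurry fun τ x : ℝ => cexp2 (t * τ) *
      (duhamelExtKernel T (τ - omega ξ) (x - omega ξ) * G (x, ξ))) (volume.prod volume) := by
    have hc := continuous_cexp2
    have hm : AEStronglyMeasurable (Function.uncurry fun τ x : ℝ => cexp2 (t * τ) *
        (duhamelExtKernel T (τ - omega ξ) (x - omega ξ) * G (x, ξ))) (volume.prod volume) := by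
      refine AEStronglyMeasurable.mul (by fun_prop) (AEStronglyMeasurable.mul ?_ ?_)
      · exact (hK.comp (by fun_prop : Measurable fun z : ℝ × ℝ =>
          (z.1 - omega ξ, z.2 - omega ξ))).aestronglyMeasurable
      · exact h1.comp_quasiMeasurePreserving Measure.quasiMeasurePreserving_snd
    refine ⟨hm, ?_⟩
    rw [hasFiniteIntegral_iff_enorm, lintegral_prod _ hm.enorm]
    calc _ ≤ ∫⁻ τ, ∫⁻ x, jb ξ ^ (-μ) * (‖duhamelExtKernel T (τ - omega ξ) (x - omega ξ)‖ₑ *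
            N (x - omega ξ)) := by
          refine lintegral_mono fun τ => lintegral_mono_ae ?_
          filter_upwards [h2] with x hx
          simp only [Function.uncurry, enorm_mul, enorm_cexp2, one_mul]
          rw [mul_left_comm]
          gcongr
      _ = jb ξ ^ (-μ) * ∫⁻ x', ∫⁻ x, ‖duhamelExtKernel T x' x‖ₑ * N x := by
          rw [← lintegral_sub_right_eq_self (fun x' => ∫⁻ x, ‖duhamelExtKernel T x' x‖ₑ * N x)
            (omega ξ), ← lintegral_const_mul' _ _ (jb_rpow_ne_top _ _)]
          refine lintegral_congr fun τ => ?_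
          rw [lintegral_const_mul' _ _ (jb_rpow_ne_top _ _), lintegral_sub_right_eq_self
            (fun x => ‖duhamelExtKernel T (τ - omega ξ) x‖ₑ * N x)]
      _ < ⊤ := ENNReal.mul_lt_top (jb_rpow_ne_top _ _).lt_top hfin
  calc timeSlice (duhamelExt T G) t ξ
      = ∫ τ, ∫ x, cexp2 (t * τ) *
          (duhamelExtKernel T (τ - omega ξ) (x - omega ξ) * G (x, ξ)) := by
        simp_rw [integral_const_mul]; rfl
    _ = ∫ x, ∫ τ, cexp2 (t * τ) *
          (duhamelExtKernel T (τ - omega ξ) (x - omega ξ) * G (x, ξ)) := integral_integral_swap hint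
    _ = duhamelInt G t ξ := by
        refine integral_congr_ae ?_
        filter_upwards [compl_mem_ae_iff.2 (measure_singleton (omega ξ))] with x hx
        rw [← integral_cexp2_mul_duhamelExtKernel hT ht (sub_ne_zero.2 hx), ← integral_mul_const]
        refine integral_congr_ae (ae_of_all _ fun τ => ?_)
        simp only []; ring

/-! ### The nonlinear term -/

/-- Exponents `b = 1/2+`, `β = 1/2-` for which the trilinear estimate and the Duhamel estimate
hold together, with a power of the length of the time interval to spare. -/
structure Admissible (μ δ b β : ℝ) : Prop where
  δ_pos : 0 < δ
  δ_le : 3 * δ ≤ μ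
  δ_le_half : 2 * (3 * δ) ≤ 1
  half_lt : 1 / 2 < b
  lt_one : b < 1
  nonneg : 0 ≤ β
  lt_half : β < 1 / 2
  add_lt : b + β < 1
  lt_add : 1 < 2 * β + 2 * δ

lemma exists_admissible {μ : ℝ} (hμ : 0 < μ) : ∃ δ b β, Admissible μ δ b β := by
  have h1 : 0 < min μ (1 / 2) := lt_min hμ (by norm_num)
  have h2 := min_le_left μ (1 / 2)
  have h3 := min_le_right μ (1 / 2)
  set ν := min μ (1 / 2)
  exact ⟨ν / 3, 1 / 2 + ν / 12, 1 / 2 - ν / 6, by constructor <;> linarith⟩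

/-- `F` is the space-time Fourier transform of an element of the Bourgain space. -/
structure InX (μ b : ℝ) (F : ℝ × ℝ → ℂ) : Prop where
  aesm : AEStronglyMeasurable F volume
  lt_top : bourgainNorm μ b F < ⊤

section

variable {μ δ b β : ℝ} {F G A B W : ℝ × ℝ → ℂ}

lemma IsMajorant.inX {M : ℝ → ℝ≥0∞} (h : IsMajorant μ F M) (hM : wnorm b M < ⊤) : InX μ b F :=
  ⟨h.aesm, (bourgainNorm_le_wnorm h).trans_lt hM⟩

lemma InX.exists_isMajorant (h : InX μ b F) :
    ∃ M, IsMajorant μ F M ∧ wnorm b M = bourgainNorm μ b F ∧ wnorm b M < ⊤ := by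
  obtain ⟨M, hM, hn⟩ := MKdV.exists_isMajorant h.aesm μ
  exact ⟨M, hM, hn b, (hn b).trans_lt h.lt_top⟩

lemma bourgainNorm_add_le (hF : AEStronglyMeasurable F volume)
    (hG : AEStronglyMeasurable G volume) :
    bourgainNorm μ b (fun q => F q + G q) ≤ bourgainNorm μ b F + bourgainNorm μ b G := by
  obtain ⟨M, hM, hM'⟩ := exists_isMajorant hF μ
  obtain ⟨N, hN, hN'⟩ := exists_isMajorant hG μ
  rw [← hM' b, ← hN' b]
  exact (bourgainNorm_le_wnorm (hM.add hN)).trans (wnorm_add_le hM.meas hN.meas)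

lemma bourgainNorm_congr (h : F =ᵐ[volume] G) (hG : AEStronglyMeasurable G volume) :
    bourgainNorm μ b F ≤ bourgainNorm μ b G := by
  obtain ⟨N, hN, hN'⟩ := exists_isMajorant hG μ
  rw [← hN' b]
  exact bourgainNorm_le_wnorm (hN.congr h)

lemma bourgainNorm_sub_le (hF : AEStronglyMeasurable F volume)
    (hG : AEStronglyMeasurable G volume) :
    bourgainNorm μ b (fun q => F q - G q) ≤ bourgainNorm μ b F + bourgainNorm μ b G := by
  obtain ⟨M, hM, hM'⟩ := exists_isMajorant hF μ
  obtain ⟨N, hN, hN'⟩ := exists_isMajorant hG μ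
  rw [← hM' b, ← hN' b]
  exact (bourgainNorm_le_wnorm (hM.sub hN)).trans (wnorm_add_le hM.meas hN.meas)

lemma InX.sub (hF : InX μ b F) (hG : InX μ b G) : InX μ b (fun q => F q - G q) :=
  ⟨hF.aesm.sub hG.aesm, (bourgainNorm_sub_le hF.aesm hG.aesm).trans_lt
    (ENNReal.add_lt_top.2 ⟨hF.lt_top, hG.lt_top⟩)⟩

lemma IsMajorant.zero : IsMajorant μ (fun _ => 0) (fun _ => 0) :=
  ⟨aestronglyMeasurable_const, measurable_const, by simp⟩

lemma bourgainNorm_zero : bourgainNorm μ b (fun _ => 0) = 0 := by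
  have h := bourgainNorm_le_wnorm (b := b) (IsMajorant.zero (μ := μ))
  simpa [wnorm] using h

lemma InX.zero : InX μ b (fun _ => 0) :=
  ⟨aestronglyMeasurable_const, by rw [bourgainNorm_zero]; exact ENNReal.zero_lt_top⟩

/-- For almost every frequency an element of the Bourgain space is integrable in `τ`. -/
lemma InX.ae_integrable (hb : 1 / 2 < b) (hF : InX μ b F) :
    ∀ᵐ ξ : ℝ, Integrable (fun τ => F (τ, ξ)) volume := by
  obtain ⟨M, hM, -, hfin⟩ := hF.exists_isMajorant
  obtain ⟨C, hC⟩ := exists_lintegral_le_wnorm hb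
  filter_upwards [hM.slice] with ξ ⟨h1, h2⟩
  refine ⟨h1, ?_⟩
  rw [hasFiniteIntegral_iff_enorm]
  calc ∫⁻ τ, ‖F (τ, ξ)‖ₑ ≤ ∫⁻ τ, jb ξ ^ (-μ) * M (τ - omega ξ) := lintegral_mono_ae h2
    _ = jb ξ ^ (-μ) * ∫⁻ τ, M τ := by
        rw [lintegral_const_mul' _ _ (jb_rpow_ne_top _ _), lintegral_sub_right_eq_self]
    _ < ⊤ := ENNReal.mul_lt_top (jb_rpow_ne_top _ _).lt_top
        ((hC M hM.meas).trans_lt (ENNReal.mul_lt_top ENNReal.coe_lt_top hfin))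

lemma integrable_cexp2_mul {w : ℝ → ℂ} (hw : Integrable w volume) (t : ℝ) :
    Integrable (fun τ => cexp2 (t * τ) * w τ) volume := by
  have h := continuous_cexp2
  exact hw.bdd_mul (c := 1) (by fun_prop) (ae_of_all _ fun x => (norm_cexp2 _).le)

lemma timeSlice_congr (h : F =ᵐ[volume] G) : ∀ᵐ ξ : ℝ, ∀ t, timeSlice F t ξ = timeSlice G t ξ := by
  have h2 := Measure.ae_ae_of_ae_prod
    ((Measure.measurePreserving_swap (μ := (volume : Measure ℝ))
      (ν := (volume : Measure ℝ))).quasiMeasurePreserving.ae h)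
  filter_upwards [h2] with ξ hξ t
  refine integral_congr_ae ?_
  filter_upwards [hξ] with τ hτ
  simp only [Prod.swap_prod_mk] at hτ
  rw [hτ]

lemma duhamelInt_congr (h : F =ᵐ[volume] G) :
    ∀ᵐ ξ : ℝ, ∀ t, duhamelInt F t ξ = duhamelInt G t ξ := by
  have h2 := Measure.ae_ae_of_ae_prod
    ((Measure.measurePreserving_swap (μ := (volume : Measure ℝ))
      (ν := (volume : Measure ℝ))).quasiMeasurePreserving.ae h)
  filter_upwards [h2] with ξ hξ t
  refine integral_congr_ae ?_
  filter_upwards [hξ] with τ hτ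
  simp only [Prod.swap_prod_mk] at hτ
  rw [hτ]

lemma timeSlice_sub (hb : 1 / 2 < b) (hF : InX μ b F) (hG : InX μ b G) :
    ∀ᵐ ξ : ℝ, ∀ t, timeSlice (fun q => F q - G q) t ξ = timeSlice F t ξ - timeSlice G t ξ := by
  filter_upwards [hF.ae_integrable hb, hG.ae_integrable hb] with ξ h1 h2 t
  simp only [timeSlice, mul_sub]
  exact integral_sub (integrable_cexp2_mul h1 t) (integrable_cexp2_mul h2 t)

/-- The space-time Fourier transform of `∂ₓ(u₁u₂u₃)`. -/
def nonlin (F₁ F₂ F₃ : ℝ × ℝ → ℂ) (q : ℝ × ℝ) : ℂ :=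
  (2 * Real.pi * q.2 * Complex.I) * triFourier F₁ F₂ F₃ q

lemma duhamel_eq_duhamelInt (F : ℝ × ℝ → ℂ) (t ξ : ℝ) :
    duhamel F t ξ = duhamelInt (nonlin F F F) t ξ := by
  rw [duhamel, duhamelInt, ← integral_const_mul]
  refine integral_congr_ae (ae_of_all _ fun τ => ?_)
  simp only [nonlin, cubeFourier_eq]
  ring

/-- The trilinear estimate for the nonlinear term. -/
lemma exists_nonlin_majorant (h : Admissible μ δ b β) :
    ∃ C : ℝ≥0, ∀ (F₁ F₂ F₃ : ℝ × ℝ → ℂ) (M₁ M₂ M₃ : ℝ → ℝ≥0∞),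
      IsMajorant μ F₁ M₁ → IsMajorant μ F₂ M₂ → IsMajorant μ F₃ M₃ →
      ∃ N : ℝ → ℝ≥0∞, IsMajorant μ (nonlin F₁ F₂ F₃) N ∧
        (∀ τ ξ : ℝ, ‖(2 * Real.pi * ξ * Complex.I : ℂ)‖ₑ * triAbs F₁ F₂ F₃ (τ, ξ) ≤
          jb ξ ^ (-μ) * N (τ - omega ξ)) ∧
        wnorm (-β) N ≤ C * (wnorm b M₁ * wnorm b M₂ * wnorm b M₃) := by
  obtain ⟨C, hC⟩ := exists_trilinear h.δ_pos h.δ_le h.δ_le_half h.half_lt h.nonneg h.lt_add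
  refine ⟨‖(2 * Real.pi * Complex.I : ℂ)‖₊ * C, fun F₁ F₂ F₃ M₁ M₂ M₃ h₁ h₂ h₃ => ?_⟩
  obtain ⟨N, hN, hle, hn⟩ := hC F₁ F₂ F₃ M₁ M₂ M₃ h₁ h₂ h₃
  have hle' : ∀ τ ξ : ℝ, ‖(2 * Real.pi * ξ * Complex.I : ℂ)‖ₑ * triAbs F₁ F₂ F₃ (τ, ξ) ≤
      jb ξ ^ (-μ) * (‖(2 * Real.pi * Complex.I : ℂ)‖ₑ * N (τ - omega ξ)) := by
    intro τ ξ
    have h1 : ‖(2 * Real.pi * ξ * Complex.I : ℂ)‖ₑ =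
        ‖(2 * Real.pi * Complex.I : ℂ)‖ₑ * ‖ξ‖ₑ := by
      rw [show (2 * Real.pi * ξ * Complex.I : ℂ) = 2 * Real.pi * Complex.I * (ξ : ℂ) by ring,
        enorm_mul]
      congr 1
      rw [← ofReal_norm, ← ofReal_norm, Complex.norm_real]
    calc _ = ‖(2 * Real.pi * Complex.I : ℂ)‖ₑ * (jb ξ ^ μ * jb ξ ^ (-μ)) * (‖ξ‖ₑ *
            triAbs F₁ F₂ F₃ (τ, ξ)) := by rw [jb_rpow_mul_neg, h1]; ring
      _ = jb ξ ^ (-μ) * (‖(2 * Real.pi * Complex.I : ℂ)‖ₑ *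
            (‖ξ‖ₑ * jb ξ ^ μ * triAbs F₁ F₂ F₃ (τ, ξ))) := by ring
      _ ≤ _ := by gcongr; exact hle τ ξ
  refine ⟨fun x => ‖(2 * Real.pi * Complex.I : ℂ)‖ₑ * N x, ⟨?_, hN.const_mul _, ae_of_all _ ?_⟩,
    hle', ?_⟩
  · exact AEStronglyMeasurable.mul (by fun_prop)
      (aestronglyMeasurable_triFourier h₁.aesm h₂.aesm h₃.aesm)
  · rintro ⟨τ, ξ⟩
    rw [nonlin, enorm_mul]
    exact (mul_le_mul_right (enorm_triFourier_le _ _ _ _) _).trans (hle' τ ξ)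
  · rw [wnorm_const_mul enorm_ne_top, ENNReal.coe_mul, mul_assoc (ENNReal.ofNNReal _)]
    exact mul_le_mul_right hn _

lemma quasiMeasurePreserving_modulation :
    Measure.QuasiMeasurePreserving (fun q : ℝ × ℝ => q.1 - omega q.2) volume volume := by
  have h := (measurePreserving_shear (a := fun ξ => -omega ξ)
    measurable_omega.neg).quasiMeasurePreserving
  exact Measure.quasiMeasurePreserving_fst.comp h

lemma ae_lt_top_of_wnorm_lt_top {N : ℝ → ℝ≥0∞} (hN : Measurable N) {b : ℝ}
    (h : wnorm b N < ⊤) : ∀ᵐ x, N x < ⊤ := by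
  have h1 : ∫⁻ τ, (jb τ ^ b * N τ) ^ 2 < ⊤ := by
    rw [← eLpNorm_two_sq]; exact ENNReal.pow_lt_top h
  filter_upwards [ae_lt_top (by fun_prop) h1.ne] with x hx
  by_contra h2
  rw [not_lt, top_le_iff] at h2
  rw [h2, ENNReal.mul_top (jb_rpow_ne_zero _ _)] at hx
  simp at hx

/-- The triple convolution converges absolutely almost everywhere. -/
lemma ae_integrable_triIntegrand (h : Admissible μ δ b β) (hA : InX μ b A) (hB : InX μ b B)
    (hW : InX μ b W) : ∀ᵐ q : ℝ × ℝ, Integrable (triIntegrand A B W q) volume := by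
  obtain ⟨C, hC⟩ := exists_nonlin_majorant h
  obtain ⟨M₁, h₁, -, f₁⟩ := hA.exists_isMajorant
  obtain ⟨M₂, h₂, -, f₂⟩ := hB.exists_isMajorant
  obtain ⟨M₃, h₃, -, f₃⟩ := hW.exists_isMajorant
  obtain ⟨N, hN, hle, hn⟩ := hC _ _ _ _ _ _ h₁ h₂ h₃
  have hfin : wnorm (-β) N < ⊤ := hn.trans_lt (ENNReal.mul_lt_top ENNReal.coe_lt_top
    (ENNReal.mul_lt_top (ENNReal.mul_lt_top f₁ f₂) f₃))
  have h0 : ∀ᵐ q : ℝ × ℝ, q.2 ≠ 0 := Measure.quasiMeasurePreserving_snd.ae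
    (compl_mem_ae_iff.2 (measure_singleton (0 : ℝ)))
  filter_upwards [quasiMeasurePreserving_modulation.ae (ae_lt_top_of_wnorm_lt_top hN.meas hfin),
    h0] with q hq hq0
  refine ⟨aestronglyMeasurable_triIntegrand h₁.aesm h₂.aesm h₃.aesm q, ?_⟩
  rw [hasFiniteIntegral_iff_enorm]
  have h1 := (hle q.1 q.2).trans_lt (ENNReal.mul_lt_top (jb_rpow_ne_top _ _).lt_top hq)
  refine ENNReal.lt_top_of_mul_ne_top_right h1.ne ?_
  simp [hq0, Real.pi_ne_zero]

/-- The nonlinear term is a difference of cubes, which factors. -/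
lemma nonlin_sub_nonlin (h : Admissible μ δ b β) (hF : InX μ b F) (hG : InX μ b G) :
    (fun q => nonlin F F F q - nonlin G G G q) =ᵐ[volume] fun q =>
      nonlin (fun q => F q - G q) F F q + nonlin G (fun q => F q - G q) F q +
        nonlin G G (fun q => F q - G q) q := by
  have hD := hF.sub hG
  filter_upwards [ae_integrable_triIntegrand h hF hF hF, ae_integrable_triIntegrand h hG hG hG,
    ae_integrable_triIntegrand h hD hF hF, ae_integrable_triIntegrand h hG hD hF,
    ae_integrable_triIntegrand h hG hG hD] with q h1 h2 h3 h4 h5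
  simp only [nonlin, triFourier, ← mul_add, ← mul_sub]
  rw [← integral_sub h1 h2, ← integral_add h3 h4,
    ← integral_add (f := fun p => _ + _) (h3.add h4) h5]
  congr 2
  ext p
  simp only [triIntegrand]
  ring

end

/-! ### Locality in time of the Duhamel term -/

section

variable {μ δ b β : ℝ} {F G A B W : ℝ × ℝ → ℂ}

lemma triFourier_swap₁₂ (A B W : ℝ × ℝ → ℂ) (q : ℝ × ℝ) :
    triFourier A B W q = triFourier B A W q := by
  have h := (Measure.measurePreserving_swap (μ := (volume : Measure (ℝ × ℝ)))
    (ν := (volume : Measure (ℝ × ℝ)))).integral_comp' (f := MeasurableEquiv.prodComm)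
    (triIntegrand B A W q)
  refine Eq.trans (integral_congr_ae (ae_of_all _ fun p => ?_)) h
  simp only [triIntegrand, MeasurableEquiv.prodComm, MeasurableEquiv.coe_mk, Equiv.prodComm_apply,
    Prod.fst_swap, Prod.snd_swap]
  rw [sub_right_comm]; ring

/-- The change of variables exchanging the last two factors of the triple convolution. -/
def subSubEquiv (q : ℝ × ℝ) : (ℝ × ℝ) × (ℝ × ℝ) ≃ᵐ (ℝ × ℝ) × (ℝ × ℝ) where
  toFun p := (p.1, q - p.1 - p.2)
  invFun p := (p.1, q - p.1 - p.2)
  left_inv p := by simp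
  right_inv p := by simp
  measurable_toFun := by simp only [Equiv.coe_fn_mk]; fun_prop
  measurable_invFun := by simp only [Equiv.coe_fn_symm_mk]; fun_prop

lemma triFourier_swap₂₃ (A B W : ℝ × ℝ → ℂ) (q : ℝ × ℝ) :
    triFourier A B W q = triFourier A W B q := by
  have hmp : MeasurePreserving (subSubEquiv q) volume volume :=
    (MeasurePreserving.id (volume : Measure (ℝ × ℝ))).skew_product
      (μc := (volume : Measure (ℝ × ℝ))) (μd := (volume : Measure (ℝ × ℝ)))
      (g := fun p₁ p₂ => q - p₁ - p₂) (by fun_prop)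
      (ae_of_all _ fun p₁ => (Measure.measurePreserving_sub_left volume (q - p₁)).map_eq)
  have h := hmp.integral_comp' (triIntegrand A W B q)
  refine Eq.trans (integral_congr_ae (ae_of_all _ fun p => ?_)) h
  simp only [triIntegrand, subSubEquiv, MeasurableEquiv.coe_mk, Equiv.coe_fn_mk, sub_sub_cancel]
  ring

lemma nonlin_swap₂₃ (A B W : ℝ × ℝ → ℂ) : nonlin A B W = nonlin A W B := by
  ext q; rw [nonlin, nonlin, triFourier_swap₂₃]

lemma nonlin_swap₁₃ (A B W : ℝ × ℝ → ℂ) : nonlin A B W = nonlin W B A := by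
  ext q
  rw [nonlin, nonlin, triFourier_swap₁₂, triFourier_swap₂₃, triFourier_swap₁₂]

lemma quasiMeasurePreserving_slice (ν : Measure ℝ) [SFinite ν] :
    Measure.QuasiMeasurePreserving (fun z : (ℝ × ℝ) × ℝ => (z.2, z.1.2))
      ((ν.prod volume).prod volume) (volume.prod volume) :=
  (Measure.measurePreserving_swap.quasiMeasurePreserving).comp
    (QuasiMeasurePreserving.prodMap Measure.quasiMeasurePreserving_snd
      (Measure.QuasiMeasurePreserving.id _))

lemma aestronglyMeasurable_timeSlice (hW : AEStronglyMeasurable W volume)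
    (ν : Measure ℝ) [SFinite ν] :
    AEStronglyMeasurable (fun z : ℝ × ℝ => timeSlice W z.1 z.2) (ν.prod volume) := by
  have hc := continuous_cexp2
  refine AEStronglyMeasurable.integral_prod_right'
      (f := fun z : (ℝ × ℝ) × ℝ => cexp2 (z.1.1 * z.2) * W (z.2, z.1.2)) ?_
  have h1 : AEStronglyMeasurable (fun z : (ℝ × ℝ) × ℝ => cexp2 (z.1.1 * z.2))
      ((ν.prod volume).prod volume) :=
    (by fun_prop : Continuous (fun z : (ℝ × ℝ) × ℝ => cexp2 (z.1.1 * z.2))).aestronglyMeasurable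
  have h2 := hW.comp_quasiMeasurePreserving (quasiMeasurePreserving_slice ν)
  exact h1.mul h2

lemma ae_ae_timeSlice_eq_zero (hW : AEStronglyMeasurable W volume) {t : ℝ}
    (h0 : ∀ s ∈ uIcc 0 t, ∀ᵐ ξ, timeSlice W s ξ = 0) :
    ∀ᵐ ξ : ℝ, ∀ᵐ s ∂(volume.restrict (uIoc 0 t)), timeSlice W s ξ = 0 := by
  have hm := aestronglyMeasurable_timeSlice hW (volume.restrict (uIoc 0 t))
  have hm2 : AEMeasurable (Function.uncurry fun s ξ => ‖timeSlice W s ξ‖ₑ)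
      ((volume.restrict (uIoc 0 t)).prod volume) := hm.enorm
  have h1 : ∫⁻ ξ, ∫⁻ s in uIoc 0 t, ‖timeSlice W s ξ‖ₑ = 0 := by
    refine (lintegral_lintegral_swap hm2).symm.trans ?_
    rw [lintegral_congr_ae (g := fun _ => 0), lintegral_zero]
    filter_upwards [ae_restrict_mem measurableSet_uIoc] with s hs
    rw [lintegral_congr_ae (g := fun _ => 0), lintegral_zero]
    filter_upwards [h0 s (uIoc_subset_uIcc hs)] with ξ hξ
    simp [hξ]
  have hsw := hm.prod_swap
  simp only [Prod.fst_swap, Prod.snd_swap] at hsw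
  have h3 : AEMeasurable (fun ξ => ∫⁻ s in uIoc 0 t, ‖timeSlice W s ξ‖ₑ) volume :=
    hsw.enorm.lintegral_prod_right'
  filter_upwards [(lintegral_eq_zero_iff' h3).1 h1, hsw.prodMk_left] with ξ hξ hξm
  have h4 : AEMeasurable (fun s => ‖timeSlice W s ξ‖ₑ) (volume.restrict (uIoc 0 t)) := hξm.enorm
  have h2 := (lintegral_eq_zero_iff' h4).1 hξ
  filter_upwards [h2] with s hs
  simpa using hs

lemma integral_duhamelKernel_mul_eq_zero {w : ℝ → ℂ} (hw : Integrable w volume) {t : ℝ}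
    (h0 : ∀ᵐ s ∂(volume.restrict (uIoc 0 t)), ∫ τ, cexp2 (s * τ) * w τ = 0) (ξ a : ℝ) :
    ∫ τ, duhamelKernel t τ ξ * w (τ - a) = 0 := by
  have hc := continuous_cexp2
  have hint : Integrable (Function.uncurry fun τ s : ℝ =>
      cexp2 ((t - s) * omega ξ) * cexp2 (s * τ) * w (τ - a))
      (volume.prod (volume.restrict (uIoc 0 t))) := by
    have hf : IsFiniteMeasure ((volume : Measure ℝ).restrict (uIoc 0 t)) :=
      ⟨by rw [Measure.restrict_apply_univ, uIoc]; exact measure_Ioc_lt_top⟩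
    have h1 : Integrable (fun z : ℝ × ℝ => w (z.1 - a))
        (volume.prod (volume.restrict (uIoc 0 t))) := (hw.comp_sub_right a).comp_fst _
    refine h1.bdd_mul (c := 1) (by fun_prop) (ae_of_all _ fun z => ?_)
    rw [norm_mul, norm_cexp2, norm_cexp2, one_mul]
  have hk : ∀ τ, duhamelKernel t τ ξ * w (τ - a) = (if 0 ≤ t then 1 else -1 : ℝ) •
      ∫ s in uIoc 0 t, cexp2 ((t - s) * omega ξ) * cexp2 (s * τ) * w (τ - a) := by
    intro τ
    rw [integral_mul_const, duhamelKernel, intervalIntegral.intervalIntegral_eq_integral_uIoc,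
      smul_mul_assoc]
  simp_rw [hk]
  rw [integral_smul, integral_integral_swap hint]
  rw [integral_congr_ae (g := fun _ => 0), integral_zero, smul_zero]
  filter_upwards [h0] with s hs
  have h1 : ∀ τ, cexp2 ((t - s) * omega ξ) * cexp2 (s * τ) * w (τ - a) =
      (fun x => cexp2 ((t - s) * omega ξ) * cexp2 (s * a) * (cexp2 (s * x) * w x)) (τ - a) := by
    intro τ
    have : cexp2 (s * τ) = cexp2 (s * a) * cexp2 (s * (τ - a)) := by
      rw [← cexp2_add]; congr 1; ring
    simp only [this]; ring
  simp_rw [h1]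
  rw [integral_sub_right_eq_self (fun x => cexp2 ((t - s) * omega ξ) * cexp2 (s * a) *
    (cexp2 (s * x) * w x)), integral_const_mul, hs, mul_zero]

/-- The Duhamel term at time `t` only sees the factors on the time interval between `0` and `t`:
after Fubini, the `τ`-integral against the last factor reconstructs its values there. -/
theorem duhamelInt_nonlin_eq_zero (h : Admissible μ δ b β) (hA : InX μ b A) (hB : InX μ b B)
    (hW : InX μ b W) {t : ℝ} (h0 : ∀ s ∈ uIcc 0 t, ∀ᵐ ξ, timeSlice W s ξ = 0) :
    ∀ᵐ ξ, duhamelInt (nonlin A B W) t ξ = 0 := by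
  obtain ⟨C, hC⟩ := exists_nonlin_majorant h
  obtain ⟨M₁, h₁, -, f₁⟩ := hA.exists_isMajorant
  obtain ⟨M₂, h₂, -, f₂⟩ := hB.exists_isMajorant
  obtain ⟨M₃, h₃, -, f₃⟩ := hW.exists_isMajorant
  obtain ⟨N, hN, hle, hn⟩ := hC _ _ _ _ _ _ h₁ h₂ h₃
  have hfin : wnorm (-β) N < ⊤ := hn.trans_lt (ENNReal.mul_lt_top ENNReal.coe_lt_top
    (ENNReal.mul_lt_top (ENNReal.mul_lt_top f₁ f₂) f₃))
  have hmeas : ∀ᵐ ξ : ℝ, AEStronglyMeasurable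
      (fun z : ℝ × ((ℝ × ℝ) × (ℝ × ℝ)) => triIntegrand A B W (z.1, ξ) z.2)
      (volume.prod volume) := by
    have hmp : MeasurePreserving (fun z : ℝ × (ℝ × ((ℝ × ℝ) × (ℝ × ℝ))) => ((z.2.1, z.1), z.2.2))
        (volume.prod (volume.prod volume)) ((volume.prod volume).prod volume) := by
      have e1 := (measurePreserving_prodAssoc (volume : Measure ℝ) (volume : Measure ℝ)
        (volume : Measure ((ℝ × ℝ) × (ℝ × ℝ)))).symm
      have e2 := (Measure.measurePreserving_swap (μ := (volume : Measure ℝ))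
        (ν := (volume : Measure ℝ))).prod
          (MeasurePreserving.id (volume : Measure ((ℝ × ℝ) × (ℝ × ℝ))))
      exact e2.comp e1
    exact ((aestronglyMeasurable_triIntegrand' hA.aesm hB.aesm hW.aesm).comp_measurePreserving
      hmp).prodMk_left
  have hgood := (hW.ae_integrable h.half_lt).and (ae_ae_timeSlice_eq_zero hW.aesm h0)
  filter_upwards [hmeas, compl_mem_ae_iff.2 (measure_singleton (0 : ℝ))] with ξ hm hξ0
  have hx : (2 * Real.pi * ξ * Complex.I : ℂ) ≠ 0 := by
    have : ξ ≠ 0 := hξ0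
    simp [this, Real.pi_ne_zero]
  have hKm := ((continuous_duhamelKernel t).comp (Continuous.prodMk_left ξ)).aestronglyMeasurable
    (μ := (volume : Measure ℝ))
  have hint : Integrable (Function.uncurry fun (τ : ℝ) (p : (ℝ × ℝ) × (ℝ × ℝ)) =>
      duhamelKernel t τ ξ * triIntegrand A B W (τ, ξ) p) (volume.prod volume) := by
    have hm' : AEStronglyMeasurable (Function.uncurry fun (τ : ℝ) (p : (ℝ × ℝ) × (ℝ × ℝ)) =>
        duhamelKernel t τ ξ * triIntegrand A B W (τ, ξ) p) (volume.prod volume) := (hKm.comp_quasiMeasurePreserving (Measure.quasiMeasurePreserving_fst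
      (ν := (volume : Measure ((ℝ × ℝ) × (ℝ × ℝ)))))).mul hm
    refine ⟨hm', ?_⟩
    rw [hasFiniteIntegral_iff_enorm, lintegral_prod _ hm'.enorm]
    have h1 : ∀ τ, ∫⁻ p, ‖Function.uncurry (fun (τ : ℝ) (p : (ℝ × ℝ) × (ℝ × ℝ)) =>
        duhamelKernel t τ ξ * triIntegrand A B W (τ, ξ) p) (τ, p)‖ₑ =
        ‖duhamelKernel t τ ξ‖ₑ * triAbs A B W (τ, ξ) := by
      intro τ
      simp only [Function.uncurry, enorm_mul]
      rw [lintegral_const_mul' _ _ enorm_ne_top]; rfl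
    simp_rw [h1]
    refine ENNReal.lt_top_of_mul_ne_top_right (a := ‖(2 * Real.pi * ξ * Complex.I : ℂ)‖ₑ)
      (ne_of_lt ?_) (by simpa using hx)
    rw [← lintegral_const_mul' _ _ enorm_ne_top]
    calc _ ≤ ∫⁻ τ, jb ξ ^ (-μ) * (‖duhamelKernel t τ ξ‖ₑ * N (τ - omega ξ)) := by
          refine lintegral_mono fun τ => ?_
          rw [mul_left_comm, mul_left_comm (jb ξ ^ (-μ))]
          exact mul_le_mul_right (hle τ ξ) _
      _ = jb ξ ^ (-μ) * ∫⁻ τ, ‖duhamelKernel t τ ξ‖ₑ * N (τ - omega ξ) :=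
          lintegral_const_mul' _ _ (jb_rpow_ne_top _ _)
      _ < ⊤ := ENNReal.mul_lt_top (jb_rpow_ne_top _ _).lt_top
        (lintegral_duhamelKernel_mul_lt_top h.lt_half hN.meas hfin t ξ)
  have h2 : ∫ τ, duhamelKernel t τ ξ * triFourier A B W (τ, ξ) = 0 := by
    calc _ = ∫ τ, ∫ p, duhamelKernel t τ ξ * triIntegrand A B W (τ, ξ) p := by
          simp_rw [integral_const_mul]; rfl
      _ = ∫ p, ∫ τ, duhamelKernel t τ ξ * triIntegrand A B W (τ, ξ) p :=
          integral_integral_swap hint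
      _ = 0 := by
          rw [integral_congr_ae (g := fun _ => 0), integral_zero]
          have hq := (Measure.quasiMeasurePreserving_snd (μ := (volume : Measure ℝ))
            (ν := (volume : Measure ℝ))).comp (quasiMeasurePreserving_sub_sub (0, ξ))
          filter_upwards [hq.ae hgood] with p ⟨hp1, hp2⟩
          simp only [Function.comp, Prod.snd_sub] at hp1 hp2
          have h3 := integral_duhamelKernel_mul_eq_zero hp1 hp2 ξ (p.1.1 + p.2.1)
          calc _ = ∫ τ, (A p.1 * B p.2) * (duhamelKernel t τ ξ *
                W (τ - (p.1.1 + p.2.1), ξ - p.1.2 - p.2.2)) := by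
                refine integral_congr_ae (ae_of_all _ fun τ => ?_)
                have : ((τ, ξ) - p.1 - p.2 : ℝ × ℝ) =
                  (τ - (p.1.1 + p.2.1), ξ - p.1.2 - p.2.2) := by
                  ext <;> simp [sub_sub]
                simp only [triIntegrand, this]; ring
            _ = 0 := by rw [integral_const_mul, h3, mul_zero]
  calc duhamelInt (nonlin A B W) t ξ
      = (2 * Real.pi * ξ * Complex.I) * ∫ τ, duhamelKernel t τ ξ * triFourier A B W (τ, ξ) := by
        rw [duhamelInt, ← integral_const_mul]
        refine integral_congr_ae (ae_of_all _ fun τ => ?_)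
        simp only [nonlin]; ring
    _ = 0 := by rw [h2, mul_zero]

/-- The nonlinear terms have an integrable product with the Duhamel kernel. -/
lemma ae_integrable_duhamelKernel_mul_nonlin (h : Admissible μ δ b β) (hA : InX μ b A)
    (hB : InX μ b B) (hW : InX μ b W) :
    ∀ᵐ ξ : ℝ, ∀ t, Integrable (fun τ => duhamelKernel t τ ξ * nonlin A B W (τ, ξ)) volume := by
  obtain ⟨C, hC⟩ := exists_nonlin_majorant h
  obtain ⟨M₁, h₁, -, f₁⟩ := hA.exists_isMajorant
  obtain ⟨M₂, h₂, -, f₂⟩ := hB.exists_isMajorant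
  obtain ⟨M₃, h₃, -, f₃⟩ := hW.exists_isMajorant
  obtain ⟨N, hN, -, hn⟩ := hC _ _ _ _ _ _ h₁ h₂ h₃
  exact ae_integrable_duhamelKernel_mul h.lt_half hN (hn.trans_lt
    (ENNReal.mul_lt_top ENNReal.coe_lt_top (ENNReal.mul_lt_top (ENNReal.mul_lt_top f₁ f₂) f₃)))

/-- The Duhamel term at time `t` depends only on the curve between the times `0` and `t`, not on
its extension. -/
theorem duhamelInt_nonlin_congr (h : Admissible μ δ b β) (hF : InX μ b F) (hG : InX μ b G) {t : ℝ}
    (h0 : ∀ s ∈ uIcc 0 t, ∀ᵐ ξ, timeSlice F s ξ = timeSlice G s ξ) :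
    ∀ᵐ ξ, duhamelInt (nonlin F F F) t ξ = duhamelInt (nonlin G G G) t ξ := by
  have hD := hF.sub hG
  have h0' : ∀ s ∈ uIcc 0 t, ∀ᵐ ξ, timeSlice (fun q => F q - G q) s ξ = 0 := by
    intro s hs
    filter_upwards [h0 s hs, timeSlice_sub h.half_lt hF hG] with ξ h1 h2
    rw [h2, h1, sub_self]
  have z₃ := duhamelInt_nonlin_eq_zero h hG hG hD h0'
  have z₂ := duhamelInt_nonlin_eq_zero h hG hF hD h0'
  have z₁ := duhamelInt_nonlin_eq_zero h hF hF hD h0'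
  rw [nonlin_swap₂₃] at z₂
  rw [nonlin_swap₁₃] at z₁
  filter_upwards [z₁, z₂, z₃, duhamelInt_congr (nonlin_sub_nonlin h hF hG),
    ae_integrable_duhamelKernel_mul_nonlin h hF hF hF,
    ae_integrable_duhamelKernel_mul_nonlin h hG hG hG,
    ae_integrable_duhamelKernel_mul_nonlin h hD hF hF,
    ae_integrable_duhamelKernel_mul_nonlin h hG hD hF,
    ae_integrable_duhamelKernel_mul_nonlin h hG hG hD] with ξ z₁ z₂ z₃ hs i₁ i₂ i₃ i₄ i₅
  have hs := hs t
  simp only [duhamelInt] at z₁ z₂ z₃ hs ⊢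
  simp only [mul_sub, mul_add] at hs
  rw [integral_sub (i₁ t) (i₂ t), integral_add (f := fun τ => _ + _) ((i₃ t).add (i₄ t)) (i₅ t),
    integral_add (i₃ t) (i₄ t), z₁, z₂, z₃] at hs
  rw [← sub_eq_zero, hs]; simp

end

/-! ### The solution map and its contraction property -/

section

variable {μ δ b β : ℝ} {F G A B W : ℝ × ℝ → ℂ} {f₀ g₀ : ℝ → ℂ}

/-- The free evolution with initial datum `f₀`, cut off in time. -/
def linPart (f₀ : ℝ → ℂ) (q : ℝ × ℝ) : ℂ := cutoffFT (q.1 - omega q.2) * f₀ q.2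

/-- The map whose fixed points are extensions to all times of solutions on `[-T, T]` with
initial datum `f₀`. -/
def solMap (σ T : ℝ) (f₀ : ℝ → ℂ) (F : ℝ × ℝ → ℂ) (q : ℝ × ℝ) : ℂ :=
  linPart f₀ q + σ * duhamelExt T (nonlin F F F) q

lemma isMajorant_linPart (hf : AEStronglyMeasurable f₀ volume) :
    IsMajorant μ (linPart f₀) (fun τ => weightedSup μ f₀ * ‖cutoffFT τ‖ₑ) := by
  have ho := continuous_omega
  refine ⟨AEStronglyMeasurable.mul ?_ ?_, by fun_prop, ?_⟩
  · exact (cutoffFT.continuous.comp (by fun_prop :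
      Continuous fun q : ℝ × ℝ => q.1 - omega q.2)).aestronglyMeasurable
  · exact hf.comp_quasiMeasurePreserving Measure.quasiMeasurePreserving_snd
  · have h := (Measure.quasiMeasurePreserving_snd (μ := (volume : Measure ℝ))
      (ν := (volume : Measure ℝ))).ae (ae_le_weightedSup μ f₀)
    filter_upwards [h] with q hq
    rw [linPart, enorm_mul, mul_comm, ← mul_assoc]
    gcongr

lemma exists_wnorm_cutoffFT_le {b : ℝ} (hb : b < 1) :
    ∃ C : ℝ≥0, ∀ c : ℝ≥0∞, c ≠ ⊤ → wnorm b (fun τ => c * ‖cutoffFT τ‖ₑ) ≤ C * c := by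
  obtain ⟨C, hC⟩ := exists_enorm_schwartz_le cutoffFT
  obtain ⟨A, hA⟩ := ENNReal.canLift.prf _ (lintegral_sq_jb_lt_top (p := b - 2) (by linarith))
  refine ⟨C * A, fun c hc => ?_⟩
  rw [wnorm_const_mul hc, mul_comm]
  gcongr
  calc wnorm b (fun τ => ‖cutoffFT τ‖ₑ) ≤ wnorm b (fun τ => C * jb τ ^ (-2 : ℝ)) := wnorm_mono hC
    _ = C * eLpNorm (fun τ => jb τ ^ (b - 2)) 2 volume := by
        rw [wnorm_const_mul ENNReal.coe_ne_top, wnorm]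
        simp_rw [jb_rpow_mul_rpow]
        rfl
    _ = _ := by rw [ENNReal.coe_mul, hA]

lemma timeSlice_linPart {t : ℝ} (ht : |t| ≤ 1) (ξ : ℝ) :
    timeSlice (linPart f₀) t ξ = cexp2 (t * omega ξ) * f₀ ξ := by
  have h := integral_cexp2_mul_scaled_cutoffFT one_pos ht (omega ξ)
  simp only [Complex.ofReal_one, one_mul] at h
  simp only [timeSlice, linPart, ← mul_assoc]
  rw [integral_mul_const, h]

lemma duhamelExt_sub (h : Admissible μ δ b β) {N₁ N₂ : ℝ → ℝ≥0∞} (hF : IsMajorant μ F N₁)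
    (hG : IsMajorant μ G N₂) (hN₁ : wnorm (-β) N₁ < ⊤) (hN₂ : wnorm (-β) N₂ < ⊤) {T : ℝ}
    (hT : 0 < T) (hT1 : T ≤ 1) :
    (fun q => duhamelExt T F q - duhamelExt T G q) =ᵐ[volume]
      duhamelExt T (fun q => F q - G q) := by
  have key : ∀ {F : ℝ × ℝ → ℂ} {N : ℝ → ℝ≥0∞}, IsMajorant μ F N → wnorm (-β) N < ⊤ →
      ∀ᵐ q : ℝ × ℝ, Integrable (fun x =>
        duhamelExtKernel T (q.1 - omega q.2) (x - omega q.2) * F (x, q.2)) volume := by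
    intro F N hF hN
    obtain ⟨C, hC⟩ := exists_wnorm_duhamelExt_le (by linarith [h.half_lt]) h.lt_one h.lt_half
      h.nonneg h.add_lt.le
    have hfin := (hC T hT hT1 N hF.meas).trans_lt (ENNReal.mul_lt_top ENNReal.coe_lt_top
      (ENNReal.mul_lt_top (ENNReal.rpow_lt_top_of_nonneg (by linarith [h.add_lt])
        ENNReal.ofReal_ne_top) hN))
    have hm : Measurable fun z : ℝ × ℝ => duhamelExtKernel T z.1 z.2 :=
      measurable_duhamelExtKernel T
    have h1 := quasiMeasurePreserving_modulation.ae
      (ae_lt_top_of_wnorm_lt_top (hF.duhamelExt T).meas hfin)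
    have h2 : ∀ᵐ q : ℝ × ℝ, AEStronglyMeasurable (fun τ => F (τ, q.2)) volume ∧
        ∀ᵐ τ : ℝ, ‖F (τ, q.2)‖ₑ ≤ jb q.2 ^ (-μ) * N (τ - omega q.2) :=
      Measure.quasiMeasurePreserving_snd.ae hF.slice
    filter_upwards [h1, h2] with q hq1 hq
    obtain ⟨hq2, hq3⟩ := hq
    have hmq := hm.comp (by fun_prop : Measurable fun x : ℝ => (q.1 - omega q.2, x - omega q.2))
    simp only [Function.comp_def] at hmq
    refine ⟨hmq.aestronglyMeasurable.mul hq2, ?_⟩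
    rw [hasFiniteIntegral_iff_enorm]
    calc _ ≤ ∫⁻ x, jb q.2 ^ (-μ) * (‖duhamelExtKernel T (q.1 - omega q.2) (x - omega q.2)‖ₑ *
            N (x - omega q.2)) := by
          refine lintegral_mono_ae ?_
          filter_upwards [hq3] with x hx
          rw [enorm_mul, mul_left_comm]
          gcongr
      _ = jb q.2 ^ (-μ) * ∫⁻ x, ‖duhamelExtKernel T (q.1 - omega q.2) x‖ₑ * N x := by
          rw [lintegral_const_mul' _ _ (jb_rpow_ne_top _ _), lintegral_sub_right_eq_self
            (fun x => ‖duhamelExtKernel T (q.1 - omega q.2) x‖ₑ * N x)]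
      _ < ⊤ := ENNReal.mul_lt_top (jb_rpow_ne_top _ _).lt_top hq1
  filter_upwards [key hF hN₁, key hG hN₂] with q h1 h2
  simp only [duhamelExt, mul_sub]
  exact (integral_sub h1 h2).symm

/-- The nonlinear term of an element of the Bourgain space has a majorant of finite norm. -/
lemma InX.exists_nonlin_majorant (h : Admissible μ δ b β) (hA : InX μ b A) (hB : InX μ b B)
    (hW : InX μ b W) : ∃ N, IsMajorant μ (nonlin A B W) N ∧ wnorm (-β) N < ⊤ := by
  obtain ⟨C, hC⟩ := MKdV.exists_nonlin_majorant h
  obtain ⟨M₁, h₁, -, f₁⟩ := hA.exists_isMajorant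
  obtain ⟨M₂, h₂, -, f₂⟩ := hB.exists_isMajorant
  obtain ⟨M₃, h₃, -, f₃⟩ := hW.exists_isMajorant
  obtain ⟨N, hN, -, hn⟩ := hC _ _ _ _ _ _ h₁ h₂ h₃
  exact ⟨N, hN, hn.trans_lt
    (ENNReal.mul_lt_top ENNReal.coe_lt_top (ENNReal.mul_lt_top (ENNReal.mul_lt_top f₁ f₂) f₃))⟩

lemma exists_nonlin_sub_majorant (h : Admissible μ δ b β) :
    ∃ C : ℝ≥0, ∀ F G : ℝ × ℝ → ℂ, InX μ b F → InX μ b G →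
      ∃ N, IsMajorant μ (fun q => nonlin F F F q - nonlin G G G q) N ∧
        wnorm (-β) N ≤ C * ((bourgainNorm μ b F * bourgainNorm μ b F +
          bourgainNorm μ b G * bourgainNorm μ b F + bourgainNorm μ b G * bourgainNorm μ b G) *
          bourgainNorm μ b (fun q => F q - G q)) := by
  obtain ⟨C, hC⟩ := exists_nonlin_majorant h
  refine ⟨C, fun F G hF hG => ?_⟩
  obtain ⟨M₁, h₁, e₁, -⟩ := hF.exists_isMajorant
  obtain ⟨M₂, h₂, e₂, -⟩ := hG.exists_isMajorant
  obtain ⟨M₃, h₃, e₃, -⟩ := (hF.sub hG).exists_isMajorant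
  obtain ⟨N₁, k₁, -, n₁⟩ := hC _ _ _ _ _ _ h₃ h₁ h₁
  obtain ⟨N₂, k₂, -, n₂⟩ := hC _ _ _ _ _ _ h₂ h₃ h₁
  obtain ⟨N₃, k₃, -, n₃⟩ := hC _ _ _ _ _ _ h₂ h₂ h₃
  refine ⟨_, ((k₁.add k₂).add k₃).congr (nonlin_sub_nonlin h hF hG), ?_⟩
  calc _ ≤ wnorm (-β) N₁ + wnorm (-β) N₂ + wnorm (-β) N₃ :=
        (wnorm_add_le (k₁.meas.add k₂.meas) k₃.meas).trans
          (add_le_add_left (wnorm_add_le k₁.meas k₂.meas) _)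
    _ ≤ _ := add_le_add (add_le_add n₁ n₂) n₃
    _ = _ := by rw [e₁, e₂, e₃]; ring

/-- The basic estimate for the solution map: Lipschitz in the datum, with a Lipschitz constant in
`F` that is a positive power of `T`. -/
theorem exists_solMap_sub_le (h : Admissible μ δ b β) :
    ∃ C₀ C₁ : ℝ≥0, ∀ σ T : ℝ, ‖(σ : ℂ)‖ₑ ≤ 1 → 0 < T → T ≤ 1 → ∀ (f₀ g₀ : ℝ → ℂ)
      (F G : ℝ × ℝ → ℂ), AEStronglyMeasurable f₀ volume → AEStronglyMeasurable g₀ volume →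
      weightedSup μ (fun ξ => f₀ ξ - g₀ ξ) ≠ ⊤ → InX μ b F → InX μ b G →
      bourgainNorm μ b (fun q => solMap σ T f₀ F q - solMap σ T g₀ G q) ≤
        C₀ * weightedSup μ (fun ξ => f₀ ξ - g₀ ξ) + C₁ * (ENNReal.ofReal T ^ (1 - b - β) *
          ((bourgainNorm μ b F * bourgainNorm μ b F +
          bourgainNorm μ b G * bourgainNorm μ b F + bourgainNorm μ b G * bourgainNorm μ b G) *
          bourgainNorm μ b (fun q => F q - G q))) := by
  obtain ⟨C₀, hC₀⟩ := exists_wnorm_cutoffFT_le h.lt_one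
  obtain ⟨C₁, hC₁⟩ := exists_nonlin_sub_majorant h
  obtain ⟨C₂, hC₂⟩ := exists_wnorm_duhamelExt_le (by linarith [h.half_lt]) h.lt_one h.lt_half
    h.nonneg h.add_lt.le
  refine ⟨C₀, C₂ * C₁, fun σ T hσ hT hT1 f₀ g₀ F G hf hg hfg hF hG => ?_⟩
  obtain ⟨N, hN, hn⟩ := hC₁ F G hF hG
  obtain ⟨N₁, hN₁, hn₁⟩ := hF.exists_nonlin_majorant h hF hF
  obtain ⟨N₂, hN₂, hn₂⟩ := hG.exists_nonlin_majorant h hG hG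
  have h1 := isMajorant_linPart (μ := μ) (hf.sub hg)
  have h2 := (hN.duhamelExt T).const_mul hσ
  have h3 : (fun q => solMap σ T f₀ F q - solMap σ T g₀ G q) =ᵐ[volume] fun q =>
      linPart (f₀ - g₀) q + σ * duhamelExt T (fun q => nonlin F F F q - nonlin G G G q) q := by
    filter_upwards [duhamelExt_sub h hN₁ hN₂ hn₁ hn₂ hT hT1] with q hq
    rw [← hq]
    simp only [solMap, linPart, Pi.sub_apply]
    ring
  calc _ ≤ _ := bourgainNorm_le_wnorm ((h1.add h2).congr h3)
    _ ≤ _ := wnorm_add_le h1.meas h2.meas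
    _ ≤ C₀ * weightedSup μ (fun ξ => f₀ ξ - g₀ ξ) + C₂ * (ENNReal.ofReal T ^ (1 - b - β) * _) :=
        add_le_add (hC₀ _ hfg) ((hC₂ T hT hT1 N hN.meas).trans
          (mul_le_mul_right (mul_le_mul_right hn _) _))
    _ = _ := by push_cast; ring

lemma linPart_zero : linPart (fun _ => 0) = fun _ => 0 := by ext q; simp [linPart]

lemma solMap_zero (σ T : ℝ) : solMap σ T (fun _ => 0) (fun _ => 0) = fun _ => 0 := by
  ext q
  simp [solMap, linPart_zero, duhamelExt, nonlin, triFourier, triIntegrand]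

lemma weightedSup_zero : weightedSup μ (fun _ => 0) = 0 := by
  simp only [weightedSup, mul_zero]; exact eLpNorm_zero'

lemma weightedSup_sub_le (hf : AEStronglyMeasurable f₀ volume)
    (hg : AEStronglyMeasurable g₀ volume) :
    weightedSup μ (fun ξ => f₀ ξ - g₀ ξ) ≤ weightedSup μ f₀ + weightedSup μ g₀ := by
  simp only [weightedSup, mul_sub]
  have hm : Measurable fun ξ : ℝ => ((japaneseBracket ξ ^ μ : ℝ) : ℂ) := by
    unfold japaneseBracket; fun_prop
  exact eLpNorm_sub_le (f := fun ξ : ℝ => ((japaneseBracket ξ ^ μ : ℝ) : ℂ) * f₀ ξ)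
    (g := fun ξ : ℝ => ((japaneseBracket ξ ^ μ : ℝ) : ℂ) * g₀ ξ)
    (hm.aestronglyMeasurable.mul hf) (hm.aestronglyMeasurable.mul hg) (by norm_num)

lemma aestronglyMeasurable_solMap (h : Admissible μ δ b β) (σ T : ℝ)
    (hf : AEStronglyMeasurable f₀ volume) (hF : InX μ b F) :
    AEStronglyMeasurable (solMap σ T f₀ F) volume := by
  obtain ⟨N₁, hN₁, -⟩ := hF.exists_nonlin_majorant h hF hF
  exact (isMajorant_linPart (μ := μ) hf).aesm.add ((hN₁.duhamelExt T).aesm.const_mul _)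

/-- On a short time interval the solution map is a contraction of a ball. -/
theorem exists_contraction (h : Admissible μ δ b β) :
    ∃ C : ℝ≥0, ∀ ρ : ℝ≥0, ∃ T : ℝ, 0 < T ∧ T ≤ 1 ∧ ∀ (σ : ℝ) (f₀ g₀ : ℝ → ℂ) (F G : ℝ × ℝ → ℂ),
      ‖(σ : ℂ)‖ₑ ≤ 1 → AEStronglyMeasurable f₀ volume → AEStronglyMeasurable g₀ volume →
      weightedSup μ f₀ ≤ ρ → weightedSup μ g₀ ≤ ρ → InX μ b F → InX μ b G →
      bourgainNorm μ b F ≤ (1 + 2 * C) * ρ → bourgainNorm μ b G ≤ (1 + 2 * C) * ρ →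
      (InX μ b (solMap σ T f₀ F) ∧ bourgainNorm μ b (solMap σ T f₀ F) ≤ (1 + 2 * C) * ρ) ∧
        bourgainNorm μ b (fun q => solMap σ T f₀ F q - solMap σ T g₀ G q) ≤
          C * weightedSup μ (fun ξ => f₀ ξ - g₀ ξ) +
            2⁻¹ * bourgainNorm μ b (fun q => F q - G q) := by
  obtain ⟨C, C₁, hC⟩ := exists_solMap_sub_le h
  refine ⟨C, fun ρ => ?_⟩
  set r : ℝ≥0 := (1 + 2 * C) * ρ with hr
  have hε : 0 < 1 - b - β := by linarith [h.add_lt]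
  obtain ⟨T, hT, hT1, hTs⟩ : ∃ T : ℝ, 0 < T ∧ T ≤ 1 ∧
      (C₁ : ℝ≥0∞) * (ENNReal.ofReal T ^ (1 - b - β) * (r * r + r * r + r * r)) ≤ 2⁻¹ := by
    have h1 : Tendsto (fun T : ℝ => (C₁ : ℝ≥0∞) * (ENNReal.ofReal T ^ (1 - b - β) *
        (r * r + r * r + r * r))) (𝓝[>] 0) (𝓝 (C₁ * ((0 : ℝ≥0∞) ^ (1 - b - β) *
        (r * r + r * r + r * r)))) := by
      refine ENNReal.Tendsto.const_mul (ENNReal.Tendsto.mul_const ?_ (Or.inr (by finiteness)))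
        (Or.inr (by finiteness))
      refine (ENNReal.continuous_rpow_const.tendsto _).comp ?_
      have h2 : Tendsto ENNReal.ofReal (𝓝[>] (0 : ℝ)) (𝓝 (ENNReal.ofReal 0)) :=
        (ENNReal.continuous_ofReal.tendsto 0).mono_left nhdsWithin_le_nhds
      simpa using h2
    rw [ENNReal.zero_rpow_of_pos hε, zero_mul, mul_zero] at h1
    have h3 := h1.eventually (ge_mem_nhds (show (0 : ℝ≥0∞) < 2⁻¹ by simp))
    have h4 : ∀ᶠ T : ℝ in 𝓝[>] 0, T ∈ Ioc (0 : ℝ) 1 := Ioc_mem_nhdsGT one_pos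
    obtain ⟨T, h5, h6⟩ := (h3.and h4).exists
    exact ⟨T, h6.1, h6.2, h5⟩
  refine ⟨T, hT, hT1, fun σ f₀ g₀ F G hσ hf hg hfρ hgρ hF hG hFr hGr => ?_⟩
  have hr' : (1 + 2 * (C : ℝ≥0∞)) * ρ = r := by rw [hr]; push_cast; rfl
  rw [hr'] at hFr hGr ⊢
  have main : ∀ {f₀ g₀ : ℝ → ℂ} {F G : ℝ × ℝ → ℂ}, AEStronglyMeasurable f₀ volume →
      AEStronglyMeasurable g₀ volume → weightedSup μ f₀ ≤ ρ → weightedSup μ g₀ ≤ ρ → InX μ b F →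
      InX μ b G → bourgainNorm μ b F ≤ r → bourgainNorm μ b G ≤ r →
      bourgainNorm μ b (fun q => solMap σ T f₀ F q - solMap σ T g₀ G q) ≤
        C * weightedSup μ (fun ξ => f₀ ξ - g₀ ξ) + 2⁻¹ * bourgainNorm μ b (fun q => F q - G q) := by
    intro f₀ g₀ F G hf hg hfρ hgρ hF hG hFr hGr
    have h0 : weightedSup μ (fun ξ => f₀ ξ - g₀ ξ) ≠ ⊤ :=
      ((weightedSup_sub_le hf hg).trans_lt (ENNReal.add_lt_top.2
        ⟨hfρ.trans_lt ENNReal.coe_lt_top, hgρ.trans_lt ENNReal.coe_lt_top⟩)).ne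
    refine (hC σ T hσ hT hT1 f₀ g₀ F G hf hg h0 hF hG).trans (add_le_add le_rfl ?_)
    calc _ ≤ (C₁ : ℝ≥0∞) * (ENNReal.ofReal T ^ (1 - b - β) * ((r * r + r * r + r * r) *
          bourgainNorm μ b (fun q => F q - G q))) := by gcongr
      _ = (C₁ : ℝ≥0∞) * (ENNReal.ofReal T ^ (1 - b - β) * (r * r + r * r + r * r)) *
          bourgainNorm μ b (fun q => F q - G q) := by ring
      _ ≤ _ := by gcongr
  refine ⟨?_, main hf hg hfρ hgρ hF hG hFr hGr⟩
  have h1 := main hf (g₀ := fun _ => 0) (G := fun _ => 0) aestronglyMeasurable_const hfρ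
    (by simp [weightedSup_zero]) hF InX.zero hFr (by simp [bourgainNorm_zero])
  simp only [solMap_zero, sub_zero] at h1
  have h2 : bourgainNorm μ b (solMap σ T f₀ F) ≤ r := by
    refine h1.trans ?_
    calc (C : ℝ≥0∞) * weightedSup μ f₀ + 2⁻¹ * bourgainNorm μ b F ≤ C * ρ + 2⁻¹ * r := by gcongr
      _ ≤ 2⁻¹ * r + 2⁻¹ * r := by
          refine add_le_add ?_ le_rfl
          rw [← hr', ← mul_assoc, mul_add, ← mul_assoc, ENNReal.inv_mul_cancel (by simp) (by simp),
            one_mul]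
          gcongr
          exact le_add_self
      _ = r := by rw [← add_mul, ENNReal.inv_two_add_inv_two, one_mul]
  exact ⟨⟨aestronglyMeasurable_solMap h σ T hf hF, h2.trans_lt ENNReal.coe_lt_top⟩, h2⟩

end

section

variable {μ δ b β : ℝ} {F G A B W : ℝ × ℝ → ℂ} {f₀ g₀ : ℝ → ℂ}

/-- The solution map produces extensions of its own Duhamel formula. -/
lemma timeSlice_solMap (h : Admissible μ δ b β) {σ T : ℝ} (hT : 0 < T) (hT1 : T ≤ 1)
    (hf : AEStronglyMeasurable f₀ volume) (hfin : weightedSup μ f₀ ≠ ⊤) (hF : InX μ b F) :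
    ∀ᵐ ξ : ℝ, ∀ t, |t| ≤ T → timeSlice (solMap σ T f₀ F) t ξ =
      cexp2 (t * omega ξ) * f₀ ξ + σ * duhamelInt (nonlin F F F) t ξ := by
  obtain ⟨N, hN, hn⟩ := hF.exists_nonlin_majorant h hF hF
  obtain ⟨C, hC⟩ := exists_wnorm_cutoffFT_le h.lt_one
  obtain ⟨C', hC'⟩ := exists_wnorm_duhamelExt_le (by linarith [h.half_lt]) h.lt_one h.lt_half
    h.nonneg h.add_lt.le
  have hfinN := (hC' T hT hT1 N hN.meas).trans_lt (ENNReal.mul_lt_top ENNReal.coe_lt_top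
    (ENNReal.mul_lt_top (ENNReal.rpow_lt_top_of_nonneg (by linarith [h.add_lt])
      ENNReal.ofReal_ne_top) hn))
  have i₁ : InX μ b (linPart f₀) := (isMajorant_linPart hf).inX
    ((hC _ hfin).trans_lt (ENNReal.mul_lt_top ENNReal.coe_lt_top hfin.lt_top))
  have i₂ : InX μ b (duhamelExt T (nonlin F F F)) := (hN.duhamelExt T).inX hfinN
  filter_upwards [timeSlice_duhamelExt h.half_lt h.lt_one h.nonneg h.lt_half h.add_lt.le hN hn hT
    hT1, i₁.ae_integrable h.half_lt, i₂.ae_integrable h.half_lt] with ξ h1 h2 h3 t ht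
  rw [← timeSlice_linPart (ht.trans hT1), ← h1 t ht]
  simp only [timeSlice, solMap]
  rw [← integral_const_mul, ← integral_add (integrable_cexp2_mul h2 t)
    ((integrable_cexp2_mul h3 t).const_mul _)]
  refine integral_congr_ae (ae_of_all _ fun τ => ?_)
  simp only []; ring

lemma exists_weightedSup_timeSlice_le (hb : 1 / 2 < b) :
    ∃ C : ℝ≥0, ∀ F : ℝ × ℝ → ℂ, AEStronglyMeasurable F volume → ∀ t,
      weightedSup μ (timeSlice F t) ≤ C * bourgainNorm μ b F := by
  obtain ⟨C, hC⟩ := exists_lintegral_le_wnorm hb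
  refine ⟨C, fun F hF t => ?_⟩
  obtain ⟨M, hM, hn⟩ := exists_isMajorant hF μ
  rw [← hn b]
  refine le_trans (weightedSup_le_of_ae ?_) (hC M hM.meas)
  filter_upwards [hM.slice] with ξ ⟨h1, h2⟩
  calc ‖timeSlice F t ξ‖ₑ ≤ ∫⁻ τ, ‖cexp2 (t * τ) * F (τ, ξ)‖ₑ := enorm_integral_le_lintegral_enorm _
    _ ≤ ∫⁻ τ, jb ξ ^ (-μ) * M (τ - omega ξ) := by
        refine lintegral_mono_ae ?_
        filter_upwards [h2] with τ hτ
        rwa [enorm_mul, enorm_cexp2, one_mul]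
    _ = jb ξ ^ (-μ) * ∫⁻ τ, M τ := by
        rw [lintegral_const_mul' _ _ (jb_rpow_ne_top _ _), lintegral_sub_right_eq_self]

lemma aestronglyMeasurable_timeSlice_const (hF : AEStronglyMeasurable F volume) (t : ℝ) :
    AEStronglyMeasurable (timeSlice F t) volume := by
  have hc := continuous_cexp2
  have h1 : AEStronglyMeasurable (fun z : ℝ × ℝ => F z.swap) (volume.prod volume) :=
    AEStronglyMeasurable.prod_swap hF
  refine AEStronglyMeasurable.integral_prod_right' (f := fun z : ℝ × ℝ =>
    cexp2 (t * z.2) * F z.swap) (AEStronglyMeasurable.mul ?_ h1)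
  exact (by fun_prop : Continuous fun z : ℝ × ℝ => cexp2 (t * z.2)).aestronglyMeasurable

lemma ae_eq_of_weightedSup_sub_eq_zero
    (h : weightedSup μ (fun ξ => f₀ ξ - g₀ ξ) = 0) : f₀ =ᵐ[volume] g₀ := by
  filter_upwards [ae_le_weightedSup μ (fun ξ => f₀ ξ - g₀ ξ)] with ξ hξ
  rw [h, mul_zero, nonpos_iff_eq_zero, enorm_eq_zero] at hξ
  exact sub_eq_zero.1 hξ

/-! ### Uniqueness -/

/-- `F` satisfies the Duhamel formula with datum `f₀` at the times in `J`. -/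
def SolvesOn (σ : ℝ) (J : Set ℝ) (f₀ : ℝ → ℂ) (F : ℝ × ℝ → ℂ) : Prop :=
  ∀ t ∈ J, ∀ᵐ ξ : ℝ, timeSlice F t ξ =
    cexp2 (t * omega ξ) * f₀ ξ + σ * duhamelInt (nonlin F F F) t ξ

/-- Iterating the solution map starting from a solution does not change its values, only its
extension. -/
lemma SolvesOn.iterate (h : Admissible μ δ b β) {σ T : ℝ} {J : Set ℝ} (hJ : J.OrdConnected)
    (h0 : 0 ∈ J) (hT : 0 < T) (hT1 : T ≤ 1) (hf : AEStronglyMeasurable f₀ volume)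
    (hfin : weightedSup μ f₀ ≠ ⊤) (hF : InX μ b F) (hsol : SolvesOn σ J f₀ F)
    (hit : ∀ k, InX μ b ((solMap σ T f₀)^[k] F)) (k : ℕ) :
    ∀ t ∈ J, |t| ≤ T → ∀ᵐ ξ, timeSlice ((solMap σ T f₀)^[k] F) t ξ = timeSlice F t ξ := by
  induction k with
  | zero => exact fun t _ _ => ae_of_all _ fun ξ => rfl
  | succ k ih =>
    intro t ht htT
    have hloc := duhamelInt_nonlin_congr h (hit k) hF (t := t) fun s hs =>
      ih s (hJ.uIcc_subset h0 ht hs) (by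
        rw [← sub_zero s]
        exact (abs_sub_left_of_mem_uIcc hs).trans (by simpa using htT))
    filter_upwards [timeSlice_solMap (σ := σ) h hT hT1 hf hfin (hit k), hloc, hsol t ht]
      with ξ h1 h2 h3
    rw [Function.iterate_succ_apply', h1 t htT, h2, h3]

/-- Uniqueness on a short time interval, whose length depends only on the size of the
extensions. -/
lemma exists_unique_short (h : Admissible μ δ b β) (ρ : ℝ≥0) :
    ∃ T : ℝ, 0 < T ∧ ∀ (σ : ℝ) (J : Set ℝ) (f₀ : ℝ → ℂ) (F G : ℝ × ℝ → ℂ), ‖(σ : ℂ)‖ₑ ≤ 1 →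
      J.OrdConnected → 0 ∈ J → AEStronglyMeasurable f₀ volume → weightedSup μ f₀ ≤ ρ →
      InX μ b F → InX μ b G → bourgainNorm μ b F ≤ ρ → bourgainNorm μ b G ≤ ρ →
      SolvesOn σ J f₀ F → SolvesOn σ J f₀ G →
      ∀ t ∈ J, |t| ≤ T → ∀ᵐ ξ, timeSlice F t ξ = timeSlice G t ξ := by
  obtain ⟨C, hC⟩ := exists_contraction h
  obtain ⟨T, hT, hT1, hΦ⟩ := hC ρ
  obtain ⟨C', hC'⟩ := exists_weightedSup_timeSlice_le (μ := μ) h.half_lt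
  refine ⟨T, hT, fun σ J f₀ F G hσ hJ h0 hf hfρ hF hG hFρ hGρ hsF hsG t ht htT => ?_⟩
  have hfin : weightedSup μ f₀ ≠ ⊤ := (hfρ.trans_lt ENNReal.coe_lt_top).ne
  have hle : (ρ : ℝ≥0∞) ≤ (1 + 2 * C) * ρ := le_mul_of_one_le_left zero_le le_self_add
  have hball : ∀ {F : ℝ × ℝ → ℂ}, InX μ b F → bourgainNorm μ b F ≤ ρ → ∀ k,
      InX μ b ((solMap σ T f₀)^[k] F) ∧
        bourgainNorm μ b ((solMap σ T f₀)^[k] F) ≤ (1 + 2 * C) * ρ := by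
    intro F hF hFρ k
    induction k with
    | zero => exact ⟨hF, hFρ.trans hle⟩
    | succ k ih =>
      rw [Function.iterate_succ_apply']
      exact (hΦ σ f₀ f₀ _ _ hσ hf hf hfρ hfρ ih.1 ih.1 ih.2 ih.2).1
  have hdiff : ∀ k, bourgainNorm μ b (fun q => (solMap σ T f₀)^[k] F q -
      (solMap σ T f₀)^[k] G q) ≤ 2⁻¹ ^ k * bourgainNorm μ b (fun q => F q - G q) := by
    intro k
    induction k with
    | zero => simp
    | succ k ih =>
      rw [Function.iterate_succ_apply', Function.iterate_succ_apply']
      have h1 := (hΦ σ f₀ f₀ _ _ hσ hf hf hfρ hfρ (hball hF hFρ k).1 (hball hG hGρ k).1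
        (hball hF hFρ k).2 (hball hG hGρ k).2).2
      simp only [sub_self, weightedSup_zero, mul_zero, zero_add] at h1
      refine h1.trans ?_
      rw [pow_succ', mul_assoc]
      exact mul_le_mul_right ih _
  have hbound : ∀ k, weightedSup μ (fun ξ => timeSlice F t ξ - timeSlice G t ξ) ≤
      C' * (2⁻¹ ^ k * bourgainNorm μ b (fun q => F q - G q)) := by
    intro k
    have e1 := hsF.iterate h hJ h0 hT hT1 hf hfin hF (fun k => (hball hF hFρ k).1) k t ht htT
    have e2 := hsG.iterate h hJ h0 hT hT1 hf hfin hG (fun k => (hball hG hGρ k).1) k t ht htT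
    have e3 := timeSlice_sub h.half_lt (hball hF hFρ k).1 (hball hG hGρ k).1
    have e4 : (fun ξ => timeSlice F t ξ - timeSlice G t ξ) =ᵐ[volume]
        timeSlice (fun q => (solMap σ T f₀)^[k] F q - (solMap σ T f₀)^[k] G q) t := by
      filter_upwards [e1, e2, e3] with ξ a1 a2 a3
      rw [a3 t, a1, a2]
    rw [weightedSup_congr e4]
    exact (hC' _ ((hball hF hFρ k).1.sub (hball hG hGρ k).1).aesm t).trans
      (mul_le_mul_right (hdiff k) _)
  refine ae_eq_of_weightedSup_sub_eq_zero (μ := μ) (le_antisymm ?_ zero_le)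
  have hlim : Tendsto (fun k : ℕ => (C' : ℝ≥0∞) * (2⁻¹ ^ k *
      bourgainNorm μ b (fun q => F q - G q))) atTop (𝓝 (C' * (0 *
      bourgainNorm μ b (fun q => F q - G q)))) := by
    refine ENNReal.Tendsto.const_mul (ENNReal.Tendsto.mul_const ?_
      (Or.inr (hF.sub hG).lt_top.ne)) (Or.inr ENNReal.coe_ne_top)
    exact ENNReal.tendsto_pow_atTop_nhds_zero_of_lt_one (by
      rw [ENNReal.inv_lt_one]; exact ENNReal.one_lt_two)
  rw [zero_mul, mul_zero] at hlim
  exact ge_of_tendsto' hlim hbound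

/-- The space-time Fourier transform of the time translate `u(t₀ + ·)`. -/
def translate (t₀ : ℝ) (F : ℝ × ℝ → ℂ) (q : ℝ × ℝ) : ℂ := cexp2 (t₀ * q.1) * F q

lemma InX.translate (hF : InX μ b F) (t₀ : ℝ) :
    InX μ b (translate t₀ F) ∧ bourgainNorm μ b (MKdV.translate t₀ F) ≤ bourgainNorm μ b F := by
  obtain ⟨M, hM, hn, hfin⟩ := hF.exists_isMajorant
  have hc := continuous_cexp2
  have h1 : IsMajorant μ (MKdV.translate t₀ F) M := by
    refine ⟨AEStronglyMeasurable.mul ?_ hF.aesm, hM.meas, ?_⟩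
    · exact (by fun_prop : Continuous fun q : ℝ × ℝ => cexp2 (t₀ * q.1)).aestronglyMeasurable
    · filter_upwards [hM.le] with q hq
      rwa [MKdV.translate, enorm_mul, enorm_cexp2, one_mul]
  exact ⟨h1.inX hfin, hn ▸ bourgainNorm_le_wnorm h1⟩

lemma timeSlice_translate (t₀ t ξ : ℝ) : timeSlice (translate t₀ F) t ξ = timeSlice F (t₀ + t) ξ := by
  refine integral_congr_ae (ae_of_all _ fun τ => ?_)
  simp only [translate]
  rw [← mul_assoc, ← cexp2_add]
  congr 2; ring

lemma nonlin_translate (t₀ : ℝ) : nonlin (translate t₀ F) (translate t₀ F) (translate t₀ F) =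
    translate t₀ (nonlin F F F) := by
  ext q
  have h1 : triFourier (translate t₀ F) (translate t₀ F) (translate t₀ F) q =
      cexp2 (t₀ * q.1) * triFourier F F F q := by
    rw [triFourier, triFourier, ← integral_const_mul]
    refine integral_congr_ae (ae_of_all _ fun p => ?_)
    have : cexp2 (t₀ * q.1) = cexp2 (t₀ * p.1.1) * cexp2 (t₀ * p.2.1) *
        cexp2 (t₀ * (q - p.1 - p.2).1) := by
      rw [← cexp2_add, ← cexp2_add]; congr 1; simp only [Prod.fst_sub]; ring
    simp only [triIntegrand, translate, this]; ring
  simp only [translate, nonlin, h1]; ring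

lemma duhamelKernel_add (t₀ t τ ξ : ℝ) : duhamelKernel (t₀ + t) τ ξ =
    cexp2 (t * omega ξ) * duhamelKernel t₀ τ ξ + cexp2 (t₀ * τ) * duhamelKernel t τ ξ := by
  have hc := continuous_cexp2
  have hi : ∀ a c : ℝ, IntervalIntegrable (fun s => cexp2 (s * (τ - omega ξ))) volume a c :=
    fun a c => (by fun_prop : Continuous fun s => cexp2 (s * (τ - omega ξ))).intervalIntegrable a c
  have h1 : ∫ s in t₀..(t₀ + t), cexp2 (s * (τ - omega ξ)) =
      cexp2 (t₀ * (τ - omega ξ)) * ∫ s in (0 : ℝ)..t, cexp2 (s * (τ - omega ξ)) := by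
    have h2 := intervalIntegral.integral_comp_add_left (a := 0) (b := t)
      (fun s => cexp2 (s * (τ - omega ξ))) t₀
    rw [add_zero] at h2
    rw [← h2, ← intervalIntegral.integral_const_mul]
    refine intervalIntegral.integral_congr fun s _ => ?_
    simp only [add_mul, cexp2_add]
  rw [duhamelKernel_eq, duhamelKernel_eq, duhamelKernel_eq,
    ← intervalIntegral.integral_add_adjacent_intervals (hi 0 t₀) (hi t₀ (t₀ + t)), h1, mul_add,
    ← mul_assoc, ← mul_assoc, ← mul_assoc, ← cexp2_add, ← cexp2_add, ← cexp2_add]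
  congr 3 <;> ring_nf

lemma duhamelKernel_zero (τ ξ : ℝ) : duhamelKernel 0 τ ξ = 0 := by simp [duhamelKernel]

lemma duhamelInt_zero (G : ℝ × ℝ → ℂ) (ξ : ℝ) : duhamelInt G 0 ξ = 0 := by
  simp [duhamelInt, duhamelKernel_zero]

lemma SolvesOn.zero {σ : ℝ} {J : Set ℝ} (hF : SolvesOn σ J f₀ F) (h0 : 0 ∈ J) :
    ∀ᵐ ξ, timeSlice F 0 ξ = f₀ ξ := by
  filter_upwards [hF 0 h0] with ξ hξ
  rw [hξ, duhamelInt_zero, zero_mul, cexp2_zero]; ring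

lemma SolvesOn.congr {σ : ℝ} {J : Set ℝ} (hF : SolvesOn σ J f₀ F) (h : ∀ᵐ ξ, f₀ ξ = g₀ ξ) :
    SolvesOn σ J g₀ F := fun t ht => by
  filter_upwards [hF t ht, h] with ξ h1 h2
  rw [h1, h2]

/-- The Duhamel formula can be started at any time. -/
lemma SolvesOn.translate (h : Admissible μ δ b β) (hX : InX μ b F) {σ : ℝ} {J : Set ℝ}
    (hF : SolvesOn σ J f₀ F) {t₀ : ℝ} (ht₀ : t₀ ∈ J) :
    SolvesOn σ ((t₀ + ·) ⁻¹' J) (timeSlice F t₀) (translate t₀ F) := by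
  intro t ht
  have hX' := (hX.translate t₀).1
  have hi := ae_integrable_duhamelKernel_mul_nonlin h hX' hX' hX'
  rw [nonlin_translate] at hi
  filter_upwards [hF t₀ ht₀, hF (t₀ + t) ht, hi,
    ae_integrable_duhamelKernel_mul_nonlin h hX hX hX] with ξ h1 h2 h3 h4
  have h5 : duhamelInt (nonlin F F F) (t₀ + t) ξ =
      cexp2 (t * omega ξ) * duhamelInt (nonlin F F F) t₀ ξ +
        duhamelInt (MKdV.translate t₀ (nonlin F F F)) t ξ := by
    simp only [duhamelInt]
    rw [← integral_const_mul, ← integral_add ((h4 t₀).const_mul _) (h3 t)]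
    refine integral_congr_ae (ae_of_all _ fun τ => ?_)
    simp only [duhamelKernel_add, MKdV.translate]; ring
  rw [timeSlice_translate, h2, h1, nonlin_translate, h5, add_mul, cexp2_add]
  ring

/-- Uniqueness on time intervals of any length, by steps of fixed length. -/
theorem SolvesOn.unique (h : Admissible μ δ b β) {σ : ℝ} (hσ : ‖(σ : ℂ)‖ₑ ≤ 1) {J : Set ℝ}
    (hJ : J.OrdConnected) (h0 : 0 ∈ J) (hF : InX μ b F) (hG : InX μ b G)
    (hsF : SolvesOn σ J f₀ F) (hsG : SolvesOn σ J f₀ G) :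
    ∀ t ∈ J, ∀ᵐ ξ, timeSlice F t ξ = timeSlice G t ξ := by
  obtain ⟨C, hC⟩ := exists_weightedSup_timeSlice_le (μ := μ) h.half_lt
  obtain ⟨ρ, hρ⟩ := ENNReal.canLift.prf
    ((1 + C) * (bourgainNorm μ b F + bourgainNorm μ b G) : ℝ≥0∞)
    (ENNReal.mul_ne_top (by finiteness) (ENNReal.add_lt_top.2 ⟨hF.lt_top, hG.lt_top⟩).ne)
  have hρF : bourgainNorm μ b F ≤ ρ := by
    rw [hρ]; exact le_self_add.trans (le_mul_of_one_le_left zero_le le_self_add)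
  have hρG : bourgainNorm μ b G ≤ ρ := by
    rw [hρ]; exact le_add_self.trans (le_mul_of_one_le_left zero_le le_self_add)
  have hρt : ∀ t, weightedSup μ (timeSlice F t) ≤ ρ := fun t => by
    rw [hρ]; exact (hC F hF.aesm t).trans (mul_le_mul' le_add_self le_self_add)
  obtain ⟨T, hT, huniq⟩ := exists_unique_short h ρ
  have key : ∀ k : ℕ, ∀ t ∈ J, |t| ≤ k * T → ∀ᵐ ξ, timeSlice F t ξ = timeSlice G t ξ := by
    intro k
    induction k with
    | zero =>
      intro t _ ht
      have : t = 0 := by simpa using ht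
      rw [this]
      filter_upwards [hsF.zero h0, hsG.zero h0] with ξ h1 h2
      rw [h1, h2]
    | succ k ih =>
      intro t ht htk
      have hk : (0 : ℝ) < k + 1 := by positivity
      set t₀ : ℝ := t * (k / (k + 1)) with ht₀
      have h1 : t - t₀ = t / (k + 1) := by rw [ht₀]; field_simp; ring
      have h2 : |t₀| ≤ k * T := by
        push_cast at htk
        rw [ht₀, abs_mul, abs_of_nonneg (a := (k : ℝ) / (k + 1)) (by positivity)]
        calc |t| * (k / (k + 1)) ≤ ((k + 1) * T) * (k / (k + 1)) := by gcongr
          _ = k * T := by field_simp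
      have h3 : |t - t₀| ≤ T := by
        push_cast at htk
        rw [h1, abs_div, abs_of_pos hk, div_le_iff₀ hk]; linarith
      have h4 : t₀ ∈ J := by
        refine hJ.uIcc_subset h0 ht ?_
        have e1 : (0 : ℝ) ≤ k / (k + 1) := by positivity
        have e2 : (k : ℝ) / (k + 1) ≤ 1 := by rw [div_le_one hk]; linarith
        rw [mem_uIcc, ht₀]
        rcases le_total 0 t with e | e
        · exact Or.inl ⟨by positivity, mul_le_of_le_one_right e e2⟩
        · exact Or.inr ⟨by nlinarith, mul_nonpos_of_nonpos_of_nonneg e e1⟩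
      have hJ' : ((t₀ + ·) ⁻¹' J).OrdConnected :=
        hJ.preimage_mono fun x y hxy => add_le_add_right hxy t₀
      have h5 := huniq σ ((t₀ + ·) ⁻¹' J) (timeSlice F t₀) _ _ hσ hJ' (by simpa using h4)
        (aestronglyMeasurable_timeSlice_const hF.aesm t₀) (hρt t₀) (hF.translate t₀).1
        (hG.translate t₀).1 ((hF.translate t₀).2.trans hρF) ((hG.translate t₀).2.trans hρG)
        (hsF.translate h hF h4) ((hsG.translate h hG h4).congr ((ih t₀ h4 h2).mono fun _ => Eq.symm))
        (t - t₀) (by simpa using ht) h3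
      simpa only [timeSlice_translate, add_sub_cancel] using h5
  intro t ht
  obtain ⟨k, hk⟩ := exists_nat_ge (|t| / T)
  exact key k t ht ((div_le_iff₀ hT).1 hk)

end

/-! ### Existence -/

section

variable {μ δ b β : ℝ} {F G : ℝ × ℝ → ℂ} {f₀ g₀ : ℝ → ℂ}

lemma wnorm_tsum_le {b : ℝ} {M : ℕ → ℝ → ℝ≥0∞} (hM : ∀ k, Measurable (M k)) :
    wnorm b (fun τ => ∑' k, M k τ) ≤ ∑' k, wnorm b (M k) := by
  have hfin : ∀ n, wnorm b (fun τ => ∑ k ∈ Finset.range n, M k τ) ≤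
      ∑ k ∈ Finset.range n, wnorm b (M k) := by
    intro n
    induction n with
    | zero => simp [wnorm]
    | succ n ih =>
      simp only [Finset.sum_range_succ]
      exact (wnorm_add_le (Finset.measurable_sum _ fun k _ => hM k) (hM n)).trans
        (add_le_add_left ih _)
  refine eLpNorm_two_le ?_
  have hlim : Tendsto (fun n => ∫⁻ τ, (jb τ ^ b * ∑ k ∈ Finset.range n, M k τ) ^ 2) atTop
      (𝓝 (∫⁻ τ, (jb τ ^ b * ∑' k, M k τ) ^ 2)) := by
    refine lintegral_tendsto_of_tendsto_of_monotone (fun n => ?_) (ae_of_all _ fun τ n m hnm => ?_)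
      (ae_of_all _ fun τ => ?_)
    · have := Finset.measurable_sum (Finset.range n) fun k _ => hM k
      have h2 : Measurable fun τ => ∑ k ∈ Finset.range n, M k τ := by
        simpa only [Finset.sum_apply] using this
      fun_prop
    · dsimp only
      gcongr
    · exact ((ENNReal.continuous_pow 2).tendsto _).comp
        (ENNReal.Tendsto.const_mul (ENNReal.tendsto_nat_tsum _) (Or.inr (jb_rpow_ne_top _ _)))
  refine le_of_tendsto' hlim fun n => ?_
  rw [← eLpNorm_two_sq]
  gcongr
  exact (hfin n).trans (ENNReal.sum_le_tsum _)

/-- The Bourgain space is complete, in the form needed for the Picard iteration. -/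
lemma exists_limit {F : ℕ → ℝ × ℝ → ℂ} {D : ℝ≥0∞} (hD : D ≠ ⊤) (hF : ∀ k, InX μ b (F k))
    (hdiff : ∀ k, bourgainNorm μ b (fun q => F (k + 1) q - F k q) ≤ 2⁻¹ ^ k * D) :
    ∃ G, AEStronglyMeasurable G volume ∧
      ∀ n, bourgainNorm μ b (fun q => G q - F n q) ≤ 2⁻¹ ^ n * (2 * D) := by
  choose M hM hMn hMf using fun k => ((hF (k + 1)).sub (hF k)).exists_isMajorant
  have hS : ∀ n, wnorm b (fun τ => ∑' k, M (n + k) τ) ≤ 2⁻¹ ^ n * (2 * D) := by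
    intro n
    refine (wnorm_tsum_le fun k => (hM (n + k)).meas).trans ?_
    calc ∑' k, wnorm b (M (n + k)) ≤ ∑' k : ℕ, 2⁻¹ ^ n * D * 2⁻¹ ^ k := by
          refine ENNReal.tsum_le_tsum fun k => ?_
          rw [hMn]
          refine (hdiff (n + k)).trans (le_of_eq ?_)
          rw [pow_add]; ring
      _ = 2⁻¹ ^ n * (2 * D) := by
          rw [ENNReal.tsum_mul_left, ENNReal.tsum_geometric, ENNReal.one_sub_inv_two, inv_inv]
          ring
  have hSm : ∀ n, Measurable fun τ => ∑' k, M (n + k) τ := fun n =>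
    Measurable.tsum fun k => (hM (n + k)).meas
  have hfin : ∀ᵐ x, ∑' k, M (0 + k) x < ⊤ := ae_lt_top_of_wnorm_lt_top (hSm 0)
    ((hS 0).trans_lt (by simpa using ENNReal.mul_lt_top (by simp) hD.lt_top))
  have hae : ∀ᵐ q : ℝ × ℝ, ∀ n, HasSum (fun k => F (n + k + 1) q - F (n + k) q)
      ((F 0 q + ∑' k, (F (k + 1) q - F k q)) - F n q) ∧
      ‖(F 0 q + ∑' k, (F (k + 1) q - F k q)) - F n q‖ₑ ≤
        jb q.2 ^ (-μ) * ∑' k, M (n + k) (q.1 - omega q.2) := by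
    filter_upwards [quasiMeasurePreserving_modulation.ae hfin, ae_all_iff.2 fun k => (hM k).le]
      with q h1 h2
    have hsum : Summable fun k => F (k + 1) q - F k q := by
      refine Summable.of_enorm ?_
      refine ne_top_of_le_ne_top ?_ (ENNReal.tsum_le_tsum fun k => h2 k)
      rw [ENNReal.tsum_mul_left]
      simp only [zero_add] at h1
      exact ENNReal.mul_ne_top (jb_rpow_ne_top _ _) h1.ne
    intro n
    have h3 := (hasSum_nat_add_iff' n).2 hsum.hasSum
    rw [Finset.sum_range_sub (fun k => F k q)] at h3
    have h4 : HasSum (fun k => F (n + k + 1) q - F (n + k) q)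
        ((F 0 q + ∑' k, (F (k + 1) q - F k q)) - F n q) := by
      have e : ∀ k, n + k = k + n := add_comm n
      simp only [e]
      have e' : F 0 q + ∑' k, (F (k + 1) q - F k q) - F n q =
          ∑' k, (F (k + 1) q - F k q) - (F n q - F 0 q) := by ring
      rw [e']
      exact h3
    refine ⟨h4, ?_⟩
    rw [← h4.tsum_eq, ← ENNReal.tsum_mul_left]
    exact enorm_tsum_le_tsum_enorm.trans (ENNReal.tsum_le_tsum fun k => h2 (n + k))
  have hmeas : AEStronglyMeasurable (fun q => F 0 q + ∑' k, (F (k + 1) q - F k q)) volume := by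
    refine aestronglyMeasurable_of_tendsto_ae atTop (f := F) (fun n => (hF n).aesm) ?_
    filter_upwards [hae] with q hq
    have h1 := (hq 0).1.tendsto_sum_nat
    simp only [zero_add] at h1
    simp only [Finset.sum_range_sub (fun k => F k q)] at h1
    simpa [add_comm] using h1.add_const (F 0 q)
  refine ⟨_, hmeas, fun n => ?_⟩
  refine (bourgainNorm_le_wnorm (M := fun τ => ∑' k, M (n + k) τ) ⟨hmeas.sub (hF n).aesm, hSm n,
    ?_⟩).trans (hS n)
  filter_upwards [hae] with q hq
  exact (hq n).2

lemma ae_eq_of_bourgainNorm_sub_eq_zero (hF : AEStronglyMeasurable F volume)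
    (hG : AEStronglyMeasurable G volume) (h : bourgainNorm μ b (fun q => F q - G q) = 0) :
    F =ᵐ[volume] G := by
  obtain ⟨M, hM, hn⟩ := exists_isMajorant (hF.sub hG) μ
  have hM0 : ∀ᵐ x, M x = 0 := by
    have h1 : wnorm b M = 0 := (hn b).trans h
    have hm : Measurable fun τ => jb τ ^ b * M τ := by have := hM.meas; fun_prop
    rw [wnorm, eLpNorm_eq_zero_iff hm.aestronglyMeasurable (by simp)] at h1
    filter_upwards [h1] with x hx
    exact (mul_eq_zero.1 hx).resolve_left (jb_rpow_ne_zero _ _)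
  filter_upwards [hM.le, quasiMeasurePreserving_modulation.ae hM0] with q h1 h2
  rw [h2, mul_zero, nonpos_iff_eq_zero, enorm_eq_zero] at h1
  exact sub_eq_zero.1 h1

/-- The solution map has a fixed point, the limit of the Picard iteration. -/
lemma exists_fixedPoint (h : Admissible μ δ b β) {ρ : ℝ≥0} {σ T : ℝ}
    (hf : AEStronglyMeasurable f₀ volume)
    (hΦ : ∀ F G : ℝ × ℝ → ℂ, InX μ b F → InX μ b G → bourgainNorm μ b F ≤ ρ →
      bourgainNorm μ b G ≤ ρ → (InX μ b (solMap σ T f₀ F) ∧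
        bourgainNorm μ b (solMap σ T f₀ F) ≤ ρ) ∧
        bourgainNorm μ b (fun q => solMap σ T f₀ F q - solMap σ T f₀ G q) ≤
          2⁻¹ * bourgainNorm μ b (fun q => F q - G q)) :
    ∃ F, InX μ b F ∧ bourgainNorm μ b F ≤ ρ ∧ F =ᵐ[volume] solMap σ T f₀ F := by
  set P : ℕ → ℝ × ℝ → ℂ := fun k => (solMap σ T f₀)^[k] (fun _ => 0) with hP
  have hsucc : ∀ k, P (k + 1) = solMap σ T f₀ (P k) := fun k => Function.iterate_succ_apply' _ _ _
  have hball : ∀ k, InX μ b (P k) ∧ bourgainNorm μ b (P k) ≤ ρ := by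
    intro k
    induction k with
    | zero => exact ⟨InX.zero, by simp [hP, bourgainNorm_zero]⟩
    | succ k ih => rw [hsucc]; exact (hΦ _ _ ih.1 ih.1 ih.2 ih.2).1
  have hdiff : ∀ k, bourgainNorm μ b (fun q => P (k + 1) q - P k q) ≤ 2⁻¹ ^ k * ρ := by
    intro k
    induction k with
    | zero => simpa [hP] using (hball 1).2
    | succ k ih =>
      have h1 := (hΦ _ _ (hball (k + 1)).1 (hball k).1 (hball (k + 1)).2 (hball k).2).2
      rw [← hsucc, ← hsucc] at h1
      refine h1.trans ?_
      rw [pow_succ', mul_assoc]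
      exact mul_le_mul_right ih _
  obtain ⟨F, hFm, hlim⟩ := exists_limit ENNReal.coe_ne_top (fun k => (hball k).1) hdiff
  have hpow : ∀ c : ℝ≥0∞, c ≠ ⊤ → Tendsto (fun n : ℕ => 2⁻¹ ^ n * c) atTop (𝓝 0) := by
    intro c hc
    rw [← zero_mul c]
    refine ENNReal.Tendsto.mul_const ?_ (Or.inr hc)
    exact ENNReal.tendsto_pow_atTop_nhds_zero_of_lt_one (by
      rw [ENNReal.inv_lt_one]; exact ENNReal.one_lt_two)
  have hFρ : bourgainNorm μ b F ≤ ρ := by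
    have h1 : Tendsto (fun n : ℕ => 2⁻¹ ^ n * (2 * (ρ : ℝ≥0∞)) + ρ) atTop (𝓝 (0 + ρ)) :=
      (hpow _ (by finiteness)).add_const _
    rw [zero_add] at h1
    refine ge_of_tendsto' h1 fun n => ?_
    have h2 := bourgainNorm_add_le (μ := μ) (b := b) (hFm.sub (hball n).1.aesm) (hball n).1.aesm
    simp only [Pi.sub_apply, sub_add_cancel] at h2
    exact h2.trans (add_le_add (hlim n) (hball n).2)
  have hF : InX μ b F := ⟨hFm, hFρ.trans_lt ENNReal.coe_lt_top⟩
  have hΦm := aestronglyMeasurable_solMap h σ T hf hF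
  refine ⟨F, hF, hFρ, ae_eq_of_bourgainNorm_sub_eq_zero (μ := μ) (b := b) hFm hΦm
    (le_antisymm ?_ zero_le)⟩
  refine ge_of_tendsto' (hpow (2 * ρ + 2 * ρ) (by finiteness)) fun n => ?_
  have h1 := bourgainNorm_sub_le (μ := μ) (b := b) (hFm.sub (hball (n + 1)).1.aesm)
    (hΦm.sub (hball (n + 1)).1.aesm)
  simp only [Pi.sub_apply, sub_sub_sub_cancel_right] at h1
  refine h1.trans ?_
  rw [mul_add]
  refine add_le_add ((hlim (n + 1)).trans ?_) ?_
  · gcongr ?_ * _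
    exact pow_le_pow_right_of_le_one' (by simp) (Nat.le_succ n)
  · rw [hsucc]
    refine ((hΦ F (P n) hF (hball n).1 hFρ (hball n).2).2).trans ?_
    refine (mul_le_of_le_one_left zero_le (by simp)).trans (hlim n)

/-- Well-posedness at the level of space-time Fourier transforms of extensions. -/
theorem exists_solution_operator (h : Admissible μ δ b β) :
    ∃ C : ℝ≥0, ∀ ρ : ℝ≥0, ∃ T : ℝ, 0 < T ∧ ∀ σ : ℝ, ‖(σ : ℂ)‖ₑ ≤ 1 →
      ∃ S : (ℝ → ℂ) → ℝ × ℝ → ℂ,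
        (∀ f₀, AEStronglyMeasurable f₀ volume → weightedSup μ f₀ ≤ ρ →
          InX μ b (S f₀) ∧ SolvesOn σ (Icc (-T) T) f₀ (S f₀)) ∧
        ∀ f₀ g₀, AEStronglyMeasurable f₀ volume → AEStronglyMeasurable g₀ volume →
          weightedSup μ f₀ ≤ ρ → weightedSup μ g₀ ≤ ρ →
          bourgainNorm μ b (fun q => S f₀ q - S g₀ q) ≤
            C * weightedSup μ (fun ξ => f₀ ξ - g₀ ξ) := by
  obtain ⟨C, hC⟩ := exists_contraction h
  refine ⟨2 * C, fun ρ => ?_⟩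
  obtain ⟨T, hT, hT1, hΦ⟩ := hC ρ
  refine ⟨T, hT, fun σ hσ => ?_⟩
  have hex : ∀ f₀ : ℝ → ℂ, ∃ F, AEStronglyMeasurable f₀ volume → weightedSup μ f₀ ≤ ρ →
      InX μ b F ∧ bourgainNorm μ b F ≤ (1 + 2 * C) * ρ ∧ F =ᵐ[volume] solMap σ T f₀ F := by
    intro f₀
    by_cases hf : AEStronglyMeasurable f₀ volume ∧ weightedSup μ f₀ ≤ ρ
    · obtain ⟨F, hF⟩ := exists_fixedPoint (ρ := (1 + 2 * C) * ρ) (σ := σ) (T := T) h hf.1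
        (fun F G hF hG hFr hGr => by
          have h1 := hΦ σ f₀ f₀ F G hσ hf.1 hf.1 hf.2 hf.2 hF hG (by simpa using hFr)
            (by simpa using hGr)
          simp only [sub_self, weightedSup_zero, mul_zero, zero_add] at h1
          simpa using h1)
      exact ⟨F, fun _ _ => by simpa using hF⟩
    · exact ⟨0, fun h1 h2 => absurd ⟨h1, h2⟩ hf⟩
  choose S hS using hex
  refine ⟨S, fun f₀ hf hfρ => ?_, fun f₀ g₀ hf hg hfρ hgρ => ?_⟩
  · obtain ⟨h1, h2, h3⟩ := hS f₀ hf hfρ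
    refine ⟨h1, fun t ht => ?_⟩
    filter_upwards [timeSlice_congr h3, timeSlice_solMap (σ := σ) h hT hT1 hf
      (hfρ.trans_lt ENNReal.coe_lt_top).ne h1] with ξ h4 h5
    rw [h4, h5 t (abs_le.2 ht)]
  · obtain ⟨h1, h2, h3⟩ := hS f₀ hf hfρ
    obtain ⟨k1, k2, k3⟩ := hS g₀ hg hgρ
    have h4 := (hΦ σ f₀ g₀ _ _ hσ hf hg hfρ hgρ h1 k1 h2 k2).2
    set d := bourgainNorm μ b (fun q => S f₀ q - S g₀ q) with hd
    have hdfin : d ≠ ⊤ := (h1.sub k1).lt_top.ne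
    have h5 : d ≤ C * weightedSup μ (fun ξ => f₀ ξ - g₀ ξ) + 2⁻¹ * d := by
      refine le_trans (bourgainNorm_congr ?_ ((aestronglyMeasurable_solMap h σ T hf h1).sub
        (aestronglyMeasurable_solMap h σ T hg k1))) h4
      filter_upwards [h3, k3] with q a1 a2
      simp only [Pi.sub_apply]
      rw [← a1, ← a2]
    have h6 : 2⁻¹ * d + 2⁻¹ * d ≤ C * weightedSup μ (fun ξ => f₀ ξ - g₀ ξ) + 2⁻¹ * d := by
      rw [← add_mul, ENNReal.inv_two_add_inv_two, one_mul]; exact h5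
    have h7 := (ENNReal.add_le_add_iff_right (by finiteness)).1 h6
    calc d = 2 * (2⁻¹ * d) := by
          rw [← mul_assoc, ENNReal.mul_inv_cancel (by simp) (by simp), one_mul]
      _ ≤ 2 * (C * weightedSup μ (fun ξ => f₀ ξ - g₀ ξ)) := by gcongr
      _ = _ := by push_cast; ring

end

/-! ### Tempered distributions whose Fourier transform is a function -/

section

variable {μ : ℝ} {u v : 𝓢'(ℝ, ℂ)} {f g : ℝ → ℂ}

lemma HasFourier.congr (h : HasFourier u f) (hfg : f =ᵐ[volume] g) : HasFourier u g := by
  refine ⟨h.1.congr hfg, fun φ => ?_⟩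
  have h1 : (fun ξ => f ξ * φ ξ) =ᵐ[volume] fun ξ => g ξ * φ ξ := by
    filter_upwards [hfg] with ξ hξ
    rw [hξ]
  exact ⟨(h.2 φ).1.congr h1, (h.2 φ).2.trans (integral_congr_ae h1)⟩

lemma HasFourier.sub (hu : HasFourier u f) (hv : HasFourier v g) :
    HasFourier (u - v) (fun ξ => f ξ - g ξ) := by
  refine ⟨hu.1.sub hv.1, fun φ => ?_⟩
  simp only [sub_mul]
  refine ⟨(hu.2 φ).1.sub (hv.2 φ).1, ?_⟩
  rw [integral_sub (hu.2 φ).1 (hv.2 φ).1, ← (hu.2 φ).2, ← (hv.2 φ).2]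
  simp [TemperedDistribution.fourier_apply]

lemma HasFourier.apply (hu : HasFourier u f) (φ : 𝓢(ℝ, ℂ)) : u φ = ∫ ξ, f ξ * (𝓕⁻ φ) ξ := by
  rw [← (hu.2 (𝓕⁻ φ)).2, TemperedDistribution.fourier_apply]
  simp

lemma HasFourier.ext (hu : HasFourier u f) (hv : HasFourier v f) : u = v := by
  ext φ
  rw [hu.apply, hv.apply]

/-- The Fourier transform of a tempered distribution is at most one function. -/
lemma HasFourier.unique (hf : HasFourier u f) (hg : HasFourier u g) : f =ᵐ[volume] g := by
  have key : ∀ n : ℕ, ∀ᵐ ξ : ℝ, |ξ| ≤ n → f ξ = g ξ := by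
    intro n
    set χ : ContDiffBump (0 : ℝ) := ⟨n + 1, n + 2, by positivity, by linarith⟩ with hχ
    have hsch : ∀ {w : ℝ → ℝ}, ContDiff ℝ (⊤ : ℕ∞) w → HasCompactSupport w →
        ∃ φ : 𝓢(ℝ, ℂ), ∀ x, φ x = (w x : ℂ) := fun {w} hw hc =>
      ⟨HasCompactSupport.toSchwartzMap (f := Complex.ofRealCLM ∘ w) (hc.comp_left rfl)
        (Complex.ofRealCLM.contDiff.comp hw), fun x => rfl⟩
    obtain ⟨φ, hφ⟩ := hsch χ.contDiff χ.hasCompactSupport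
    have h1 := ae_eq_zero_of_integral_contDiff_smul_eq_zero (μ := volume)
      (f := fun ξ => f ξ * φ ξ - g ξ * φ ξ)
      ((hf.2 φ).1.sub (hg.2 φ).1).locallyIntegrable (fun w hw hc => by
        obtain ⟨ψ, hψ⟩ := hsch (w := fun x => w x * χ x) (hw.mul χ.contDiff) hc.mul_right
        have e : ∀ ξ, w ξ • (f ξ * φ ξ - g ξ * φ ξ) = f ξ * ψ ξ - g ξ * ψ ξ := fun ξ => by
          rw [hφ, hψ, Complex.real_smul]; push_cast; ring
        simp_rw [e]
        rw [integral_sub (hf.2 ψ).1 (hg.2 ψ).1, ← (hf.2 ψ).2, ← (hg.2 ψ).2, sub_self])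
    filter_upwards [h1] with ξ hξ hn
    have h2 : φ ξ = 1 := by
      rw [hφ, χ.one_of_mem_closedBall]
      · simp
      · simp only [mem_closedBall_zero_iff, Real.norm_eq_abs, hχ]; linarith
    rw [h2, mul_one, mul_one] at hξ
    exact sub_eq_zero.1 hξ
  filter_upwards [ae_all_iff.2 key] with ξ hξ
  obtain ⟨n, hn⟩ := exists_nat_ge |ξ|
  exact hξ n hn

lemma normFL_eq (hf : HasFourier u f) : normFL μ u = weightedSup μ f :=
  le_antisymm (iInf₂_le f hf) (le_iInf₂ fun _ hg => (weightedSup_congr (hf.unique hg)).le)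

lemma exists_hasFourier_of_normFL_lt_top (h : normFL μ u < ⊤) : ∃ f, HasFourier u f := by
  obtain ⟨f, hf⟩ := iInf_lt_iff.1 h
  obtain ⟨hf, -⟩ := iInf_lt_iff.1 hf
  exact ⟨f, hf⟩

lemma ae_le_of_weightedSup (hμ : 0 ≤ μ) : ∀ᵐ ξ, ‖f ξ‖ₑ ≤ weightedSup μ f := by
  filter_upwards [ae_le_weightedSup μ f] with ξ hξ
  refine hξ.trans (mul_le_of_le_one_left zero_le ?_)
  simpa using jb_rpow_mono (neg_nonpos.2 hμ) ξ

/-- Every function in the weighted space is the Fourier transform of a tempered distribution. -/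
lemma exists_hasFourier (hμ : 0 ≤ μ) (hf : AEStronglyMeasurable f volume)
    (hfin : weightedSup μ f < ⊤) : ∃ u, HasFourier u f := by
  have hmem : MemLp f ⊤ volume := by
    refine ⟨hf, ?_⟩
    rw [eLpNorm_exponent_top]
    exact (eLpNormEssSup_le_of_ae_enorm_bound (ae_le_of_weightedSup hμ)).trans_lt hfin
  refine ⟨𝓕⁻ (Lp.toTemperedDistribution hmem.toLp), hf, fun φ => ?_⟩
  have hi : Integrable (fun ξ => f ξ * φ ξ) volume :=
    (φ.integrable (μ := volume)).essSup_smul hf hmem.2.ne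
  refine ⟨hi, ?_⟩
  rw [FourierTransform.fourier_fourierInv_eq, Lp.toTemperedDistribution_apply]
  refine integral_congr_ae ?_
  filter_upwards [hmem.coeFn_toLp] with ξ hξ
  rw [hξ, smul_eq_mul, mul_comm]

/-! ### Real-valued distributions -/

/-- The reflection `conj ψ(-x)` of a Schwartz function. -/
def schwartzSharp (ψ : 𝓢(ℝ, ℂ)) : 𝓢(ℝ, ℂ) :=
  SchwartzMap.postcompCLM (𝕜 := ℝ) (Complex.conjCLE : ℂ →L[ℝ] ℂ)
    (SchwartzMap.compCLMOfContinuousLinearEquiv ℝ (ContinuousLinearEquiv.neg ℝ : ℝ ≃L[ℝ] ℝ) ψ)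

lemma schwartzSharp_apply (ψ : 𝓢(ℝ, ℂ)) (x : ℝ) :
    schwartzSharp ψ x = (starRingEnd ℂ) (ψ (-x)) := rfl

/-- The pointwise complex conjugate of a Schwartz function. -/
def schwartzConj (ψ : 𝓢(ℝ, ℂ)) : 𝓢(ℝ, ℂ) :=
  SchwartzMap.postcompCLM (𝕜 := ℝ) (Complex.conjCLE : ℂ →L[ℝ] ℂ) ψ

lemma schwartzConj_apply (ψ : 𝓢(ℝ, ℂ)) (x : ℝ) :
    schwartzConj ψ x = (starRingEnd ℂ) (ψ x) := rfl

lemma fourier_schwartzSharp (ψ : 𝓢(ℝ, ℂ)) : 𝓕 (schwartzSharp ψ) = schwartzConj (𝓕 ψ) := by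
  ext x
  rw [schwartzConj_apply, SchwartzMap.fourier_coe, SchwartzMap.fourier_coe, Real.fourier_eq',
    Real.fourier_eq', ← integral_conj, ← integral_neg_eq_self]
  refine integral_congr_ae (ae_of_all _ fun y => ?_)
  simp only [schwartzSharp_apply, neg_neg, smul_eq_mul, map_mul, ← Complex.exp_conj,
    Complex.conj_I, Complex.conj_ofReal, RCLike.inner_apply, conj_trivial]
  congr 2
  push_cast; ring

lemma fourierInv_schwartzConj (ψ : 𝓢(ℝ, ℂ)) : 𝓕⁻ (schwartzConj ψ) = schwartzSharp (𝓕⁻ ψ) := by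
  have h : schwartzConj ψ = 𝓕 (schwartzSharp (𝓕⁻ ψ)) := by
    rw [fourier_schwartzSharp]; simp
  rw [h]; simp

lemma IsReal.conj_apply (hu : IsReal u) (φ : 𝓢(ℝ, ℂ)) :
    (starRingEnd ℂ) (u (schwartzConj φ)) = u φ := by
  have h1 : (u ((1 / 2 : ℂ) • (φ + schwartzConj φ))).im = 0 := hu _ fun x => by
    simp [schwartzConj_apply]
  have h2 : (u ((-Complex.I / 2 : ℂ) • (φ - schwartzConj φ))).im = 0 := hu _ fun x => by
    simp [schwartzConj_apply]
  simp only [map_smul, map_add, map_sub, smul_eq_mul] at h1 h2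
  generalize u φ = z at *
  generalize u (schwartzConj φ) = w at *
  simp at h1 h2
  apply Complex.ext <;> simp <;> linarith

lemma hasFourier_sharp_of_isReal (hu : IsReal u) (hf : HasFourier u f) :
    HasFourier u (fun ξ => (starRingEnd ℂ) (f (-ξ))) := by
  refine ⟨Complex.continuous_conj.comp_aestronglyMeasurable
    (hf.1.comp_measurePreserving (Measure.measurePreserving_neg volume)), fun φ => ?_⟩
  have h1 := hf.2 (schwartzSharp φ)
  have e : (fun ξ => (starRingEnd ℂ) (f (-ξ)) * φ ξ) =
      fun ξ => (starRingEnd ℂ) ((fun η => f η * schwartzSharp φ η) (-ξ)) := by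
    ext ξ; simp [schwartzSharp_apply]
  rw [e]
  refine ⟨(Complex.conjCLE : ℂ →L[ℝ] ℂ).integrable_comp h1.1.comp_neg, ?_⟩
  rw [integral_conj, integral_neg_eq_self (fun η => f η * schwartzSharp φ η), ← h1.2,
    TemperedDistribution.fourier_apply, TemperedDistribution.fourier_apply, fourier_schwartzSharp,
    hu.conj_apply]

/-- A distribution with Hermitian Fourier transform is real-valued. -/
lemma isReal_of_hasFourier (hf : HasFourier u f)
    (h : ∀ᵐ ξ, (starRingEnd ℂ) (f (-ξ)) = f ξ) : IsReal u := by
  intro φ hφ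
  have h1 : schwartzSharp (𝓕⁻ φ) = 𝓕⁻ φ := by
    rw [← fourierInv_schwartzConj]
    congr 1
    ext x
    rw [schwartzConj_apply, Complex.conj_eq_iff_im, hφ]
  rw [← Complex.conj_eq_iff_im, hf.apply, ← integral_conj, ← integral_neg_eq_self]
  refine integral_congr_ae ?_
  filter_upwards [h] with ξ hξ
  rw [map_mul, hξ, ← schwartzSharp_apply, h1]

end

/-! ### Solutions with real data are real -/

section

variable {μ δ b β : ℝ} {F G : ℝ × ℝ → ℂ} {f₀ g₀ : ℝ → ℂ}

/-- The space-time Fourier transform of the complex conjugate. -/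
def sharp (F : ℝ × ℝ → ℂ) (q : ℝ × ℝ) : ℂ := (starRingEnd ℂ) (F (-q))

lemma omega_neg (ξ : ℝ) : omega (-ξ) = -omega ξ := by simp only [omega]; ring

lemma InX.sharp (hF : InX μ b F) : InX μ b (sharp F) := by
  obtain ⟨M, hM, -, hfin⟩ := hF.exists_isMajorant
  have hneg : MeasurePreserving (Neg.neg : ℝ × ℝ → ℝ × ℝ) volume volume :=
    Measure.measurePreserving_neg volume
  have h1 : IsMajorant μ (MKdV.sharp F) (fun τ => M (-τ)) := by
    refine ⟨Complex.continuous_conj.comp_aestronglyMeasurable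
      (hF.aesm.comp_measurePreserving hneg), hM.meas.comp measurable_neg, ?_⟩
    filter_upwards [hneg.quasiMeasurePreserving.ae hM.le] with q hq
    rw [MKdV.sharp, RCLike.enorm_conj]
    simpa [jb_neg, omega_neg, neg_sub, sub_eq_add_neg, add_comm] using hq
  refine h1.inX (lt_of_le_of_lt (le_of_eq ?_) hfin)
  have hm := hM.meas
  have h2 := eLpNorm_comp_measurePreserving (p := 2) (g := fun τ => jb τ ^ b * M τ)
    (by fun_prop : Measurable fun τ => jb τ ^ b * M τ).aestronglyMeasurable
    (Measure.measurePreserving_neg (volume : Measure ℝ))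
  rw [wnorm, wnorm, ← h2]
  congr 1
  ext τ
  simp [jb_neg]

lemma timeSlice_sharp (t ξ : ℝ) :
    timeSlice (sharp F) t ξ = (starRingEnd ℂ) (timeSlice F t (-ξ)) := by
  rw [timeSlice, timeSlice, ← integral_conj, ← integral_neg_eq_self]
  refine integral_congr_ae (ae_of_all _ fun τ => ?_)
  simp only [sharp, map_mul, conj_cexp2, Prod.neg_mk, neg_neg, mul_neg]

lemma nonlin_sharp (F : ℝ × ℝ → ℂ) :
    nonlin (sharp F) (sharp F) (sharp F) = sharp (nonlin F F F) := by
  ext q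
  have h1 : triFourier (sharp F) (sharp F) (sharp F) q =
      (starRingEnd ℂ) (triFourier F F F (-q)) := by
    have : (volume : Measure ((ℝ × ℝ) × (ℝ × ℝ))).IsAddHaarMeasure :=
      inferInstanceAs ((volume : Measure (ℝ × ℝ)).prod volume).IsAddHaarMeasure
    rw [triFourier, triFourier, ← integral_conj, ← integral_neg_eq_self]
    refine integral_congr_ae (ae_of_all _ fun p => ?_)
    simp only [triIntegrand, sharp, map_mul, Prod.fst_neg, Prod.snd_neg, neg_neg]
    congr 3
    abel
  rw [nonlin, h1, sharp, nonlin]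
  simp only [map_mul, map_ofNat, Complex.conj_ofReal, Complex.conj_I, Prod.snd_neg]
  push_cast
  ring

lemma duhamelKernel_neg (t τ ξ : ℝ) :
    duhamelKernel t (-τ) (-ξ) = (starRingEnd ℂ) (duhamelKernel t τ ξ) := by
  have hc := continuous_cexp2
  have h := (Complex.conjCLE : ℂ →L[ℝ] ℂ).intervalIntegral_comp_comm (μ := volume) (a := 0) (b := t)
    (f := fun s => cexp2 ((t - s) * omega ξ) * cexp2 (s * τ))
    ((by fun_prop : Continuous fun s =>
      cexp2 ((t - s) * omega ξ) * cexp2 (s * τ)).intervalIntegrable _ _)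
  refine Eq.trans ?_ h
  refine intervalIntegral.integral_congr fun s _ => ?_
  simp [omega_neg, conj_cexp2]

lemma duhamelInt_sharp (t ξ : ℝ) :
    duhamelInt (sharp G) t ξ = (starRingEnd ℂ) (duhamelInt G t (-ξ)) := by
  rw [duhamelInt, duhamelInt, ← integral_conj, ← integral_neg_eq_self]
  refine integral_congr_ae (ae_of_all _ fun τ => ?_)
  have h := duhamelKernel_neg t τ (-ξ)
  rw [neg_neg] at h
  simp only [sharp, map_mul, Prod.neg_mk, neg_neg, h]

lemma SolvesOn.sharp {σ : ℝ} {J : Set ℝ} (hF : SolvesOn σ J f₀ F) :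
    SolvesOn σ J (fun ξ => (starRingEnd ℂ) (f₀ (-ξ))) (sharp F) := by
  intro t ht
  filter_upwards [(Measure.measurePreserving_neg (volume : Measure ℝ)).quasiMeasurePreserving.ae
    (hF t ht)] with ξ hξ
  rw [timeSlice_sharp, hξ, nonlin_sharp, duhamelInt_sharp]
  simp [omega_neg, conj_cexp2]

/-- By uniqueness, a solution with Hermitian datum is Hermitian. -/
lemma SolvesOn.hermitian (h : Admissible μ δ b β) {σ : ℝ} (hσ : ‖(σ : ℂ)‖ₑ ≤ 1) {J : Set ℝ}
    (hJ : J.OrdConnected) (h0 : 0 ∈ J) (hF : InX μ b F) (hsF : SolvesOn σ J f₀ F)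
    (hf : ∀ᵐ ξ, (starRingEnd ℂ) (f₀ (-ξ)) = f₀ ξ) :
    ∀ t ∈ J, ∀ᵐ ξ, (starRingEnd ℂ) (timeSlice F t (-ξ)) = timeSlice F t ξ := by
  intro t ht
  have h1 := (hsF.sharp.congr hf).unique h hσ hJ h0 hF.sharp hF hsF t ht
  simpa only [timeSlice_sharp] using h1

/-! ### From extensions to solutions -/

/-- An element of the Bourgain space is a continuous curve of tempered distributions. -/
lemma InX.exists_curve (hμ : 0 ≤ μ) (hb : 1 / 2 < b) (hF : InX μ b F) :
    ∃ u : ℝ → 𝓢'(ℝ, ℂ), (∀ t, HasFourier (u t) (timeSlice F t)) ∧ Continuous u := by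
  obtain ⟨C, hC⟩ := exists_weightedSup_timeSlice_le (μ := μ) hb
  have hle := hC F hF.aesm
  have hfin : (C : ℝ≥0∞) * bourgainNorm μ b F < ⊤ :=
    ENNReal.mul_lt_top ENNReal.coe_lt_top hF.lt_top
  choose u hu using fun t => exists_hasFourier hμ
    (aestronglyMeasurable_timeSlice_const hF.aesm t) ((hle t).trans_lt hfin)
  refine ⟨u, hu, PointwiseConvergenceCLM.continuous_of_continuous_eval fun φ => ?_⟩
  have hu' : (fun t => u t φ) = fun t => ∫ ξ, timeSlice F t ξ * (𝓕⁻ φ) ξ :=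
    funext fun t => (hu t).apply φ
  rw [hu']
  refine continuous_of_dominated (bound := fun ξ =>
    ((C : ℝ≥0∞) * bourgainNorm μ b F).toReal * ‖(𝓕⁻ φ) ξ‖) (fun t => ?_) (fun t => ?_) ?_ ?_
  · exact (aestronglyMeasurable_timeSlice_const hF.aesm t).mul
      (𝓕⁻ φ).continuous.aestronglyMeasurable
  · filter_upwards [ae_le_of_weightedSup (f := timeSlice F t) hμ] with ξ hξ
    rw [norm_mul]
    gcongr
    rw [← toReal_enorm]
    exact ENNReal.toReal_mono hfin.ne (hξ.trans (hle t))
  · exact ((𝓕⁻ φ).integrable (μ := volume)).norm.const_mul _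
  · filter_upwards [hF.ae_integrable hb] with ξ hξ
    refine Continuous.mul ?_ continuous_const
    have hc := continuous_cexp2
    refine continuous_of_dominated (bound := fun τ => ‖F (τ, ξ)‖)
      (fun t => (integrable_cexp2_mul hξ t).1) (fun t => ae_of_all _ fun τ => ?_) hξ.norm
      (ae_of_all _ fun τ => by fun_prop)
    rw [norm_mul, norm_cexp2, one_mul]

/-- The profile of an element of the Bourgain space is continuous in norm. -/
lemma InX.profileContinuousOn (hb : 1 / 2 < b) (hF : InX μ b F) {u : ℝ → 𝓢'(ℝ, ℂ)}
    (hu : ∀ t, HasFourier (u t) (timeSlice F t)) (T : ℝ) : ProfileContinuousOn μ T u := by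
  obtain ⟨C, hC⟩ := exists_weightedSup_timeSlice_le (μ := μ) hb
  obtain ⟨C', hC'⟩ := exists_lintegral_le_wnorm hb
  obtain ⟨M, hM, -, hfin⟩ := hF.exists_isMajorant
  have hMm := hM.meas
  have hMi : ∫⁻ τ, M τ < ⊤ := (hC' M hMm).trans_lt (ENNReal.mul_lt_top ENNReal.coe_lt_top hfin)
  have hc := continuous_cexp2
  refine ⟨timeSlice F, fun t _ => ⟨hu t, (hC F hF.aesm t).trans_lt
    (ENNReal.mul_lt_top ENNReal.coe_lt_top hF.lt_top)⟩, fun s _ => ?_⟩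
  have hbound : ∀ t, weightedSup μ (fun ξ => cexp2 (-(t * omega ξ)) * timeSlice F t ξ -
      cexp2 (-(s * omega ξ)) * timeSlice F s ξ) ≤
      ∫⁻ x, ‖cexp2 (t * x) - cexp2 (s * x)‖ₑ * M x := by
    intro t
    refine weightedSup_le_of_ae ?_
    filter_upwards [hF.ae_integrable hb, hM.slice] with ξ h1 ⟨_, h2⟩
    have e : ∀ r τ : ℝ, cexp2 (-(r * omega ξ)) * (cexp2 (r * τ) * F (τ, ξ)) =
        cexp2 (r * (τ - omega ξ)) * F (τ, ξ) := fun r τ => by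
      rw [← mul_assoc, ← cexp2_add]; congr 2; ring
    rw [timeSlice, timeSlice, ← integral_const_mul, ← integral_const_mul,
      ← integral_sub ((integrable_cexp2_mul h1 t).const_mul _)
        ((integrable_cexp2_mul h1 s).const_mul _)]
    simp only [e, ← sub_mul]
    refine (enorm_integral_le_lintegral_enorm _).trans ?_
    calc _ ≤ ∫⁻ τ, jb ξ ^ (-μ) * (‖cexp2 (t * (τ - omega ξ)) - cexp2 (s * (τ - omega ξ))‖ₑ *
            M (τ - omega ξ)) := by
          refine lintegral_mono_ae ?_
          filter_upwards [h2] with τ hτ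
          rw [enorm_mul, mul_left_comm]
          gcongr
      _ = _ := by
          rw [lintegral_const_mul' _ _ (jb_rpow_ne_top _ _), lintegral_sub_right_eq_self
            (fun x => ‖cexp2 (t * x) - cexp2 (s * x)‖ₑ * M x)]
  have hlim : Tendsto (fun t => ∫⁻ x, ‖cexp2 (t * x) - cexp2 (s * x)‖ₑ * M x)
      (𝓝[Icc (-T) T] s) (𝓝 (∫⁻ _ : ℝ, 0)) := by
    refine tendsto_lintegral_filter_of_dominated_convergence (fun x => 2 * M x)
      (Eventually.of_forall fun t => by fun_prop) (Eventually.of_forall fun t =>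
        ae_of_all _ fun x => ?_) ?_ ?_
    · gcongr
      refine enorm_sub_le.trans (le_of_eq ?_)
      rw [enorm_cexp2, enorm_cexp2, one_add_one_eq_two]
    · rw [lintegral_const_mul _ hMm]
      exact ENNReal.mul_ne_top (by simp) hMi.ne
    · filter_upwards [ae_lt_top hMm hMi.ne] with x hx
      have h1 : Tendsto (fun t => ‖cexp2 (t * x) - cexp2 (s * x)‖ₑ) (𝓝[Icc (-T) T] s)
          (𝓝 ‖cexp2 (s * x) - cexp2 (s * x)‖ₑ) :=
        ((by fun_prop : Continuous fun t => ‖cexp2 (t * x) - cexp2 (s * x)‖ₑ).tendsto s).mono_left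
          nhdsWithin_le_nhds
      rw [sub_self, enorm_zero] at h1
      simpa using ENNReal.Tendsto.mul_const h1 (Or.inr hx.ne)
  rw [lintegral_zero] at hlim
  exact tendsto_of_tendsto_of_tendsto_of_le_of_le tendsto_const_nhds hlim (fun _ => zero_le) hbound

/-- The content of `IsSolution` at the level of extensions. -/
lemma IsSolution.exists_solvesOn {σ T : ℝ} {u₀ : 𝓢'(ℝ, ℂ)} {u : ℝ → 𝓢'(ℝ, ℂ)}
    (h : IsSolution σ μ b T u₀ u) : ∃ F f₀, InX μ b F ∧ HasFourier u₀ f₀ ∧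
      (∀ t ∈ Icc (-T) T, HasFourier (u t) (timeSlice F t)) ∧ SolvesOn σ (Icc (-T) T) f₀ F := by
  obtain ⟨-, F, ⟨hFm, hFu⟩, hfin, -, -, f₀, hf₀, hsol⟩ := h
  refine ⟨F, f₀, ⟨hFm, hfin⟩, hf₀, hFu, fun t ht => ?_⟩
  filter_upwards [(hFu t ht).unique (hsol t ht)] with ξ hξ
  rw [hξ, duhamel_eq_duhamelInt]

lemma isSolution_of_solvesOn (h : Admissible μ δ b β) {σ T : ℝ} {u₀ : 𝓢'(ℝ, ℂ)}
    {u : ℝ → 𝓢'(ℝ, ℂ)} (hF : InX μ b F) (hf₀ : HasFourier u₀ f₀)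
    (hu : ∀ t, HasFourier (u t) (timeSlice F t)) (hsol : SolvesOn σ (Icc (-T) T) f₀ F)
    (hreal : ∀ t ∈ Icc (-T) T, IsReal (u t)) : IsSolution σ μ b T u₀ u := by
  refine ⟨hreal, F, ⟨hF.aesm, fun t _ => hu t⟩, hF.lt_top, ae_integrable_triIntegrand h hF hF hF,
    fun t _ => ?_, f₀, hf₀, fun t ht => (hu t).congr ?_⟩
  · filter_upwards [ae_integrable_duhamelKernel_mul_nonlin h hF hF hF,
      compl_mem_ae_iff.2 (measure_singleton (0 : ℝ))] with ξ h1 h2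
    have hξ : (2 * Real.pi * ξ * Complex.I : ℂ) ≠ 0 := by
      have : ξ ≠ 0 := h2
      simp [this, Real.pi_ne_zero]
    refine ((h1 t).const_mul (2 * Real.pi * ξ * Complex.I : ℂ)⁻¹).congr (ae_of_all _ fun τ => ?_)
    simp only [nonlin, cubeFourier_eq]
    rw [mul_left_comm (duhamelKernel t τ ξ), inv_mul_cancel_left₀ hξ]
  · filter_upwards [hsol t ht] with ξ hξ
    rw [hξ, duhamel_eq_duhamelInt]

end

end MKdV

end

theorem theorem1 (μ : ℝ) (hμ : 0 < μ) :
    ∃ b : ℝ, 1 / 2 < b ∧ ∀ σ : ℝ, (σ = 1 ∨ σ = -1) →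
      -- uniqueness, on time intervals of any length
      (∀ T : ℝ, 0 < T → ∀ (u₀ : 𝓢'(ℝ, ℂ)) (u v : ℝ → 𝓢'(ℝ, ℂ)),
        MKdV.IsSolution σ μ b T u₀ u → MKdV.IsSolution σ μ b T u₀ v →
          ∀ t ∈ Icc (-T) T, u t = v t) ∧
      ∀ R : ℝ, 0 < R → ∃ T : ℝ, 0 < T ∧ ∃ C : ℝ≥0,
        -- existence and persistence
        (∀ u₀ : 𝓢'(ℝ, ℂ), MKdV.IsReal u₀ → MKdV.normFL μ u₀ ≤ ENNReal.ofReal R →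
          ∃ u : ℝ → 𝓢'(ℝ, ℂ), MKdV.IsSolution σ μ b T u₀ u ∧ u 0 = u₀ ∧
            ContinuousOn u (Icc (-T) T) ∧ MKdV.ProfileContinuousOn μ T u) ∧
        -- Lipschitz dependence on the initial datum
        (∀ (u₀ v₀ : 𝓢'(ℝ, ℂ)) (u v : ℝ → 𝓢'(ℝ, ℂ)),
          MKdV.normFL μ u₀ ≤ ENNReal.ofReal R → MKdV.normFL μ v₀ ≤ ENNReal.ofReal R →
          MKdV.IsSolution σ μ b T u₀ u → MKdV.IsSolution σ μ b T v₀ v →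
            MKdV.restrictedNorm μ b T (fun t => u t - v t) ≤ C * MKdV.normFL μ (u₀ - v₀) ∧
            ∀ t ∈ Icc (-T) T, MKdV.normFL μ (u t - v t) ≤ C * MKdV.normFL μ (u₀ - v₀)) := by
  obtain ⟨δ, b, β, h⟩ := MKdV.exists_admissible hμ
  refine ⟨b, h.half_lt, fun σ hσ => ?_⟩
  have hσ1 : ‖(σ : ℂ)‖ₑ ≤ 1 := by
    rcases hσ with rfl | rfl <;> simp
  have hJ : ∀ T : ℝ, (Icc (-T) T).OrdConnected := fun T => ordConnected_Icc
  have h0 : ∀ {T : ℝ}, 0 < T → (0 : ℝ) ∈ Icc (-T) T := fun hT => ⟨by linarith, hT.le⟩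
  refine ⟨fun T hT u₀ u v hu hv t ht => ?_, fun R hR => ?_⟩
  · obtain ⟨F, f₀, hF, hf₀, hFu, hFs⟩ := hu.exists_solvesOn
    obtain ⟨G, g₀, hG, hg₀, hGv, hGs⟩ := hv.exists_solvesOn
    have h1 := hFs.unique h hσ1 (hJ T) (h0 hT) hF hG (hGs.congr (hg₀.unique hf₀)) t ht
    exact ((hFu t ht).congr h1).ext (hGv t ht)
  obtain ⟨C, hC⟩ := MKdV.exists_solution_operator h
  obtain ⟨C', hC'⟩ := MKdV.exists_weightedSup_timeSlice_le (μ := μ) h.half_lt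
  obtain ⟨T, hT, hS⟩ := hC R.toNNReal
  obtain ⟨S, hS, hLip⟩ := hS σ hσ1
  refine ⟨T, hT, C + C' * C, fun u₀ hreal hu₀ => ?_, fun u₀ v₀ u v hu₀ hv₀ hu hv => ?_⟩
  · obtain ⟨f₀, hf₀⟩ := MKdV.exists_hasFourier_of_normFL_lt_top
      (hu₀.trans_lt ENNReal.ofReal_lt_top)
    rw [MKdV.normFL_eq hf₀] at hu₀
    obtain ⟨hF, hsol⟩ := hS f₀ hf₀.1 hu₀
    obtain ⟨u, hu, hcont⟩ := hF.exists_curve hμ.le h.half_lt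
    have hherm := hsol.hermitian h hσ1 (hJ T) (h0 hT) hF
      ((MKdV.hasFourier_sharp_of_isReal hreal hf₀).unique hf₀)
    exact ⟨u, MKdV.isSolution_of_solvesOn h hF hf₀ hu hsol fun t ht =>
      MKdV.isReal_of_hasFourier (hu t) (hherm t ht),
      ((hu 0).congr (hsol.zero (h0 hT))).ext hf₀, hcont.continuousOn,
      hF.profileContinuousOn h.half_lt hu T⟩
  · obtain ⟨F, f₀, hF, hf₀, hFu, hFs⟩ := hu.exists_solvesOn
    obtain ⟨G, g₀, hG, hg₀, hGv, hGs⟩ := hv.exists_solvesOn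
    rw [MKdV.normFL_eq hf₀] at hu₀
    rw [MKdV.normFL_eq hg₀] at hv₀
    obtain ⟨hF', hFs'⟩ := hS f₀ hf₀.1 hu₀
    obtain ⟨hG', hGs'⟩ := hS g₀ hg₀.1 hv₀
    have hd := hLip f₀ g₀ hf₀.1 hg₀.1 hu₀ hv₀
    rw [MKdV.normFL_eq (hf₀.sub hg₀)]
    -- the constructed extensions are also extensions of the given solutions
    have hext : ∀ t ∈ Icc (-T) T, MKdV.HasFourier (u t - v t)
        (MKdV.timeSlice (fun q => S f₀ q - S g₀ q) t) := by
      intro t ht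
      refine ((hFu t ht).sub (hGv t ht)).congr ?_
      filter_upwards [hFs.unique h hσ1 (hJ T) (h0 hT) hF hF' hFs' t ht,
        hGs.unique h hσ1 (hJ T) (h0 hT) hG hG' hGs' t ht,
        MKdV.timeSlice_sub h.half_lt hF' hG'] with ξ h1 h2 h3
      rw [h1, h2, h3]
    refine ⟨(iInf₂_le _ ⟨(hF'.sub hG').aesm, hext⟩).trans (hd.trans ?_), fun t ht => ?_⟩
    · gcongr
      exact le_self_add
    · rw [MKdV.normFL_eq (hext t ht)]
      refine (hC' _ (hF'.sub hG').aesm t).trans ((mul_le_mul_right hd _).trans ?_)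
      rw [← mul_assoc]
      gcongr
      push_cast
      exact le_add_self
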